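/- Let $d\in\mathbb N$, $1<p<\infty$, $a<b$ real. Write $\mathcal M_{loc}(\mathbb R^d)$ for the signed Radon measures on $\mathbb R^d$ (differences of two mutually singular locally finite Borel measures), with the weak$^*$ topology, i.e. the coarsest topology making $\mu\mapsto\int\zeta\,d\mu$ continuous for all $\zeta\in C_c(\mathbb R^d)$; $\mathcal M_{loc}(\mathbb R^d;\mathbb R^d)$ denotes the $\mathbb R^d$-valued Radon measures. Let $\phi:\mathbb R\times\mathbb R^d\to[0,+\infty]$ belong to $\mathcal A_p(a,b)$: $\phi$ is proper, convex, lower semicontinuous; for every $\rho$ such that $\phi(\rho,\cdot)\not\equiv+\infty$ one has $\phi(\rho,0)=0$ and $\phi(\rho,\lambda w)=|\lambda|^p\phi(\rho,w)$ for all $\lambda\neq0$, $w\in\mathbb R^d$; there is $\rho_0$ with $\phi(\rho_0,w)<\infty$ for all $w$ and $\phi(\rho_0,w)>0$ for all $w\ne0$; and the interior of $\mathrm{dom}(\phi)=\{\phi<\infty\}$ is $(a,b)\times\mathbb R^d$. Let $\phi^\infty(y)=\sup_{x\in\mathrm{dom}(\phi)}(\phi(x+y)-\phi(x))$ be its recession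 functional. Let $\gamma$ be a nonnegative Radon measure on $\mathbb R^d$. For $\mu\in\mathcal M_{loc}(\mathbb R^d)$ and $\nu\in\mathcal M_{loc}(\mathbb R^d;\mathbb R^d)$ with Lebesgue decompositions $\mu=\rho\gamma+\mu^\perp$, $\nu=w\gamma+\nu^\perp$, and with $\mu^\perp=\rho^\perp\sigma$, $\nu^\perp=w^\perp\sigma$ for $\sigma=|\mu^\perp|+\sum_i|\nu_i^\perp|$, put $$\Phi(\mu,\nu|\gamma)=\int\phi(\rho,w)\,d\gamma+\int\phi^\infty(\rho^\perp,w^\perp)\,d\sigma .$$ Let $\mathcal{CE}_{\phi,\gamma}(0,1;\mu^0\to\mu^1)$ be the set of pairs $(\mu_t,\nu_t)_{t\in[0,1]}$ such that $t\mapsto\mu_t\in\mathcal M_{loc}(\mathbb R^d)$ is weakly$^*$ continuous on $[0,1]$, $(\nu_t)$ is a Borel family in $\mathcal M_{loc}(\mathbb R^d;\mathbb R^d)$, $\int_0^1|\mu_t|(B(0,R))\,dt<\infty$ and $\int_0^1|\nu_t|(B(0,R))\,dt<\infty$ for all $R>0$, $$\int_0^1\!\int\partial_t\zeta\,d\mu_t\,dt+\int_0^1\!\int\nabla_x\zeta\cdot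 d\nu_t\,dt=0\qquad\text{for all }\zeta\in C^1_c(\mathbb R^d\times(0,1)),$$ $\mu_0=\mu^0$, $\mu_1=\mu^1$ (at times $t=0$ and $t=1$), and $\int_0^1\Phi(\mu_t,\nu_t|\gamma)\,dt<\infty$. Define $$\mathcal W_{\phi,\gamma}(\mu^0,\mu^1)=\inf\Big\{\Big(\int_0^1\Phi(\mu_t,\nu_t|\gamma)\,dt\Big)^{1/p}:(\mu,\nu)\in\mathcal{CE}_{\phi,\gamma}(0,1;\mu^0\to\mu^1)\Big\}\in[0,+\infty],\qquad \inf\emptyset=+\infty .$$ Then: 1. $\mathcal W_{\phi,\gamma}$ is a pseudo-distance (a distance that may take the value $+\infty$) in the following sense. For all $\mu_0,\mu_1,\mu_2\in\mathcal M_{loc}(\mathbb R^d)$: $\mathcal W_{\phi,\gamma}(\mu_0,\mu_1)=\mathcal W_{\phi,\gamma}(\mu_1,\mu_0)$; $\mathcal W_{\phi,\gamma}(\mu_0,\mu_2)\le\mathcal W_{\phi,\gamma}(\mu_0,\mu_1)+\mathcal W_{\phi,\gamma}(\mu_1,\mu_2)$; and $\mathcal W_{\phi,\gamma}(\mu_0,\mu_1)=0$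 implies $\mu_0=\mu_1$. Moreover $\mathcal W_{\phi,\gamma}(\mu,\mu)=0$ for every $\mu$ with $a\gamma\le\mu\le b\gamma$, while every other $\mu$ satisfies $\mathcal W_{\phi,\gamma}(\mu,\nu)=+\infty$ for all $\nu$ (including $\nu=\mu$). 2. The topology induced by $\mathcal W_{\phi,\gamma}$ on $\mathcal M_{loc}(\mathbb R^d)$ ($U$ is open iff for each $\mu\in U$ there is $\varepsilon>0$ such that $\mathcal W_{\phi,\gamma}(\mu,\nu)<\varepsilon$ implies $\nu\in U$) is stronger than or equal to the weak$^*$ topology. 3. Every subset of $\mathcal M_{loc}(\mathbb R^d)$ that is bounded with respect to $\mathcal W_{\phi,\gamma}$, i.e. contained in $\{\mu:\mathcal W_{\phi,\gamma}(\sigma,\mu)\le R\}$ for some $\sigma\in\mathcal M_{loc}(\mathbb R^d)$ and $R<\infty$, is weakly$^*$ relatively compact. -/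

import Mathlib

open MeasureTheory Set
open scoped ENNReal NNReal

noncomputable section

namespace GenWass

/-- Euclidean space `ℝ^d`. -/
abbrev E (d : ℕ) := EuclideanSpace ℝ (Fin d)

/-- A signed Radon measure on `ℝ^d` (possibly of infinite total variation), given by its Jordan
decomposition into two mutually singular locally finite Borel measures.  (Every locally finite
Borel measure on `ℝ^d` is Radon.) -/
@[ext]
structure SignedRadon (d : ℕ) where
  pos : Measure (E d)
  neg : Measure (E d)
  pos_lf : IsLocallyFiniteMeasure pos
  neg_lf : IsLocallyFiniteMeasure neg
  sing : pos ⟂ₘ neg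

attribute [instance] SignedRadon.pos_lf SignedRadon.neg_lf

namespace SignedRadon

variable {d : ℕ}

/-- The value `μ(A)` on a bounded Borel set `A`. -/
def val (μ : SignedRadon d) (A : Set (E d)) : ℝ := μ.pos.real A - μ.neg.real A

/-- The total variation `|μ|`. -/
def variation (μ : SignedRadon d) : Measure (E d) := μ.pos + μ.neg

/-- The integral `∫ f dμ` (used for continuous compactly supported `f` only). -/
def integral (μ : SignedRadon d) (f : E d → ℝ) : ℝ := ∫ x, f x ∂μ.pos - ∫ x, f x ∂μ.neg

/-- The density with respect to a measure `σ` of the part of `μ` absolutely continuous with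
respect to `σ`. -/
def density (μ : SignedRadon d) (σ : Measure (E d)) (x : E d) : ℝ :=
  (μ.pos.rnDeriv σ x).toReal - (μ.neg.rnDeriv σ x).toReal

/-- The singular part `μ^⊥` of `μ` in its Lebesgue decomposition with respect to `γ`. -/
def singularPart (μ : SignedRadon d) (γ : Measure (E d)) : SignedRadon d where
  pos := μ.pos.singularPart γ
  neg := μ.neg.singularPart γ
  pos_lf := inferInstance
  neg_lf := inferInstance
  sing := μ.sing.mono_ac (Measure.absolutelyContinuous_of_le (Measure.singularPart_le μ.pos γ))
    (Measure.absolutelyContinuous_of_le (Measure.singularPart_le μ.neg γ))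

/-- The weak* topology: the coarsest one for which `μ ↦ ∫ ζ dμ` is continuous for every
continuous compactly supported `ζ`. -/
instance weakStar : TopologicalSpace (SignedRadon d) :=
  TopologicalSpace.induced
    (fun μ (ζ : CompactlySupportedContinuousMap (E d) ℝ) => μ.integral ζ) Pi.topologicalSpace

/-- `a γ ≤ μ ≤ b γ`, tested on bounded Borel sets; that is, `μ = ρ γ` with `a ≤ ρ ≤ b`. -/
def Between (a b : ℝ) (γ : Measure (E d)) (μ : SignedRadon d) : Prop :=
  ∀ A : Set (E d), MeasurableSet A → Bornology.IsBounded A →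
    a * γ.real A ≤ μ.val A ∧ μ.val A ≤ b * γ.real A

end SignedRadon

/-- An `ℝ^d`-valued Radon measure on `ℝ^d`, given by its `d` components. -/
abbrev VectorRadon (d : ℕ) := Fin d → SignedRadon d

/-- The vector of the densities of the components. -/
def VectorRadon.density {d : ℕ} (ν : VectorRadon d) (σ : Measure (E d)) (x : E d) : E d :=
  WithLp.toLp 2 (fun i => (ν i).density σ x)

/-- The singular part `ν^⊥` with respect to `γ`, taken componentwise. -/
def VectorRadon.singularPart {d : ℕ} (ν : VectorRadon d) (γ : Measure (E d)) : VectorRadon d :=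
  fun i => (ν i).singularPart γ

/-- The effective domain of an extended nonnegative function. -/
def dom {X : Type*} (f : X → ℝ≥0∞) : Set X := {x | f x ≠ ⊤}

/-- Admissible action densities of order `p`. -/
structure IsActionDensity {d : ℕ} (p : ℝ) (φ : ℝ × E d → ℝ≥0∞) : Prop where
  lsc : LowerSemicontinuous φ
  proper : (dom φ).Nonempty
  convex : ConvexOn ℝ≥0 univ φ
  homogeneous : ∀ ρ : ℝ, (∃ w : E d, (ρ, w) ∈ dom φ) →
    φ (ρ, 0) = 0 ∧
      ∀ l : ℝ, l ≠ 0 → ∀ w : E d, φ (ρ, l • w) = ENNReal.ofReal (|l| ^ p) * φ (ρ, w)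
  nondegenerate : ∃ ρ₀ : ℝ, ∀ w : E d, (ρ₀, w) ∈ dom φ ∧ (w ≠ 0 → 0 < φ (ρ₀, w))

/-- Admissible action densities of order `p` whose domain has interior `(a,b) × ℝ^d`. -/
structure IsActionDensityOn {d : ℕ} (p a b : ℝ) (φ : ℝ × E d → ℝ≥0∞) : Prop
    extends IsActionDensity p φ where
  interior_dom : interior (dom φ) = Ioo a b ×ˢ univ

/-- The recession functional `φ^∞(y) = sup {φ(x + y) - φ(x) : x ∈ dom φ}`.  Since `φ ≥ 0` is
convex, this supremum is nonnegative, so truncating the subtraction at `0` does not change it. -/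
def recession {d : ℕ} (φ : ℝ × E d → ℝ≥0∞) (y : ℝ × E d) : ℝ≥0∞ :=
  ⨆ x ∈ dom φ, (φ (x + y) - φ x)

/-- The action functional `Φ(μ,ν|γ) = ∫ φ(ρ,w) dγ + ∫ φ^∞(ρ^⊥,w^⊥) dσ`, where `μ = ρ γ + μ^⊥` and
`ν = w γ + ν^⊥` are the Lebesgue decompositions, `σ = |μ^⊥| + ∑ᵢ |νᵢ^⊥|`, and `μ^⊥ = ρ^⊥ σ`,
`ν^⊥ = w^⊥ σ`. -/
def action {d : ℕ} (φ : ℝ × E d → ℝ≥0∞) (γ : Measure (E d)) (μ : SignedRadon d)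
    (ν : VectorRadon d) : ℝ≥0∞ :=
  let σ : Measure (E d) :=
    (μ.singularPart γ).variation + ∑ i, (ν.singularPart γ i).variation
  ∫⁻ x, φ (μ.density γ x, ν.density γ x) ∂γ +
    ∫⁻ x, recession φ ((μ.singularPart γ).density σ x, (ν.singularPart γ).density σ x) ∂σ

/-- The class `CE(0,T)` of solutions of `∂ₜ μₜ + div νₜ = 0` in `ℝ^d × (0,T)`; only the values of
the families at times in `[0,T]` matter.  For `ν`, finiteness of `∫₀ᵀ |νₜ|(B(0,R)) dt` is expressed
by that of its components, which is equivalent. -/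
structure IsCE {d : ℕ} (T : ℝ) (μ : ℝ → SignedRadon d) (ν : ℝ → VectorRadon d) : Prop where
  continuousOn : ContinuousOn μ (Icc 0 T)
  borel : ∀ i, ∀ A : Set (E d), MeasurableSet A → Bornology.IsBounded A →
    Measurable (fun t : Ioo (0 : ℝ) T => (ν t i).val A)
  finite_left : ∀ R : ℝ, 0 < R →
    ∫⁻ t in Ioo 0 T, (μ t).variation (Metric.ball 0 R) < ⊤
  finite_right : ∀ R : ℝ, 0 < R → ∀ i,
    ∫⁻ t in Ioo 0 T, (ν t i).variation (Metric.ball 0 R) < ⊤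
  equation : ∀ ζ : E d × ℝ → ℝ, ContDiff ℝ 1 ζ → HasCompactSupport ζ →
    tsupport ζ ⊆ univ ×ˢ Ioo 0 T →
    (∫ t in Ioo 0 T, (μ t).integral (fun x => deriv (fun s => ζ (x, s)) t)) +
      (∫ t in Ioo 0 T, ∑ i, (ν t i).integral
        (fun x => fderiv ℝ (fun y => ζ (y, t)) x (EuclideanSpace.single i 1))) = 0

/-- The class of solutions on `[0,T]` with finite energy connecting `μ₀` to `μ₁`. -/
def finiteEnergyCE {d : ℕ} (φ : ℝ × E d → ℝ≥0∞) (γ : Measure (E d)) (T : ℝ)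
    (μ₀ μ₁ : SignedRadon d) : Set ((ℝ → SignedRadon d) × (ℝ → VectorRadon d)) :=
  {c | IsCE T c.1 c.2 ∧ c.1 0 = μ₀ ∧ c.1 T = μ₁ ∧
    ∫⁻ t in Ioo 0 T, action φ γ (c.1 t) (c.2 t) < ⊤}

/-- The modified Wasserstein distance; it is `⊤` when there is no connecting curve. -/
def W {d : ℕ} (p : ℝ) (φ : ℝ × E d → ℝ≥0∞) (γ : Measure (E d)) (μ₀ μ₁ : SignedRadon d) : ℝ≥0∞ :=
  ⨅ c ∈ finiteEnergyCE φ γ 1 μ₀ μ₁, (∫⁻ t in Ioo 0 1, action φ γ (c.1 t) (c.2 t)) ^ (1 / p)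

/-- The topology induced by `W`: a set is open iff with each of its points it contains a ball
`{ν : W(μ,ν) < ε}`, `ε > 0`. -/
abbrev topologyW {d : ℕ} (p : ℝ) (φ : ℝ × E d → ℝ≥0∞) (γ : Measure (E d)) :
    TopologicalSpace (SignedRadon d) where
  IsOpen U := ∀ μ ∈ U, ∃ ε : ℝ≥0∞, 0 < ε ∧ ∀ ν, W p φ γ μ ν < ε → ν ∈ U
  isOpen_univ := fun _ _ => ⟨1, one_pos, fun _ _ => mem_univ _⟩
  isOpen_inter := by
    rintro U V hU hV μ ⟨hμU, hμV⟩
    obtain ⟨ε, hε, h⟩ := hU μ hμU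
    obtain ⟨δ, hδ, h'⟩ := hV μ hμV
    exact ⟨min ε δ, lt_min hε hδ, fun ν hν =>
      ⟨h ν (hν.trans_le (min_le_left _ _)), h' ν (hν.trans_le (min_le_right _ _))⟩⟩
  isOpen_sUnion := by
    rintro S hS μ ⟨U, hU, hμ⟩
    obtain ⟨ε, hε, h⟩ := hS U hU μ hμ
    exact ⟨ε, hε, fun ν hν => ⟨U, hU, h ν hν⟩⟩

/-- A set is bounded for `W` if it lies in a ball of finite radius. -/
def BoundedW {d : ℕ} (p : ℝ) (φ : ℝ × E d → ℝ≥0∞) (γ : Measure (E d))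
    (B : Set (SignedRadon d)) : Prop :=
  ∃ σ : SignedRadon d, ∃ R : ℝ≥0∞, R < ⊤ ∧ ∀ μ ∈ B, W p φ γ σ μ ≤ R

end GenWass

end

/-! Two properties of `φ` carry the proof. First, its recession functional is `0` at the origin and
`⊤` everywhere else (`IsActionDensityOn.recession_eq_top`), because `dom φ` lies over `[a,b]` and
`φ` grows like the `p`-th power, `p > 1`, in `w`. Finite action therefore forces `μ = ρ γ` with `a ≤
ρ ≤ b`, and `ν = w γ` (`ac_of_action_ne_top`, `between_of_action_ne_top`). Second, `φ(ρ,w) ≥ c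
|w|^p` with `c > 0` independent of `ρ` (`IsActionDensityOn.exists_coercive`), so the energy controls
the flux.

The measures with `a γ ≤ μ ≤ b γ` form a weakly* closed and compact set, by Tychonoff and Riesz
(`isClosed_between`, `isCompact_between`). A curve of finite energy lies in it for almost every
time, hence by weak* continuity for every time, end points included. So two measures at finite
distance both belong to this set. This gives the infinite distances outside it and the relative
compactness of bounded sets.

For smooth compactly supported `g`, the continuity equation gives `∫ g dμ₁ - ∫ g dμ₀ = ∫∫ ∇g · dνₜ
dt`. Coercivity together with `|w| ≤ l + l^(1-p) |w|^p` bounds this by `C (l + l^(1-p) E)` for every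
`l > 0`, where `E` is the energy; if `E ≤ l^p` the bound is `2 C l` (`exists_enorm_sub_le`,
`exists_W_lt_smooth`). Uniform approximation extends the control to all of `C_c` (`exists_W_lt`), so
`W` separates points and dominates the weak* topology.

Symmetry is time reversal (`exists_reverse`). For the triangle inequality, two curves are run one
after the other, each for a share of time proportional to its length bound (`exists_concat`,
`W_le_of_lt_of_lt`). The diagonal vanishes by the constant curve with zero flux.

The technical weight lies in measurability in time, obtained from jointly measurable Radon–Nikodym
densities, and in passing from the distributional equation to values at the end points
(`sub_eq_integral_of_weak_deriv`). -/

noncomputable section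

namespace GenWass

/-! ### Action densities: domain, recession functional, coercivity. -/

section ActionDensity

variable {d : ℕ} {p a b : ℝ} {φ : ℝ × E d → ℝ≥0∞}

lemma IsActionDensity.convex_le (hφ : IsActionDensity p φ) {s t : ℝ} (hs : 0 ≤ s) (ht : 0 ≤ t)
    (hst : s + t = 1) (x y : ℝ × E d) :
    φ (s • x + t • y) ≤ ENNReal.ofReal s * φ x + ENNReal.ofReal t * φ y := by
  have := hφ.convex.2 (mem_univ x) (mem_univ y) (zero_le : 0 ≤ s.toNNReal)
    (zero_le : 0 ≤ t.toNNReal) (by rw [← Real.toNNReal_add hs ht, hst, Real.toNNReal_one])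
  simpa only [NNReal.smul_def, Real.coe_toNNReal s hs, Real.coe_toNNReal t ht, ENNReal.smul_def,
    smul_eq_mul, ENNReal.ofReal] using this

lemma IsActionDensity.convex_dom (hφ : IsActionDensity p φ) : Convex ℝ (dom φ) := by
  intro x hx y hy s t hs ht hst
  refine ne_top_of_le_ne_top ?_ (hφ.convex_le hs ht hst x y)
  exact ENNReal.add_ne_top.2 ⟨ENNReal.mul_ne_top ENNReal.ofReal_ne_top hx,
    ENNReal.mul_ne_top ENNReal.ofReal_ne_top hy⟩

lemma IsActionDensity.map_smul (hφ : IsActionDensity p φ) (ρ : ℝ) {l : ℝ} (hl : l ≠ 0) (w : E d) :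
    φ (ρ, l • w) = ENNReal.ofReal (|l| ^ p) * φ (ρ, w) := by
  by_cases h : ∃ w : E d, (ρ, w) ∈ dom φ
  · exact (hφ.homogeneous ρ h).2 l hl w
  · have h' : ∀ w, φ (ρ, w) = ⊤ := fun w => by
      by_contra hw
      exact h ⟨w, hw⟩
    rw [h', h', ENNReal.mul_top]
    have : 0 < |l| ^ p := Real.rpow_pos_of_pos (abs_pos.2 hl) p
    simpa using this

/-- A convex set with nonempty interior lies in the closure of that interior, here `[a,b] × ℝ^d`. -/
lemma IsActionDensityOn.fst_mem_Icc (hφ : IsActionDensityOn p a b φ) (hab : a < b) {ρ : ℝ} {w : E d}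
    (h : φ (ρ, w) ≠ ⊤) : ρ ∈ Icc a b := by
  have hne : (interior (dom φ)).Nonempty := by
    rw [hφ.interior_dom]
    exact (nonempty_Ioo.2 hab).prod univ_nonempty
  have h1 : (ρ, w) ∈ closure (dom φ) := subset_closure h
  rw [← hφ.toIsActionDensity.convex_dom.closure_interior_eq_closure_of_nonempty_interior hne,
    hφ.interior_dom, closure_prod_eq, closure_Ioo hab.ne] at h1
  exact h1.1

lemma IsActionDensityOn.mem_dom (hφ : IsActionDensityOn p a b φ) {ρ : ℝ} (hρ : ρ ∈ Ioo a b)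
    (w : E d) : φ (ρ, w) ≠ ⊤ := by
  have : (ρ, w) ∈ interior (dom φ) := by
    rw [hφ.interior_dom]
    exact ⟨hρ, mem_univ _⟩
  exact interior_subset this

/-- On the open interval this is homogeneity. Lower semicontinuity carries it to `a` and `b`, where
the slice is not assumed to meet the domain. -/
lemma IsActionDensityOn.map_zero (hφ : IsActionDensityOn p a b φ) (hab : a < b) {ρ : ℝ}
    (hρ : ρ ∈ Icc a b) : φ (ρ, 0) = 0 := by
  have hcl : IsClosed {r : ℝ | φ (r, 0) ≤ 0} :=
    (hφ.lsc.isClosed_preimage 0).preimage (by fun_prop : Continuous fun r : ℝ => (r, (0 : E d)))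
  have hsub : Ioo a b ⊆ {r : ℝ | φ (r, 0) ≤ 0} := fun r hr =>
    (hφ.homogeneous r ⟨0, hφ.mem_dom hr 0⟩).1.le
  rw [← closure_Ioo hab.ne] at hρ
  exact le_antisymm (closure_minimal hsub hcl hρ) zero_le

lemma recession_zero (φ : ℝ × E d → ℝ≥0∞) : recession φ 0 = 0 := by
  simp [recession]

/-- A shift with `r ≠ 0` pushes `(a,0)` or `(b,0)` out of the strip over `[a,b]`. For `r = 0` and a
finite value `M`, adding `w` repeatedly gives `φ(ρ₀, n w) ≤ n M`, which contradicts `φ(ρ₀, n w) =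
n^p φ(ρ₀, w)` because `p > 1`. -/
lemma IsActionDensityOn.recession_eq_top (hφ : IsActionDensityOn p a b φ) (hp : 1 < p) (hab : a < b)
    {y : ℝ × E d} (hy : y ≠ 0) : recession φ y = ⊤ := by
  obtain ⟨r, w⟩ := y
  have key : ∀ ρ ∈ Icc a b, ρ + r ∉ Icc a b → recession φ (r, w) = ⊤ := by
    intro ρ hρ hr
    have h0 := hφ.map_zero hab hρ
    have h1 : φ ((ρ, 0) + (r, w)) = ⊤ := by
      by_contra h
      exact hr (hφ.fst_mem_Icc hab h)
    refine top_le_iff.1 (le_trans ?_ (le_iSup₂ (ρ, (0 : E d)) (by simp [dom, h0])))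
    rw [h0, h1]
    simp
  rcases lt_trichotomy r 0 with hr | hr | hr
  · exact key a ⟨le_rfl, hab.le⟩ (fun h => by linarith [h.1])
  · subst hr
    have hw : w ≠ 0 := fun h => hy (by rw [h]; rfl)
    obtain ⟨ρ₀, hρ₀⟩ := hφ.nondegenerate
    by_contra hM
    set M := recession φ (0, w) with hMdef
    have hstep : ∀ v, φ (ρ₀, v + w) ≤ φ (ρ₀, v) + M := by
      intro v
      have h : φ ((ρ₀, v) + (0, w)) - φ (ρ₀, v) ≤ M :=
        le_iSup₂ (f := fun x (_ : x ∈ dom φ) => φ (x + (0, w)) - φ x) (ρ₀, v) (hρ₀ v).1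
      rw [tsub_le_iff_left] at h
      simpa using h
    have h0 : φ (ρ₀, 0) = 0 := (hφ.homogeneous ρ₀ ⟨0, (hρ₀ 0).1⟩).1
    have hn : ∀ n : ℕ, φ (ρ₀, (n : ℝ) • w) ≤ n * M := by
      intro n
      induction n with
      | zero => simp [h0]
      | succ k ih =>
        have := hstep ((k : ℝ) • w)
        rw [show (k : ℝ) • w + w = ((k + 1 : ℕ) : ℝ) • w by push_cast; rw [add_smul, one_smul]] at this
        refine this.trans ((add_le_add_left ih M).trans (le_of_eq ?_))
        push_cast
        ring
    set c := φ (ρ₀, w) with hc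
    have hcpos : 0 < c := (hρ₀ w).2 hw
    have hctop : c ≠ ⊤ := (hρ₀ w).1
    have hreal : ∀ n : ℕ, 0 < n → (n : ℝ) ^ (p - 1) * c.toReal ≤ M.toReal := by
      intro n hnpos
      have hn0 : (0 : ℝ) < n := by exact_mod_cast hnpos
      have h := hn n
      rw [hφ.map_smul ρ₀ hn0.ne' w, abs_of_pos hn0] at h
      have h' := ENNReal.toReal_mono (ENNReal.mul_ne_top (ENNReal.natCast_ne_top n) hM) h
      rw [ENNReal.toReal_mul, ENNReal.toReal_mul, ENNReal.toReal_ofReal (by positivity),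
        ENNReal.toReal_natCast, ← hc] at h'
      rw [Real.rpow_sub hn0, Real.rpow_one, div_mul_eq_mul_div, div_le_iff₀ hn0]
      linarith
    have htend := (tendsto_rpow_atTop (sub_pos.2 hp)).comp (tendsto_natCast_atTop_atTop (R := ℝ))
    obtain ⟨n, hn1, hn2⟩ := ((htend.eventually_gt_atTop (M.toReal / c.toReal)).and
      (Filter.eventually_gt_atTop 0)).exists
    have hcr : 0 < c.toReal := ENNReal.toReal_pos hcpos.ne' hctop
    rw [div_lt_iff₀ hcr] at hn1
    exact absurd (hreal n hn2) (not_le.2 hn1)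
  · exact key b ⟨hab.le, le_rfl⟩ (fun h => by linarith [h.2])

lemma IsActionDensityOn.recession_eq (hφ : IsActionDensityOn p a b φ) (hp : 1 < p) (hab : a < b) :
    recession φ = ({0}ᶜ : Set (ℝ × E d)).indicator (fun _ => ⊤) := by
  ext y
  by_cases hy : y = 0
  · simp [hy, recession_zero]
  · simp [hy, hφ.recession_eq_top hp hab hy]

/-- The nondegenerate `ρ₀` may be an end point of `[a,b]`. Positivity is an open condition and the
unit sphere is compact, so it persists at nearby interior points; homogeneity then covers all `w ≠
0`. -/
lemma IsActionDensityOn.exists_pos_of_ne_zero (hφ : IsActionDensityOn p a b φ) (hab : a < b) :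
    ∃ ρ ∈ Ioo a b, ∀ w : E d, w ≠ 0 → 0 < φ (ρ, w) := by
  obtain ⟨ρ₀, hρ₀⟩ := hφ.nondegenerate
  have hopen : IsOpen {x : ℝ × E d | 0 < φ x} := hφ.lsc.isOpen_preimage 0
  obtain ⟨u, v, hu, -, hρu, hv, huv⟩ := generalized_tube_lemma (isCompact_singleton (x := ρ₀))
    (isCompact_sphere (0 : E d) 1) hopen (by
      rintro ⟨r, w⟩ ⟨hr, hw⟩
      obtain rfl : r = ρ₀ := hr
      refine (hρ₀ w).2 ?_
      rintro rfl
      simp at hw)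
  have hcl : ρ₀ ∈ closure (Ioo a b) := by
    rw [closure_Ioo hab.ne]
    exact hφ.fst_mem_Icc hab (hρ₀ 0).1
  obtain ⟨ρ, hρu', hρ⟩ := mem_closure_iff.1 hcl u hu (hρu rfl)
  refine ⟨ρ, hρ, fun w hw => ?_⟩
  have hn : 0 < ‖w‖ := norm_pos_iff.2 hw
  have h1 : 0 < φ (ρ, ‖w‖⁻¹ • w) := huv ⟨hρu', hv (by
    simp [norm_smul, hn.ne'])⟩
  rw [hφ.map_smul ρ (inv_ne_zero hn.ne')] at h1
  exact pos_of_ne_zero (right_ne_zero_of_mul h1.ne')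

/-- Coercivity of an action density in its second argument. -/
lemma IsActionDensityOn.exists_coercive (hφ : IsActionDensityOn p a b φ) (hp : 1 < p) (hab : a < b) :
    ∃ c : ℝ, 0 < c ∧ ∀ (ρ : ℝ) (w : E d), ENNReal.ofReal (c * ‖w‖ ^ p) ≤ φ (ρ, w) := by
  obtain ⟨ρ₁, hρ₁, hpos⟩ := hφ.exists_pos_of_ne_zero hab
  -- For `d = 0` the sphere is empty and any positive constant serves.
  have hsphere : ∃ m : ℝ, 0 < m ∧ ∀ w ∈ Metric.sphere (0 : E d) 1, ENNReal.ofReal m ≤ φ (ρ₁, w) := by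
    rcases (Metric.sphere (0 : E d) 1).eq_empty_or_nonempty with he | hne
    · exact ⟨1, one_pos, by simp [he]⟩
    · have hl : LowerSemicontinuous fun w : E d => φ (ρ₁, w) :=
        hφ.lsc.comp (by fun_prop)
      obtain ⟨w₀, hw₀, hmin⟩ := (hl.lowerSemicontinuousOn _).exists_isMinOn hne
        (isCompact_sphere (0 : E d) 1)
      have h0 : w₀ ≠ 0 := by
        rintro rfl
        simp at hw₀
      have ht := hφ.mem_dom hρ₁ w₀
      refine ⟨(φ (ρ₁, w₀)).toReal, ENNReal.toReal_pos (hpos w₀ h0).ne' ht, fun w hw => ?_⟩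
      rw [ENNReal.ofReal_toReal ht]
      exact hmin hw
  obtain ⟨m, hm, hmle⟩ := hsphere
  have hρ₁le : ∀ w : E d, ENNReal.ofReal (m * ‖w‖ ^ p) ≤ φ (ρ₁, w) := by
    intro w
    rcases eq_or_ne w 0 with rfl | hw
    · simp [Real.zero_rpow (by linarith : p ≠ 0)]
    · have hn : 0 < ‖w‖ := norm_pos_iff.2 hw
      have h := hφ.map_smul ρ₁ hn.ne' (‖w‖⁻¹ • w)
      rw [smul_inv_smul₀ hn.ne', abs_of_pos hn] at h
      rw [h, mul_comm, ENNReal.ofReal_mul (by positivity)]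
      gcongr
      exact hmle _ (by simp [norm_smul, hn.ne'])
  -- The point `(ρ₁, r w)` is written as `r (ρ, w) + (1 - r)(ρ', 0)`. The choice `r = δ / (b - a)`
  -- keeps `ρ'` in `[a,b]` for every `ρ ∈ [a,b]`. Since `φ(ρ', 0) = 0`, convexity gives `m r^p |w|^p
  -- ≤ r φ(ρ, w)`, which explains the constant `m r^(p-1)`.
  set δ := min (ρ₁ - a) (b - ρ₁) with hδ
  have hδa : δ ≤ ρ₁ - a := min_le_left _ _
  have hδb : δ ≤ b - ρ₁ := min_le_right _ _
  have hδ0 : 0 < δ := lt_min (sub_pos.2 hρ₁.1) (sub_pos.2 hρ₁.2)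
  have hba : 0 < b - a := sub_pos.2 hab
  set r := δ / (b - a) with hr
  have hr0 : 0 < r := div_pos hδ0 hba
  have hr1 : r < 1 := by rw [hr, div_lt_one hba]; linarith
  have hrba : r * (b - a) = δ := div_mul_cancel₀ _ hba.ne'
  refine ⟨m * r ^ (p - 1), by positivity, fun ρ w => ?_⟩
  by_cases htop : φ (ρ, w) = ⊤
  · simp [htop]
  have hρ := hφ.fst_mem_Icc hab htop
  have hmem : (ρ₁ - r * ρ) / (1 - r) ∈ Icc a b := by
    constructor
    · rw [le_div_iff₀ (by linarith)]
      nlinarith [mul_le_mul_of_nonneg_left hρ.2 hr0.le]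
    · rw [div_le_iff₀ (by linarith)]
      nlinarith [mul_le_mul_of_nonneg_left hρ.1 hr0.le]
  have hconv := hφ.convex_le hr0.le (sub_nonneg.2 hr1.le) (by ring) (ρ, w)
    ((ρ₁ - r * ρ) / (1 - r), (0 : E d))
  rw [hφ.map_zero hab hmem, mul_zero, add_zero] at hconv
  have hpt : r • (ρ, w) + (1 - r) • ((ρ₁ - r * ρ) / (1 - r), (0 : E d)) = (ρ₁, r • w) := by
    ext1
    · have : 1 - r ≠ 0 := by linarith
      simp
      field_simp
      ring
    · simp
  rw [hpt] at hconv
  have h2 := (hρ₁le (r • w)).trans hconv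
  rw [norm_smul, Real.norm_of_nonneg hr0.le, Real.mul_rpow hr0.le (norm_nonneg _),
    show m * (r ^ p * ‖w‖ ^ p) = r * (m * r ^ (p - 1) * ‖w‖ ^ p) by
      rw [Real.rpow_sub hr0, Real.rpow_one]; field_simp,
    ENNReal.ofReal_mul hr0.le] at h2
  exact (ENNReal.mul_le_mul_iff_right (by simpa using hr0) ENNReal.ofReal_ne_top).1 h2

end ActionDensity

/-! ### Locally finite measures on Euclidean space. -/

section Measure

variable {d : ℕ}

instance isLocallyFiniteMeasure_add {X : Type*} [TopologicalSpace X] [MeasurableSpace X]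
    (m n : Measure X) [IsLocallyFiniteMeasure m] [IsLocallyFiniteMeasure n] :
    IsLocallyFiniteMeasure (m + n) := by
  refine ⟨fun x => ?_⟩
  obtain ⟨s, hs, hms⟩ := m.finiteAt_nhds x
  obtain ⟨t, ht, hnt⟩ := n.finiteAt_nhds x
  refine ⟨s ∩ t, Filter.inter_mem hs ht, ?_⟩
  rw [Measure.add_apply]
  exact ENNReal.add_lt_top.2 ⟨(measure_mono inter_subset_left).trans_lt hms,
    (measure_mono inter_subset_right).trans_lt hnt⟩

instance isLocallyFiniteMeasure_finset_sum {X ι : Type*} [TopologicalSpace X] [MeasurableSpace X]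
    (s : Finset ι) (m : ι → Measure X) [∀ i, IsLocallyFiniteMeasure (m i)] :
    IsLocallyFiniteMeasure (∑ i ∈ s, m i) := by
  classical
  induction s using Finset.induction_on with
  | empty => simpa using (inferInstance : IsLocallyFiniteMeasure (0 : Measure X))
  | insert i s hi ih =>
    rw [Finset.sum_insert hi]
    infer_instance

lemma measure_lt_top_of_isBounded (m : Measure (E d)) [IsLocallyFiniteMeasure m] {A : Set (E d)}
    (hA : Bornology.IsBounded A) : m A < ⊤ :=
  hA.measure_lt_top

/-- Locally finite measures on `ℝ^d` are compared by testing with continuous functions. -/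
lemma measure_le_of_integral_le {m n : Measure (E d)} [IsLocallyFiniteMeasure m]
    [IsLocallyFiniteMeasure n]
    (h : ∀ ζ : CompactlySupportedContinuousMap (E d) ℝ, (∀ x, 0 ≤ ζ x) →
      ∫ x, ζ x ∂m ≤ ∫ x, ζ x ∂n) : m ≤ n := by
  have hopen : ∀ U : Set (E d), IsOpen U → m U ≤ n U := by
    intro U hU
    refine le_of_forall_lt fun r hr => ?_
    obtain ⟨K, hKU, hK, hrK⟩ := hU.exists_lt_isCompact hr
    refine hrK.trans_le ?_
    obtain ⟨f, hf1, hfc, hfU, hf01⟩ := exists_continuousMap_one_of_isCompact_subset_isOpen hK hU hKU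
    have hfU0 : ∀ x, x ∉ U → f x = 0 := fun x hx => image_eq_zero_of_notMem_tsupport
      fun hx' => hx (hfU hx')
    have hmi : Integrable f m := f.continuous.integrable_of_hasCompactSupport hfc
    have hni : Integrable f n := f.continuous.integrable_of_hasCompactSupport hfc
    calc m K = ∫⁻ x, K.indicator 1 x ∂m := (lintegral_indicator_one hK.measurableSet).symm
      _ ≤ ∫⁻ x, ENNReal.ofReal (f x) ∂m := lintegral_mono fun x => by
          by_cases hx : x ∈ K
          · simp [hx, hf1 hx]
          · simp [hx]
      _ = ENNReal.ofReal (∫ x, f x ∂m) :=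
          (ofReal_integral_eq_lintegral_ofReal hmi (ae_of_all _ fun x => (hf01 x).1)).symm
      _ ≤ ENNReal.ofReal (∫ x, f x ∂n) := ENNReal.ofReal_le_ofReal
          (h ⟨f, hfc⟩ fun x => (hf01 x).1)
      _ = ∫⁻ x, ENNReal.ofReal (f x) ∂n :=
          ofReal_integral_eq_lintegral_ofReal hni (ae_of_all _ fun x => (hf01 x).1)
      _ ≤ ∫⁻ x, U.indicator 1 x ∂n := lintegral_mono fun x => by
          by_cases hx : x ∈ U
          · simpa [hx] using (hf01 x).2
          · simp [hx, hfU0 x hx]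
      _ = n U := lintegral_indicator_one hU.measurableSet
  refine Measure.le_iff'.2 fun A => ?_
  refine le_of_forall_gt fun r hr => ?_
  obtain ⟨U, hAU, hU, hUr⟩ := exists_isOpen_lt_of_lt A r hr
  exact ((measure_mono hAU).trans (hopen U hU)).trans_lt hUr

lemma ae_of_forall_restrict_ball {m : Measure (E d)} {P : E d → Prop}
    (h : ∀ n : ℕ, ∀ᵐ x ∂m.restrict (Metric.ball 0 n), P x) : ∀ᵐ x ∂m, P x := by
  have : ∀ᵐ x ∂m.restrict (⋃ n : ℕ, Metric.ball (0 : E d) n), P x :=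
    ae_restrict_iUnion_iff _ _ |>.2 h
  rwa [Metric.iUnion_ball_nat, Measure.restrict_univ] at this

end Measure

/-! ### Signed Radon measures with a density. -/

namespace SignedRadon

variable {d : ℕ} {γ : Measure (E d)} {μ : SignedRadon d} {ρ : E d → ℝ}

instance (μ : SignedRadon d) : IsLocallyFiniteMeasure μ.variation :=
  isLocallyFiniteMeasure_add μ.pos μ.neg

/-- `μ = ρ γ`. -/
structure HasDensity (μ : SignedRadon d) (γ : Measure (E d)) (ρ : E d → ℝ) : Prop where
  measurable : Measurable ρ
  pos : μ.pos = γ.withDensity fun x => ENNReal.ofReal (ρ x)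
  neg : μ.neg = γ.withDensity fun x => ENNReal.ofReal (-ρ x)

namespace HasDensity

lemma congr {ρ' : E d → ℝ} (h : μ.HasDensity γ ρ) (hm : Measurable ρ') (he : ρ =ᵐ[γ] ρ') :
    μ.HasDensity γ ρ' where
  measurable := hm
  pos := h.pos.trans (withDensity_congr_ae (he.mono fun x hx => by simp only [hx]))
  neg := h.neg.trans (withDensity_congr_ae (he.mono fun x hx => by simp only [hx]))

lemma measurable_ofReal_neg (h : μ.HasDensity γ ρ) :
    Measurable fun x => ENNReal.ofReal (-ρ x) := h.measurable.neg.ennreal_ofReal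

lemma pos_ac (h : μ.HasDensity γ ρ) : μ.pos ≪ γ := by
  rw [h.pos]
  exact withDensity_absolutelyContinuous _ _

lemma neg_ac (h : μ.HasDensity γ ρ) : μ.neg ≪ γ := by
  rw [h.neg]
  exact withDensity_absolutelyContinuous _ _

lemma variation (h : μ.HasDensity γ ρ) : μ.variation = γ.withDensity fun x => ENNReal.ofReal |ρ x| := by
  rw [SignedRadon.variation, h.pos, h.neg, ← withDensity_add_left h.measurable.ennreal_ofReal]
  congr 1
  ext x
  simp only [Pi.add_apply]
  rcases le_total 0 (ρ x) with hx | hx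
  · rw [abs_of_nonneg hx, ENNReal.ofReal_of_nonpos (neg_nonpos.2 hx), add_zero]
  · rw [abs_of_nonpos hx, ENNReal.ofReal_of_nonpos hx, zero_add]

lemma integrable_of_pos_of_neg (h : μ.HasDensity γ ρ) {f : E d → ℝ} (hp : Integrable f μ.pos)
    (hn : Integrable f μ.neg) :
    Integrable (fun x => f x * ρ x) γ ∧ μ.integral f = ∫ x, f x * ρ x ∂γ := by
  have hm := h.measurable
  rw [h.pos, integrable_withDensity_iff_integrable_smul' hm.ennreal_ofReal (by simp)] at hp
  rw [h.neg, integrable_withDensity_iff_integrable_smul' h.measurable_ofReal_neg (by simp)] at hn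
  have key : ∀ x, (ENNReal.ofReal (ρ x)).toReal • f x - (ENNReal.ofReal (-ρ x)).toReal • f x =
      f x * ρ x := by
    intro x
    rw [← sub_smul, ENNReal.toReal_ofReal', ENNReal.toReal_ofReal', max_zero_sub_max_neg_zero_eq_self,
      smul_eq_mul, mul_comm]
  refine ⟨(hp.sub hn).congr (ae_of_all _ key), ?_⟩
  rw [integral, h.pos, h.neg, integral_withDensity_eq_integral_toReal_smul hm.ennreal_ofReal (by simp),
    integral_withDensity_eq_integral_toReal_smul h.measurable_ofReal_neg (by simp),
    ← integral_sub hp hn]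
  exact integral_congr_ae (ae_of_all _ key)

lemma integrable (h : μ.HasDensity γ ρ) {f : E d → ℝ} (hf : Continuous f) (hc : HasCompactSupport f) :
    Integrable (fun x => f x * ρ x) γ :=
  (h.integrable_of_pos_of_neg (hf.integrable_of_hasCompactSupport hc)
    (hf.integrable_of_hasCompactSupport hc)).1

lemma integral_eq (h : μ.HasDensity γ ρ) {f : E d → ℝ} (hf : Continuous f)
    (hc : HasCompactSupport f) : μ.integral f = ∫ x, f x * ρ x ∂γ :=
  (h.integrable_of_pos_of_neg (hf.integrable_of_hasCompactSupport hc)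
    (hf.integrable_of_hasCompactSupport hc)).2

lemma integrableOn_val (h : μ.HasDensity γ ρ) {A : Set (E d)} (hA : MeasurableSet A)
    (hb : Bornology.IsBounded A) : IntegrableOn ρ A γ ∧ μ.val A = ∫ x in A, ρ x ∂γ := by
  have hi : IntegrableOn ρ A γ := by
    refine ⟨h.measurable.aestronglyMeasurable, ?_⟩
    have hv := measure_lt_top_of_isBounded μ.variation hb
    rw [h.variation, withDensity_apply _ hA] at hv
    rw [HasFiniteIntegral]
    simpa only [Real.enorm_eq_ofReal_abs] using hv
  refine ⟨hi, ?_⟩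
  rw [integral_eq_lintegral_pos_part_sub_lintegral_neg_part hi, val, Measure.real, Measure.real,
    h.pos, h.neg, withDensity_apply _ hA, withDensity_apply _ hA]

lemma density_ae_eq [SigmaFinite γ] (h : μ.HasDensity γ ρ) : μ.density γ =ᵐ[γ] ρ := by
  have hp := Measure.rnDeriv_withDensity γ h.measurable.ennreal_ofReal
  have hn := Measure.rnDeriv_withDensity γ h.measurable_ofReal_neg
  rw [← h.pos] at hp
  rw [← h.neg] at hn
  filter_upwards [hp, hn] with x hpx hnx
  rw [density, hpx, hnx, ENNReal.toReal_ofReal', ENNReal.toReal_ofReal',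
    max_zero_sub_max_neg_zero_eq_self]

end HasDensity

lemma measurable_density (μ : SignedRadon d) (γ : Measure (E d)) : Measurable (μ.density γ) :=
  (Measure.measurable_rnDeriv _ _).ennreal_toReal.sub (Measure.measurable_rnDeriv _ _).ennreal_toReal

/-- Mutual singularity makes the two Radon–Nikodym derivatives vanish on complementary sets up to
`γ`-null sets, so they are the positive and negative parts of their difference. -/
lemma hasDensity_density [SigmaFinite γ] (hp : μ.pos ≪ γ) (hn : μ.neg ≪ γ) :
    μ.HasDensity γ (μ.density γ) := by
  obtain ⟨N, hN, hN1, hN2⟩ := μ.sing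
  have hp' := Measure.withDensity_rnDeriv_eq μ.pos γ hp
  have hn' := Measure.withDensity_rnDeriv_eq μ.neg γ hn
  have h1 : ∀ᵐ x ∂γ, x ∈ N → μ.pos.rnDeriv γ x = 0 := by
    rw [← hp', withDensity_apply _ hN, lintegral_eq_zero_iff (Measure.measurable_rnDeriv _ _)] at hN1
    exact (ae_restrict_iff' hN).1 hN1
  have h2 : ∀ᵐ x ∂γ, x ∈ Nᶜ → μ.neg.rnDeriv γ x = 0 := by
    rw [← hn', withDensity_apply _ hN.compl,
      lintegral_eq_zero_iff (Measure.measurable_rnDeriv _ _)] at hN2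
    exact (ae_restrict_iff' hN.compl).1 hN2
  refine ⟨measurable_density μ γ, ?_, ?_⟩
  · conv_lhs => rw [← hp']
    refine withDensity_congr_ae ?_
    filter_upwards [h1, h2, Measure.rnDeriv_lt_top μ.pos γ] with x hx1 hx2 hx3
    by_cases hx : x ∈ N
    · simp [density, hx1 hx]
    · simp [density, hx2 hx, hx3.ne]
  · conv_lhs => rw [← hn']
    refine withDensity_congr_ae ?_
    filter_upwards [h1, h2, Measure.rnDeriv_lt_top μ.neg γ] with x hx1 hx2 hx3
    by_cases hx : x ∈ N
    · simp [density, hx1 hx, hx3.ne]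
    · simp [density, hx2 hx]

/-- The measure `ρ γ` for a bounded density `ρ`. -/
def ofDensity (γ : Measure (E d)) [IsLocallyFiniteMeasure γ] (ρ : E d → ℝ) (hρ : Measurable ρ)
    (M : ℝ) (hM : ∀ x, |ρ x| ≤ M) : SignedRadon d where
  pos := γ.withDensity fun x => ENNReal.ofReal (ρ x)
  neg := γ.withDensity fun x => ENNReal.ofReal (-ρ x)
  pos_lf := by
    have : γ.withDensity (fun x => ENNReal.ofReal (ρ x)) ≤ M.toNNReal • γ := by
      refine (withDensity_mono (ae_of_all _ fun x => ?_)).trans (withDensity_const (M.toNNReal : ℝ≥0∞)).le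
      exact ENNReal.ofReal_le_ofReal ((le_abs_self _).trans (hM x))
    exact Measure.isLocallyFiniteMeasure_of_le this
  neg_lf := by
    have : γ.withDensity (fun x => ENNReal.ofReal (-ρ x)) ≤ M.toNNReal • γ := by
      refine (withDensity_mono (ae_of_all _ fun x => ?_)).trans (withDensity_const (M.toNNReal : ℝ≥0∞)).le
      exact ENNReal.ofReal_le_ofReal ((neg_le_abs _).trans (hM x))
    exact Measure.isLocallyFiniteMeasure_of_le this
  sing := by
    refine ⟨{x | ρ x ≤ 0}, measurableSet_le hρ measurable_const, ?_, ?_⟩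
    · rw [withDensity_apply _ (measurableSet_le hρ measurable_const)]
      refine (setLIntegral_congr_fun (measurableSet_le hρ measurable_const) (g := fun _ => 0)
        fun x hx => ENNReal.ofReal_of_nonpos hx).trans (by simp)
    · rw [withDensity_apply _ (measurableSet_le hρ measurable_const).compl]
      refine (setLIntegral_congr_fun (measurableSet_le hρ measurable_const).compl (g := fun _ => 0)
        fun x hx => ENNReal.ofReal_of_nonpos ?_).trans (by simp)
      simp only [mem_compl_iff, mem_ofPred_eq, not_le] at hx
      linarith

lemma hasDensity_ofDensity [IsLocallyFiniteMeasure γ] (hρ : Measurable ρ) (M : ℝ)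
    (hM : ∀ x, |ρ x| ≤ M) : (ofDensity γ ρ hρ M hM).HasDensity γ ρ := ⟨hρ, rfl, rfl⟩

lemma ac_of_bounded {m γ : Measure (E d)} (h : ∀ A : Set (E d), MeasurableSet A →
    Bornology.IsBounded A → γ A = 0 → m A = 0) : m ≪ γ := by
  refine Measure.AbsolutelyContinuous.mk fun A hA h0 => ?_
  have : A = ⋃ n : ℕ, A ∩ Metric.ball 0 n := by
    rw [← inter_iUnion, Metric.iUnion_ball_nat, inter_univ]
  rw [this, measure_iUnion_null_iff]
  exact fun n => h _ (hA.inter measurableSet_ball) (Metric.isBounded_ball.subset inter_subset_right)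
    (measure_mono_null inter_subset_left h0)

/-- Intersecting a test set with one side of the Jordan decomposition removes the other part of `μ`,
so the two inequalities force `pos` and `neg` to be absolutely continuous. Comparing integrals over
subsets of balls then bounds the density almost everywhere. -/
lemma between_iff_hasDensity [IsLocallyFiniteMeasure γ] {a b : ℝ} (hab : a ≤ b) :
    μ.Between a b γ ↔ ∃ ρ : E d → ℝ, (∀ x, ρ x ∈ Icc a b) ∧ μ.HasDensity γ ρ := by
  constructor
  · intro h
    obtain ⟨N, hN, hN1, hN2⟩ := μ.sing
    have hpos : μ.pos ≪ γ := by
      refine ac_of_bounded fun A hA hb h0 => ?_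
      have h1 := (h (A ∩ Nᶜ) (hA.inter hN.compl) (hb.subset inter_subset_left)).2
      rw [val, measureReal_def μ.neg, measure_mono_null inter_subset_right hN2, measureReal_def γ,
        measure_mono_null inter_subset_left h0] at h1
      have h2 : μ.pos.real (A ∩ Nᶜ) = 0 := le_antisymm (by simpa using h1) measureReal_nonneg
      have h3 : μ.pos (A ∩ Nᶜ) = 0 := by
        rwa [measureReal_eq_zero_iff
          (measure_lt_top_of_isBounded μ.pos (hb.subset inter_subset_left)).ne] at h2
      rw [← measure_inter_add_sdiff A hN, sdiff_eq, h3, measure_mono_null inter_subset_right hN1,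
        add_zero]
    have hneg : μ.neg ≪ γ := by
      refine ac_of_bounded fun A hA hb h0 => ?_
      have h1 := (h (A ∩ N) (hA.inter hN) (hb.subset inter_subset_left)).1
      rw [val, measureReal_def μ.pos, measure_mono_null inter_subset_right hN1, measureReal_def γ,
        measure_mono_null inter_subset_left h0] at h1
      have h2 : μ.neg.real (A ∩ N) = 0 := le_antisymm (by simpa using h1) measureReal_nonneg
      have h3 : μ.neg (A ∩ N) = 0 := by
        rwa [measureReal_eq_zero_iff
          (measure_lt_top_of_isBounded μ.neg (hb.subset inter_subset_left)).ne] at h2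
      rw [← measure_inter_add_sdiff A hN, sdiff_eq, h3, measure_mono_null inter_subset_right hN2,
        add_zero]
    have hd := hasDensity_density hpos hneg
    have hI : ∀ n : ℕ, IntegrableOn (μ.density γ) (Metric.ball 0 n) γ := fun n =>
      (hd.integrableOn_val measurableSet_ball Metric.isBounded_ball).1
    have hfin : ∀ n : ℕ, IsFiniteMeasure (γ.restrict (Metric.ball 0 n)) := fun n =>
      ⟨by rw [Measure.restrict_apply_univ]; exact measure_lt_top_of_isBounded γ Metric.isBounded_ball⟩
    have hae : ∀ᵐ x ∂γ, μ.density γ x ∈ Icc a b := by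
      refine ae_of_forall_restrict_ball fun n => ?_
      have key : ∀ s : Set (E d), MeasurableSet s →
          a * γ.real (s ∩ Metric.ball 0 n) ≤ ∫ x in s, μ.density γ x ∂γ.restrict (Metric.ball 0 n) ∧
          ∫ x in s, μ.density γ x ∂γ.restrict (Metric.ball 0 n) ≤
            b * γ.real (s ∩ Metric.ball 0 n) := by
        intro s hs
        have hm := hs.inter (measurableSet_ball (x := (0 : E d)) (ε := (n : ℝ)))
        have hbd := Metric.isBounded_ball.subset (inter_subset_right (s := s)
          (t := Metric.ball (0 : E d) n))
        rw [Measure.restrict_restrict hs, ← (hd.integrableOn_val hm hbd).2]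
        exact h _ hm hbd
      have h1 := ae_le_of_forall_setIntegral_le (integrable_const (μ := γ.restrict (Metric.ball 0 n)) a)
        (hI n) fun s hs _ => by
          refine le_trans (le_of_eq ?_) (key s hs).1
          rw [setIntegral_const, smul_eq_mul, mul_comm, measureReal_restrict_apply hs]
      have h2 := ae_le_of_forall_setIntegral_le (hI n)
        (integrable_const (μ := γ.restrict (Metric.ball 0 n)) b) fun s hs _ => by
          refine le_trans (key s hs).2 (le_of_eq ?_)
          rw [setIntegral_const, smul_eq_mul, mul_comm, measureReal_restrict_apply hs]
      filter_upwards [h1, h2] with x hx1 hx2 using ⟨hx1, hx2⟩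
    -- Clamping changes the density only on a null set and makes the bounds hold everywhere.
    refine ⟨fun x => max a (min b (μ.density γ x)), fun x => ⟨le_max_left _ _,
      max_le hab (min_le_left _ _)⟩, hd.congr
        (measurable_const.max (measurable_const.min (measurable_density μ γ))) ?_⟩
    filter_upwards [hae] with x hx
    rw [min_eq_right hx.2, max_eq_right hx.1]
  · rintro ⟨ρ, hρ, hd⟩ A hA hb
    obtain ⟨hi, hv⟩ := hd.integrableOn_val hA hb
    have hfin := (measure_lt_top_of_isBounded γ hb).ne
    rw [hv]
    constructor
    · have := setIntegral_mono (μ := γ) (s := A) (integrableOn_const hfin) hi (fun x => (hρ x).1)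
      rwa [setIntegral_const, smul_eq_mul, mul_comm] at this
    · have := setIntegral_mono (μ := γ) (s := A) hi (integrableOn_const hfin) (fun x => (hρ x).2)
      rwa [setIntegral_const, smul_eq_mul, mul_comm] at this

end SignedRadon

/-! ### Weak* closedness and compactness of `a γ ≤ μ ≤ b γ`; scalar multiples. -/

namespace SignedRadon

variable {d : ℕ} {γ : Measure (E d)} {μ : SignedRadon d} {ρ : E d → ℝ}

/-- Uniqueness of the Jordan decomposition without subtraction: `p₀` is carried by a set on which
`n₀` vanishes, and there the identity gives `p₀ ≤ p₀ + n₁ = p₁`. -/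
lemma eq_of_pos_add_neg_eq {μ₀ μ₁ : SignedRadon d} (h : μ₀.pos + μ₁.neg = μ₁.pos + μ₀.neg) :
    μ₀ = μ₁ := by
  have key : ∀ {p₀ n₀ p₁ n₁ : Measure (E d)}, p₀ ⟂ₘ n₀ → p₀ + n₁ = p₁ + n₀ → p₀ ≤ p₁ := by
    intro p₀ n₀ p₁ n₁ hs h
    obtain ⟨N, hN, hN1, hN2⟩ := hs
    refine Measure.le_iff.2 fun A hA => ?_
    calc p₀ A = p₀ (A ∩ Nᶜ) := by
          rw [← measure_inter_add_sdiff A hN, sdiff_eq, measure_mono_null inter_subset_right hN1,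
            zero_add]
      _ ≤ (p₀ + n₁) (A ∩ Nᶜ) := by rw [Measure.add_apply]; exact le_self_add
      _ = p₁ (A ∩ Nᶜ) := by
          rw [h, Measure.add_apply, measure_mono_null inter_subset_right hN2, add_zero]
      _ ≤ p₁ A := measure_mono inter_subset_left
  have h' : μ₀.neg + μ₁.pos = μ₁.neg + μ₀.pos := by rw [add_comm, ← h, add_comm]
  ext1
  · exact le_antisymm (key μ₀.sing h) (key μ₁.sing h.symm)
  · exact le_antisymm (key μ₀.sing.symm h') (key μ₁.sing.symm h'.symm)

lemma ext_of_integral_eq {μ₀ μ₁ : SignedRadon d}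
    (h : ∀ ζ : CompactlySupportedContinuousMap (E d) ℝ, μ₀.integral ζ = μ₁.integral ζ) :
    μ₀ = μ₁ := by
  refine eq_of_pos_add_neg_eq (Measure.ext_of_integral_eq_on_compactlySupported fun ζ => ?_)
  rw [integral_add_measure ζ.integrable ζ.integrable, integral_add_measure ζ.integrable ζ.integrable]
  have := h ζ
  simp only [integral] at this
  linarith

/-- This is the form that is visibly weakly* closed. For the reverse direction, `a` and `b` are
split into positive and negative parts and terms are moved across, so that only nonnegative measures
are compared. -/
lemma between_iff_integral [IsLocallyFiniteMeasure γ] {a b : ℝ} (hab : a ≤ b) :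
    μ.Between a b γ ↔ ∀ ζ : CompactlySupportedContinuousMap (E d) ℝ, (∀ x, 0 ≤ ζ x) →
      a * ∫ x, ζ x ∂γ ≤ μ.integral ζ ∧ μ.integral ζ ≤ b * ∫ x, ζ x ∂γ := by
  constructor
  · rw [between_iff_hasDensity hab]
    rintro ⟨ρ, hρ, hd⟩ ζ hζ
    have hi := hd.integrable (map_continuous ζ) ζ.hasCompactSupport
    rw [hd.integral_eq (map_continuous ζ) ζ.hasCompactSupport, ← integral_const_mul, ← integral_const_mul]
    exact ⟨integral_mono (ζ.integrable.const_mul a) hi fun x => by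
        simpa only [mul_comm] using mul_le_mul_of_nonneg_left (hρ x).1 (hζ x),
      integral_mono hi (ζ.integrable.const_mul b) fun x => by
        simpa only [mul_comm] using mul_le_mul_of_nonneg_left (hρ x).2 (hζ x)⟩
  · intro h
    have h1 : μ.pos + (-b).toNNReal • γ ≤ μ.neg + b.toNNReal • γ := by
      refine measure_le_of_integral_le fun ζ hζ => ?_
      rw [integral_add_measure ζ.integrable ζ.integrable,
        integral_add_measure ζ.integrable ζ.integrable, integral_smul_nnreal_measure,
        integral_smul_nnreal_measure, NNReal.smul_def, NNReal.smul_def, Real.coe_toNNReal',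
        Real.coe_toNNReal', smul_eq_mul, smul_eq_mul]
      have h2 := (h ζ hζ).2
      rw [integral] at h2
      linear_combination h2 - (∫ x, ζ x ∂γ) * max_zero_sub_max_neg_zero_eq_self b
    have h2 : μ.neg + a.toNNReal • γ ≤ μ.pos + (-a).toNNReal • γ := by
      refine measure_le_of_integral_le fun ζ hζ => ?_
      rw [integral_add_measure ζ.integrable ζ.integrable,
        integral_add_measure ζ.integrable ζ.integrable, integral_smul_nnreal_measure,
        integral_smul_nnreal_measure, NNReal.smul_def, NNReal.smul_def, Real.coe_toNNReal',
        Real.coe_toNNReal', smul_eq_mul, smul_eq_mul]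
      have h2 := (h ζ hζ).1
      rw [integral] at h2
      linear_combination h2 + (∫ x, ζ x ∂γ) * max_zero_sub_max_neg_zero_eq_self a
    intro A hA hb
    have key : ∀ {m n : Measure (E d)} {r s : ℝ≥0}, IsLocallyFiniteMeasure m →
        IsLocallyFiniteMeasure n → m + r • γ ≤ n + s • γ →
        m.real A + r * γ.real A ≤ n.real A + s * γ.real A := by
      intro m n r s _ _ h
      have h3 := h A
      have hγ := (measure_lt_top_of_isBounded γ hb).ne
      have hm := (measure_lt_top_of_isBounded m hb).ne
      have hn := (measure_lt_top_of_isBounded n hb).ne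
      rw [Measure.add_apply, Measure.add_apply, Measure.smul_apply, Measure.smul_apply,
        ENNReal.smul_def, ENNReal.smul_def, smul_eq_mul, smul_eq_mul] at h3
      have h4 := ENNReal.toReal_mono (by finiteness) h3
      rwa [ENNReal.toReal_add hm (by finiteness), ENNReal.toReal_add hn (by finiteness),
        ENNReal.toReal_mul, ENNReal.toReal_mul] at h4
    have k1 := key μ.pos_lf μ.neg_lf h1
    have k2 := key μ.neg_lf μ.pos_lf h2
    rw [Real.coe_toNNReal', Real.coe_toNNReal'] at k1 k2
    rw [val]
    exact ⟨by linear_combination k2 - γ.real A * max_zero_sub_max_neg_zero_eq_self a,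
      by linear_combination k1 + γ.real A * max_zero_sub_max_neg_zero_eq_self b⟩

lemma continuous_integral (ζ : CompactlySupportedContinuousMap (E d) ℝ) :
    Continuous fun μ : SignedRadon d => μ.integral ζ :=
  (continuous_apply ζ).comp (continuous_induced_dom (f := fun (μ : SignedRadon d)
    (ζ : CompactlySupportedContinuousMap (E d) ℝ) => μ.integral ζ))

lemma isClosed_between [IsLocallyFiniteMeasure γ] {a b : ℝ} (hab : a ≤ b) :
    IsClosed {μ : SignedRadon d | μ.Between a b γ} := by
  simp only [between_iff_integral hab, ofPred_forall, ofPred_and]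
  refine isClosed_iInter fun ζ => isClosed_iInter fun _ => ?_
  exact (isClosed_le continuous_const (continuous_integral ζ)).inter
    (isClosed_le (continuous_integral ζ) continuous_const)

lemma HasDensity.abs_integral_le {M : ℝ} (h : μ.HasDensity γ ρ) [IsLocallyFiniteMeasure γ]
    (hM : ∀ x, |ρ x| ≤ M) {f : E d → ℝ} (hf : Continuous f) (hc : HasCompactSupport f) :
    |μ.integral f| ≤ M * ∫ x, |f x| ∂γ := by
  rw [h.integral_eq hf hc, ← integral_const_mul]
  refine (abs_integral_le_integral_abs).trans (integral_mono (h.integrable hf hc).abs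
    ((hf.integrable_of_hasCompactSupport hc).abs.const_mul M) fun x => ?_)
  simp only [abs_mul]
  rw [mul_comm]
  exact mul_le_mul_of_nonneg_right (hM x) (abs_nonneg _)

/-- The measures `ρ γ` with `a ≤ ρ ≤ b` form a weakly* compact set. -/
lemma isCompact_between [IsLocallyFiniteMeasure γ] {a b : ℝ} (hab : a ≤ b) :
    IsCompact {μ : SignedRadon d | μ.Between a b γ} := by
  set J : SignedRadon d → CompactlySupportedContinuousMap (E d) ℝ → ℝ :=
    fun μ ζ => μ.integral ζ with hJ
  have hind : Topology.IsInducing J := ⟨rfl⟩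
  rw [hind.isCompact_iff]
  set M := max |a| |b| with hM
  -- Under `μ ↦ (∫ ζ dμ)_ζ` the image lies in a product of compact intervals, since `|ρ| ≤ M`. It
  -- remains to show that it is cut out of the box by closed conditions.
  set box : Set (CompactlySupportedContinuousMap (E d) ℝ → ℝ) :=
    Set.pi univ fun ζ => Icc (-(M * ∫ x, |ζ x| ∂γ)) (M * ∫ x, |ζ x| ∂γ) with hbox
  have hboxc : IsCompact box := isCompact_univ_pi fun ζ => isCompact_Icc
  -- Linear functionals lying between `a ∫ ζ dγ` and `b ∫ ζ dγ` on nonnegative `ζ`.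
  set T : Set (CompactlySupportedContinuousMap (E d) ℝ → ℝ) :=
    (⋂ (ζ) (ξ), {L | L (ζ + ξ) = L ζ + L ξ}) ∩ ((⋂ (c : ℝ) (ζ), {L | L (c • ζ) = c * L ζ}) ∩
      ⋂ (ζ) (_ : ∀ x, 0 ≤ ζ x), {L | a * ∫ x, ζ x ∂γ ≤ L ζ} ∩ {L | L ζ ≤ b * ∫ x, ζ x ∂γ}) with hT
  have hTc : IsClosed T := by
    refine IsClosed.inter ?_ (IsClosed.inter ?_ ?_)
    · exact isClosed_iInter fun ζ => isClosed_iInter fun ξ => isClosed_eq (continuous_apply (ζ + ξ))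
        ((continuous_apply ζ).add (continuous_apply ξ))
    · exact isClosed_iInter fun c => isClosed_iInter fun ζ => isClosed_eq (continuous_apply (c • ζ))
        (continuous_const.mul (continuous_apply ζ))
    · exact isClosed_iInter fun ζ => isClosed_iInter fun _ =>
        (isClosed_le continuous_const (continuous_apply ζ)).inter
          (isClosed_le (continuous_apply ζ) continuous_const)
  have hTmem : ∀ L, L ∈ T ↔ (∀ ζ ξ, L (ζ + ξ) = L ζ + L ξ) ∧ (∀ (c : ℝ) ζ, L (c • ζ) = c * L ζ) ∧
      ∀ ζ, (∀ x, 0 ≤ ζ x) → a * ∫ x, ζ x ∂γ ≤ L ζ ∧ L ζ ≤ b * ∫ x, ζ x ∂γ := fun L => by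
    simp only [hT, mem_inter_iff, mem_iInter, mem_ofPred_eq]
  suffices J '' {μ | μ.Between a b γ} = box ∩ T by
    rw [this]
    exact hboxc.inter_right hTc
  ext L
  constructor
  · rintro ⟨μ, hμ, rfl⟩
    have h3 := (between_iff_integral hab).1 hμ
    obtain ⟨ρ, hρ, hd⟩ := (between_iff_hasDensity hab).1 hμ
    refine ⟨fun ζ _ => ?_, (hTmem _).2 ⟨fun ζ ξ => ?_, fun c ζ => ?_, h3⟩⟩
    · exact abs_le.1 (hd.abs_integral_le (fun x => abs_le_max_abs_abs (hρ x).1 (hρ x).2)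
        (map_continuous ζ) ζ.hasCompactSupport)
    · simp only [hJ, integral, CompactlySupportedContinuousMap.add_apply]
      rw [integral_add ζ.integrable ξ.integrable, integral_add ζ.integrable ξ.integrable]
      ring
    · simp only [hJ, integral, CompactlySupportedContinuousMap.smul_apply, smul_eq_mul,
        integral_const_mul]
      ring
  · rintro ⟨-, hL⟩
    obtain ⟨hadd, hsmul, hpos⟩ := (hTmem L).1 hL
    -- Subtracting `a γ` makes the functional positive. The Riesz measure `m` then satisfies `0 ≤ m
    -- ≤ (b - a) γ`, and `m + a γ` is the required signed measure.
    let Λ₀ : CompactlySupportedContinuousMap (E d) ℝ →ₗ[ℝ] ℝ :=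
      { toFun := fun ζ => L ζ - a * ∫ x, ζ x ∂γ
        map_add' := fun ζ ξ => by
          simp only [hadd, CompactlySupportedContinuousMap.add_apply]
          rw [integral_add ζ.integrable ξ.integrable]
          ring
        map_smul' := fun c ζ => by
          simp only [hsmul, CompactlySupportedContinuousMap.smul_apply, smul_eq_mul,
            integral_const_mul, RingHom.id_apply]
          ring }
    let Λ := PositiveLinearMap.mk₀ Λ₀ fun ζ hζ => sub_nonneg.2 (hpos ζ hζ).1
    have hΛ : ∀ ζ, Λ ζ = L ζ - a * ∫ x, ζ x ∂γ := fun ζ => rfl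
    set m := RealRMK.rieszMeasure Λ with hm
    have hmi : ∀ ζ : CompactlySupportedContinuousMap (E d) ℝ,
        ∫ x, ζ x ∂m = L ζ - a * ∫ x, ζ x ∂γ := fun ζ => by
      rw [hm, RealRMK.integral_rieszMeasure, hΛ]
    have hba : 0 ≤ b - a := sub_nonneg.2 hab
    have hmle : m ≤ (b - a).toNNReal • γ := by
      refine measure_le_of_integral_le fun ζ hζ => ?_
      rw [hmi, integral_smul_nnreal_measure, NNReal.smul_def, Real.coe_toNNReal _ hba, smul_eq_mul]
      linarith [(hpos ζ hζ).2]
    have hmac : m ≪ γ := (Measure.absolutelyContinuous_of_le hmle).trans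
      Measure.smul_absolutelyContinuous
    have hmd := Measure.withDensity_rnDeriv_eq m γ hmac
    have hae : ∀ᵐ x ∂γ, m.rnDeriv γ x ≤ ENNReal.ofReal (b - a) := by
      refine ae_le_of_forall_setLIntegral_le_of_sigmaFinite (Measure.measurable_rnDeriv _ _)
        fun s hs _ => ?_
      rw [← withDensity_apply _ hs, hmd, setLIntegral_const]
      exact hmle s
    -- The truncation is inactive `γ`-almost everywhere; it makes `a ≤ ρ ≤ b` hold at every point.
    set ρ : E d → ℝ := fun x => a + min (m.rnDeriv γ x).toReal (b - a) with hρ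
    have hρm : Measurable ρ := measurable_const.add
      ((Measure.measurable_rnDeriv _ _).ennreal_toReal.min measurable_const)
    have hρI : ∀ x, ρ x ∈ Icc a b := fun x => by
      constructor
      · have : 0 ≤ min (m.rnDeriv γ x).toReal (b - a) := le_min ENNReal.toReal_nonneg hba
        simp only [hρ]
        linarith
      · have : min (m.rnDeriv γ x).toReal (b - a) ≤ b - a := min_le_right _ _
        simp only [hρ]
        linarith
    have hd := hasDensity_ofDensity (γ := γ) hρm M
      (fun x => abs_le_max_abs_abs (hρI x).1 (hρI x).2)
    refine ⟨_, (between_iff_hasDensity hab).2 ⟨ρ, hρI, hd⟩, ?_⟩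
    ext ζ
    have h1 := hmi ζ
    rw [← hmd, integral_withDensity_eq_integral_toReal_smul (Measure.measurable_rnDeriv _ _)
      (Measure.rnDeriv_lt_top _ _)] at h1
    have hzi : Integrable (fun x => (m.rnDeriv γ x).toReal • ζ x) γ := by
      rw [← integrable_withDensity_iff_integrable_smul' (Measure.measurable_rnDeriv _ _)
        (Measure.rnDeriv_lt_top _ _), hmd]
      exact ζ.integrable
    have h2 : ∫ x, ζ x * ρ x ∂γ = ∫ x, a * ζ x + (m.rnDeriv γ x).toReal • ζ x ∂γ := by
      refine integral_congr_ae ?_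
      filter_upwards [hae, Measure.rnDeriv_lt_top m γ] with x hx hx2
      have : (m.rnDeriv γ x).toReal ≤ b - a := ENNReal.toReal_le_of_le_ofReal hba hx
      simp only [hρ, min_eq_left this, smul_eq_mul]
      ring
    simp only [hJ]
    rw [hd.integral_eq (map_continuous ζ) ζ.hasCompactSupport, h2,
      integral_add (ζ.integrable.const_mul a) hzi, integral_const_mul, h1]
    ring

/-- The signed measure `c μ`. -/
def scale (c : ℝ) (μ : SignedRadon d) : SignedRadon d where
  pos := c.toNNReal • μ.pos + (-c).toNNReal • μ.neg
  neg := c.toNNReal • μ.neg + (-c).toNNReal • μ.pos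
  pos_lf := inferInstance
  neg_lf := inferInstance
  sing := by
    rcases le_total 0 c with hc | hc
    · rw [Real.toNNReal_of_nonpos (neg_nonpos.2 hc), zero_smul, zero_smul, add_zero, add_zero]
      exact (μ.sing.smul_nnreal _).symm.smul_nnreal _ |>.symm
    · rw [Real.toNNReal_of_nonpos hc, zero_smul, zero_smul, zero_add, zero_add]
      exact (μ.sing.smul_nnreal _).symm.smul_nnreal _

lemma variation_scale (c : ℝ) (μ : SignedRadon d) :
    (μ.scale c).variation = |c|.toNNReal • μ.variation := by
  rw [variation, variation, scale]
  rcases le_total 0 c with hc | hc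
  · simp [Real.toNNReal_of_nonpos (neg_nonpos.2 hc), abs_of_nonneg hc]
  · simp [Real.toNNReal_of_nonpos hc, abs_of_nonpos hc, add_comm]

lemma integral_scale (c : ℝ) (μ : SignedRadon d) (f : E d → ℝ) :
    (μ.scale c).integral f = c * μ.integral f := by
  rw [integral, integral, scale]
  rcases le_total 0 c with hc | hc
  · simp only [Real.toNNReal_of_nonpos (neg_nonpos.2 hc), zero_smul, add_zero,
      integral_smul_nnreal_measure, NNReal.smul_def, Real.coe_toNNReal _ hc, smul_eq_mul]
    ring
  · simp only [Real.toNNReal_of_nonpos hc, zero_smul, zero_add,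
      integral_smul_nnreal_measure, NNReal.smul_def, Real.coe_toNNReal _ (neg_nonneg.2 hc),
      smul_eq_mul]
    ring

lemma val_scale (c : ℝ) (μ : SignedRadon d) (A : Set (E d)) :
    (μ.scale c).val A = c * μ.val A := by
  rw [val, val, scale]
  rcases le_total 0 c with hc | hc
  · simp only [Real.toNNReal_of_nonpos (neg_nonpos.2 hc), zero_smul, add_zero,
      measureReal_nnreal_smul_apply, Real.coe_toNNReal _ hc]
    ring
  · simp only [Real.toNNReal_of_nonpos hc, zero_smul, zero_add,
      measureReal_nnreal_smul_apply, Real.coe_toNNReal _ (neg_nonneg.2 hc)]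
    ring

lemma HasDensity.scale (h : μ.HasDensity γ ρ) (c : ℝ) :
    (μ.scale c).HasDensity γ (fun x => c * ρ x) := by
  have key : ∀ u v : ℝ, ENNReal.ofReal u * ENNReal.ofReal v + ENNReal.ofReal (-u) * ENNReal.ofReal (-v)
      = ENNReal.ofReal (u * v) := by
    intro u v
    rcases le_total 0 u with hu | hu
    · rw [ENNReal.ofReal_of_nonpos (neg_nonpos.2 hu), zero_mul, add_zero, ENNReal.ofReal_mul hu]
    · rw [ENNReal.ofReal_of_nonpos hu, zero_mul, zero_add, ← ENNReal.ofReal_mul (neg_nonneg.2 hu),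
        neg_mul_neg]
  refine ⟨h.measurable.const_mul c, ?_, ?_⟩
  · change c.toNNReal • μ.pos + (-c).toNNReal • μ.neg = _
    rw [h.pos, h.neg]
    change (c.toNNReal : ℝ≥0∞) • γ.withDensity (fun x => ENNReal.ofReal (ρ x)) +
      ((-c).toNNReal : ℝ≥0∞) • γ.withDensity (fun x => ENNReal.ofReal (-ρ x)) = _
    rw [← withDensity_smul _ h.measurable.ennreal_ofReal,
      ← withDensity_smul _ h.measurable_ofReal_neg,
      ← withDensity_add_left (h.measurable.ennreal_ofReal.const_smul _)]
    congr 1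
    ext x
    exact key c (ρ x)
  · change c.toNNReal • μ.neg + (-c).toNNReal • μ.pos = _
    rw [h.pos, h.neg]
    change (c.toNNReal : ℝ≥0∞) • γ.withDensity (fun x => ENNReal.ofReal (-ρ x)) +
      ((-c).toNNReal : ℝ≥0∞) • γ.withDensity (fun x => ENNReal.ofReal (ρ x)) = _
    rw [← withDensity_smul _ h.measurable.ennreal_ofReal,
      ← withDensity_smul _ h.measurable_ofReal_neg,
      ← withDensity_add_left (h.measurable_ofReal_neg.const_smul _)]
    congr 1
    ext x
    have := key c (-ρ x)
    rw [neg_neg, mul_neg] at this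
    exact this

lemma variation_ac_iff : μ.variation ≪ γ ↔ μ.pos ≪ γ ∧ μ.neg ≪ γ :=
  Measure.AbsolutelyContinuous.add_left_iff

lemma variation_scale_ac_iff {c : ℝ} (hc : c ≠ 0) :
    (μ.scale c).variation ≪ γ ↔ μ.variation ≪ γ := by
  have hc' : |c|.toNNReal ≠ 0 := by simpa using hc
  rw [variation_scale]
  exact ⟨fun h => (Measure.absolutelyContinuous_smul (μ := μ.variation)
    (c := (|c|.toNNReal : ℝ≥0∞)) (by simpa using hc)).trans h,
    fun h => Measure.smul_absolutelyContinuous.trans h⟩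

lemma eq_zero_of_density_ae_eq_zero {σ : Measure (E d)} [SigmaFinite σ] (hac : μ.variation ≪ σ)
    (h : μ.density σ =ᵐ[σ] 0) : μ.variation = 0 := by
  obtain ⟨hp, hn⟩ := variation_ac_iff.1 hac
  rw [((hasDensity_density hp hn).congr measurable_zero h).variation]
  simp

end SignedRadon

/-! ### The action functional. -/

section Action

variable {d : ℕ} {p a b : ℝ} {φ : ℝ × E d → ℝ≥0∞} {γ : Measure (E d)} {μ : SignedRadon d}
  {ν : VectorRadon d}

lemma measure_add_eq_zero_iff {X : Type*} [MeasurableSpace X] {m n : Measure X} :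
    m + n = 0 ↔ m = 0 ∧ n = 0 := by
  simp only [← Measure.measure_univ_eq_zero, Measure.add_apply, add_eq_zero]

lemma SignedRadon.variation_singularPart_eq_zero_iff [SigmaFinite γ] :
    (μ.singularPart γ).variation = 0 ↔ μ.variation ≪ γ := by
  rw [variation_ac_iff, ← Measure.singularPart_eq_zero, ← Measure.singularPart_eq_zero, variation,
    measure_add_eq_zero_iff]
  rfl

lemma VectorRadon.measurable_density (ν : VectorRadon d) (γ : Measure (E d)) :
    Measurable (ν.density γ) :=
  (WithLp.measurable_toLp 2 _).comp
    (measurable_pi_lambda _ fun i => SignedRadon.measurable_density (ν i) γ)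

/-- The common singular measure with respect to which the singular parts are evaluated. -/
lemma singular_sum_eq_zero_iff [SigmaFinite γ] :
    (μ.singularPart γ).variation + ∑ i, (ν.singularPart γ i).variation = 0 ↔
      μ.variation ≪ γ ∧ ∀ i, (ν i).variation ≪ γ := by
  rw [measure_add_eq_zero_iff, SignedRadon.variation_singularPart_eq_zero_iff]
  refine and_congr_right fun _ => ?_
  have : ∀ i, (ν.singularPart γ i).variation = 0 ↔ (ν i).variation ≪ γ := fun i =>
    SignedRadon.variation_singularPart_eq_zero_iff
  simp_rw [← this]
  refine ⟨fun h i => ?_, fun h => Finset.sum_eq_zero fun i _ => h i⟩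
  refine le_antisymm ?_ (Measure.zero_le _)
  rw [← h]
  exact Finset.single_le_sum (fun i _ => Measure.zero_le _) (Finset.mem_univ i)

lemma action_of_ac [SigmaFinite γ] (hμ : μ.variation ≪ γ) (hν : ∀ i, (ν i).variation ≪ γ) :
    action φ γ μ ν = ∫⁻ x, φ (μ.density γ x, ν.density γ x) ∂γ := by
  simp only [action, singular_sum_eq_zero_iff.2 ⟨hμ, hν⟩, lintegral_zero_measure, add_zero]

/-- As the recession functional is infinite off the origin, its integral is finite only if the
densities of both singular parts with respect to `σ` vanish `σ`-almost everywhere, so these parts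
are zero. -/
lemma ac_of_action_ne_top [SigmaFinite γ] (hφ : IsActionDensityOn p a b φ) (hp : 1 < p)
    (hab : a < b) (h : action φ γ μ ν ≠ ⊤) :
    μ.variation ≪ γ ∧ ∀ i, (ν i).variation ≪ γ := by
  simp only [action] at h
  set σ := (μ.singularPart γ).variation + ∑ i, (ν.singularPart γ i).variation with hσ
  have h2 := (ENNReal.add_ne_top.1 h).2
  rw [hφ.recession_eq hp hab] at h2
  have hmeas : Measurable fun x => ((μ.singularPart γ).density σ x, (ν.singularPart γ).density σ x) :=
    (SignedRadon.measurable_density _ σ).prodMk (VectorRadon.measurable_density _ σ)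
  have hae := ae_lt_top ((measurable_const.indicator (measurableSet_singleton _).compl).comp hmeas) h2
  have hzero : ∀ᵐ x ∂σ, ((μ.singularPart γ).density σ x, (ν.singularPart γ).density σ x) = 0 := by
    filter_upwards [hae] with x hx
    by_contra hne
    simp [indicator, hne] at hx
  have hμσ : (μ.singularPart γ).variation ≪ σ :=
    Measure.absolutelyContinuous_of_le (Measure.le_add_right le_rfl)
  have hνσ : ∀ i, (ν.singularPart γ i).variation ≪ σ := fun i =>
    Measure.absolutelyContinuous_of_le (Measure.le_add_left
      (Finset.single_le_sum (f := fun i => (ν.singularPart γ i).variation)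
        (fun i _ => Measure.zero_le _) (Finset.mem_univ i)))
  refine ⟨SignedRadon.variation_singularPart_eq_zero_iff.1
    (SignedRadon.eq_zero_of_density_ae_eq_zero hμσ (hzero.mono fun x hx => congrArg Prod.fst hx)),
    fun i => SignedRadon.variation_singularPart_eq_zero_iff.1
    (SignedRadon.eq_zero_of_density_ae_eq_zero (hνσ i) (hzero.mono fun x hx => ?_))⟩
  exact congrFun (congrArg (fun v : E d => v.ofLp) (congrArg Prod.snd hx)) i

lemma between_of_action_ne_top [IsLocallyFiniteMeasure γ] (hφ : IsActionDensityOn p a b φ)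
    (hp : 1 < p) (hab : a < b) (h : action φ γ μ ν ≠ ⊤) : μ.Between a b γ := by
  obtain ⟨hμ, hν⟩ := ac_of_action_ne_top hφ hp hab h
  obtain ⟨hμp, hμn⟩ := SignedRadon.variation_ac_iff.1 hμ
  rw [action_of_ac hμ hν] at h
  have hmeas : Measurable fun x => (μ.density γ x, ν.density γ x) :=
    (SignedRadon.measurable_density _ γ).prodMk (VectorRadon.measurable_density _ γ)
  have hae := ae_lt_top (hφ.lsc.measurable.comp hmeas) h
  rw [SignedRadon.between_iff_hasDensity hab.le]
  refine ⟨fun x => max a (min b (μ.density γ x)), fun x => ⟨le_max_left _ _,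
      max_le hab.le (min_le_left _ _)⟩, (SignedRadon.hasDensity_density hμp hμn).congr
        (measurable_const.max (measurable_const.min (SignedRadon.measurable_density μ γ))) ?_⟩
  filter_upwards [hae] with x hx
  have := hφ.fst_mem_Icc hab hx.ne
  rw [min_eq_right this.2, max_eq_right this.1]

/-- The cost of changing the speed of a curve: used with `c = -1` for time reversal and with `c =
θ⁻¹`, `(1 - θ)⁻¹` for concatenation. -/
lemma action_scale [IsLocallyFiniteMeasure γ] (hφ : IsActionDensityOn p a b φ) (hp : 1 < p)
    (hab : a < b) {c : ℝ} (hc : c ≠ 0) (μ : SignedRadon d) (ν : VectorRadon d) :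
    action φ γ μ (fun i => (ν i).scale c) = ENNReal.ofReal (|c| ^ p) * action φ γ μ ν := by
  by_cases h : μ.variation ≪ γ ∧ ∀ i, (ν i).variation ≪ γ
  · rw [action_of_ac h.1 h.2,
      action_of_ac h.1 fun i => (SignedRadon.variation_scale_ac_iff hc).2 (h.2 i),
      ← lintegral_const_mul' _ _ ENNReal.ofReal_ne_top]
    have hi : ∀ i, ((ν i).scale c).density γ =ᵐ[γ] fun x => c * (ν i).density γ x := fun i =>
      ((SignedRadon.hasDensity_density (SignedRadon.variation_ac_iff.1 (h.2 i)).1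
        (SignedRadon.variation_ac_iff.1 (h.2 i)).2).scale c).density_ae_eq
    refine lintegral_congr_ae ?_
    filter_upwards [ae_all_iff.2 hi] with x hx
    rw [← hφ.map_smul _ hc]
    congr 2
    ext i
    exact hx i
  · have h1 : action φ γ μ ν = ⊤ := by
      by_contra h'
      exact h (ac_of_action_ne_top hφ hp hab h')
    have h2 : action φ γ μ (fun i => (ν i).scale c) = ⊤ := by
      by_contra h'
      have := ac_of_action_ne_top hφ hp hab h'
      exact h ⟨this.1, fun i => (SignedRadon.variation_scale_ac_iff hc).1 (this.2 i)⟩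
    rw [h1, h2, ENNReal.mul_top]
    have : 0 < |c| ^ p := Real.rpow_pos_of_pos (abs_pos.2 hc) p
    simpa using this

lemma SignedRadon.variation_scale_zero (μ : SignedRadon d) : (μ.scale 0).variation = 0 := by
  simp [variation_scale]

/-- The factor `0`, excluded from homogeneity, rests instead on `φ(ρ, 0) = 0` for `ρ ∈ [a,b]`; it
makes constant curves cost nothing. -/
lemma action_scale_zero [IsLocallyFiniteMeasure γ] (hφ : IsActionDensityOn p a b φ)
    (hab : a < b) (hμ : μ.Between a b γ) (ν : VectorRadon d) :
    action φ γ μ (fun i => (ν i).scale 0) = 0 := by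
  obtain ⟨ρ, hρ, hd⟩ := (SignedRadon.between_iff_hasDensity hab.le).1 hμ
  have hν : ∀ i, ((ν i).scale 0).variation ≪ γ := fun i => by
    rw [SignedRadon.variation_scale_zero]
    exact Measure.AbsolutelyContinuous.zero γ
  rw [action_of_ac (SignedRadon.variation_ac_iff.2 ⟨hd.pos_ac, hd.neg_ac⟩) hν]
  have hi : ∀ i, ((ν i).scale 0).density γ =ᵐ[γ] fun _ => 0 := fun i => by
    refine SignedRadon.HasDensity.density_ae_eq ⟨measurable_const, ?_, ?_⟩
    · have := SignedRadon.variation_scale_zero (ν i)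
      rw [SignedRadon.variation, measure_add_eq_zero_iff] at this
      simp [this.1]
    · have := SignedRadon.variation_scale_zero (ν i)
      rw [SignedRadon.variation, measure_add_eq_zero_iff] at this
      simp [this.2]
  refine (lintegral_congr_ae (g := fun _ => 0) ?_).trans (by simp)
  filter_upwards [hd.density_ae_eq, ae_all_iff.2 hi] with x hx hx'
  have : VectorRadon.density (fun i => (ν i).scale 0) γ x = 0 := by
    ext i
    exact hx' i
  rw [this, hx]
  exact hφ.map_zero hab (hρ x)

end Action

open ProbabilityTheory Filter Topology

/-! ### Radon–Nikodym densities jointly measurable in parameter and space. -/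

section JointDensity

variable {d : ℕ} {T : Type*} [MeasurableSpace T]

/-- Derivatives of finite kernels are jointly measurable. The family is therefore restricted to
balls, normalised, and compared with a finite measure equivalent to `γ`; the chain rule and a
supremum over the balls recover the derivative with respect to `γ`. -/
lemma exists_measurable_rnDeriv (γ : Measure (E d)) [IsLocallyFiniteMeasure γ]
    (m : T → Measure (E d)) [∀ t, IsLocallyFiniteMeasure (m t)]
    (hm : ∀ A : Set (E d), MeasurableSet A → Bornology.IsBounded A → Measurable fun t => m t A) :
    (∃ f : T × E d → ℝ≥0∞, Measurable f ∧
      ∀ t, (fun x => f (t, x)) =ᵐ[γ] (m t).rnDeriv γ) ∧ MeasurableSet {t | m t ≪ γ} := by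
  have hball : ∀ (t : T) (n : ℕ), m t (Metric.ball 0 n) ≠ ⊤ := fun t n =>
    (measure_lt_top_of_isBounded _ Metric.isBounded_ball).ne
  have hmb : ∀ n : ℕ, Measurable fun t => 1 + m t (Metric.ball 0 n) := fun n =>
    measurable_const.add (hm _ measurableSet_ball Metric.isBounded_ball)
  -- The factor `(1 + m t (ball))⁻¹` bounds all masses by `1`, as a finite kernel requires a bound
  -- uniform in `t`.
  let κ : ℕ → Kernel T (E d) := fun n =>
    { toFun := fun t => (1 + m t (Metric.ball 0 n))⁻¹ • (m t).restrict (Metric.ball 0 n)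
      measurable' := by
        refine Measure.measurable_of_measurable_coe _ fun A hA => ?_
        simp only [Measure.smul_apply, smul_eq_mul, Measure.restrict_apply hA]
        exact (hmb n).inv.mul (hm _ (hA.inter measurableSet_ball)
          (Metric.isBounded_ball.subset inter_subset_right)) }
  have hκ : ∀ n t, κ n t = (1 + m t (Metric.ball 0 n))⁻¹ • (m t).restrict (Metric.ball 0 n) :=
    fun n t => rfl
  have hfin : ∀ n, IsFiniteKernel (κ n) := fun n => by
    refine ⟨⟨1, ENNReal.one_lt_top, fun t => ?_⟩⟩
    rw [hκ, Measure.smul_apply, smul_eq_mul, Measure.restrict_apply_univ]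
    refine (mul_le_mul_right (le_add_self (b := 1)) _).trans ?_
    exact ENNReal.inv_mul_le_one _
  let η : Kernel T (E d) := Kernel.const T γ.toFinite
  constructor
  · let f : ℕ → T × E d → ℝ≥0∞ := fun n q => (Metric.ball (0 : E d) n).indicator
      (fun x => (1 + m q.1 (Metric.ball 0 n)) * ((κ n).rnDeriv η q.1 x * γ.toFinite.rnDeriv γ x)) q.2
    have hf : ∀ n, Measurable (f n) := fun n => by
      have h1 : Measurable fun q : T × E d => (1 + m q.1 (Metric.ball 0 n)) *
          ((κ n).rnDeriv η q.1 q.2 * γ.toFinite.rnDeriv γ q.2) :=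
        ((hmb n).comp measurable_fst).mul ((Kernel.measurable_rnDeriv (κ n) η).mul
          ((Measure.measurable_rnDeriv _ _).comp measurable_snd))
      have : f n = (Prod.snd ⁻¹' Metric.ball (0 : E d) n).indicator
          fun q : T × E d => (1 + m q.1 (Metric.ball 0 n)) *
          ((κ n).rnDeriv η q.1 q.2 * γ.toFinite.rnDeriv γ q.2) := by
        ext q
        rfl
      rw [this]
      exact h1.indicator (measurable_snd measurableSet_ball)
    refine ⟨fun q => ⨆ n, f n q, Measurable.iSup hf, fun t => ?_⟩
    have hn : ∀ n : ℕ, ∀ᵐ x ∂γ, f n (t, x) = (Metric.ball (0 : E d) n).indicator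
        ((m t).rnDeriv γ) x := fun n => by
      have h1 : (κ n).rnDeriv η t =ᵐ[γ] (κ n t).rnDeriv γ.toFinite :=
        (absolutelyContinuous_toFinite γ).ae_eq Kernel.rnDeriv_eq_rnDeriv_measure
      have h2 : (κ n t).rnDeriv γ.toFinite * γ.toFinite.rnDeriv γ =ᵐ[γ] (κ n t).rnDeriv γ :=
        (absolutelyContinuous_toFinite γ).ae_eq
          (Measure.rnDeriv_mul_rnDeriv' (toFinite_absolutelyContinuous γ))
      have hc0 : 1 + m t (Metric.ball 0 n) ≠ 0 := by simp
      have hct : 1 + m t (Metric.ball 0 n) ≠ ⊤ := ENNReal.add_ne_top.2 ⟨ENNReal.one_ne_top, hball t n⟩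
      have h3 := Measure.rnDeriv_smul_left_of_ne_top' ((m t).restrict (Metric.ball 0 n)) γ
        (r := (1 + m t (Metric.ball 0 n))⁻¹) (by simp)
      have h4 := Measure.rnDeriv_restrict (m t) γ (measurableSet_ball (x := (0 : E d)) (ε := n))
      rw [← hκ n t] at h3
      filter_upwards [h1, h2, h3, h4] with x e1 e2 e3 e4
      by_cases hx : x ∈ Metric.ball (0 : E d) n
      · simp only [f, indicator_of_mem hx]
        rw [Pi.mul_apply] at e2
        rw [e1, e2, e3, Pi.smul_apply, e4, indicator_of_mem hx, smul_eq_mul, ← mul_assoc,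
          ENNReal.mul_inv_cancel hc0 hct, one_mul]
      · simp only [f, indicator_of_notMem hx]
    filter_upwards [ae_all_iff.2 hn] with x hx
    simp only [hx]
    refine le_antisymm (iSup_le fun n => indicator_le_self _ _ x) ?_
    obtain ⟨n, hn⟩ := exists_nat_gt ‖x‖
    refine le_trans (le_of_eq ?_) (le_iSup _ n)
    rw [indicator_of_mem (by simpa using hn)]
  · have : {t | m t ≪ γ} = ⋂ n, {t | κ n t ≪ η t} := by
      ext t
      simp only [mem_ofPred_eq, mem_iInter]
      constructor
      · intro h n
        refine (Measure.smul_absolutelyContinuous.trans ?_).trans (absolutelyContinuous_toFinite γ)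
        exact (Measure.absolutelyContinuous_of_le Measure.restrict_le_self).trans h
      · intro h
        refine SignedRadon.ac_of_bounded fun A hA hb h0 => ?_
        obtain ⟨R, hR⟩ := hb.subset_ball (0 : E d)
        obtain ⟨n, hn⟩ := exists_nat_gt R
        have h1 : κ n t A = 0 := h n (toFinite_absolutelyContinuous γ h0)
        rw [hκ, Measure.smul_apply, smul_eq_mul, mul_eq_zero, Measure.restrict_apply hA,
          inter_eq_left.2 (hR.trans (Metric.ball_subset_ball hn.le))] at h1
        refine h1.resolve_left ?_
        simpa using hball t n
    rw [this]
    exact MeasurableSet.iInter fun n => Kernel.measurableSet_absolutelyContinuous (κ n) η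

end JointDensity

/-! ### Borel families: measurability of the Jordan parts and of the action. -/

section BorelFamily

variable {d : ℕ} {T : Type*} [MeasurableSpace T]

/-- Borel families of signed Radon measures. -/
def BorelFamily (μ : T → SignedRadon d) : Prop :=
  ∀ A : Set (E d), MeasurableSet A → Bornology.IsBounded A → Measurable fun t => (μ t).val A

lemma BorelFamily.scale {μ : T → SignedRadon d} (h : BorelFamily μ) (c : ℝ) :
    BorelFamily fun t => (μ t).scale c := fun A hA hb => by
  simp only [SignedRadon.val_scale]
  exact (h A hA hb).const_mul c

/-- The supremum over all Borel sets is attained at the set `Nᶜ` carrying the positive part, and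
members of a generating algebra approximate `Nᶜ` in variation on `A`. With a countable algebra,
measurability of `t ↦ (μ t).val` passes to the positive part. -/
lemma SignedRadon.pos_eq_iSup (μ : SignedRadon d) {𝒞 : Set (Set (E d))} (h𝒞 : IsSetAlgebra 𝒞)
    (hgen : borel (E d) = MeasurableSpace.generateFrom 𝒞) {A : Set (E d)}
    (hb : Bornology.IsBounded A) :
    μ.pos A = ⨆ C ∈ 𝒞, ENNReal.ofReal (μ.val (A ∩ C)) := by
  have hlt : ∀ B : Set (E d), μ.pos (A ∩ B) ≠ ⊤ ∧ μ.neg (A ∩ B) ≠ ⊤ := fun B =>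
    ⟨(measure_lt_top_of_isBounded _ (hb.subset inter_subset_left)).ne,
      (measure_lt_top_of_isBounded _ (hb.subset inter_subset_left)).ne⟩
  refine le_antisymm ?_ (iSup₂_le fun C _ => ?_)
  · obtain ⟨N, hN, hN1, hN2⟩ := μ.sing
    have hfin : IsFiniteMeasure (μ.variation.restrict A) :=
      ⟨by rw [Measure.restrict_apply_univ]; exact measure_lt_top_of_isBounded _ hb⟩
    have hdense := Measure.MeasureDense.of_generateFrom_isSetAlgebra_finite
      (μ := μ.variation.restrict A) h𝒞 ((BorelSpace.measurable_eq (α := E d)).trans hgen)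
    refine ENNReal.le_of_forall_pos_le_add fun ε hε _ => ?_
    obtain ⟨C, hC, hCε⟩ := hdense.approx Nᶜ hN.compl (measure_ne_top _ _) ε hε
    have hCm := hdense.measurable C hC
    refine le_trans ?_ (add_le_add_left (le_iSup₂ C hC) _)
    rw [Measure.restrict_apply (hN.compl.symmDiff hCm)] at hCε
    have h1 : μ.pos A ≤ μ.pos (A ∩ C) + μ.pos (symmDiff Nᶜ C ∩ A) := by
      have hsub : A ⊆ (A ∩ C) ∪ (symmDiff Nᶜ C ∩ A) ∪ N := by
        intro x hx
        by_cases hxC : x ∈ C <;> by_cases hxN : x ∈ N <;>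
          simp [hx, hxC, hxN, Set.mem_symmDiff]
      refine (measure_mono hsub).trans ((measure_union_le _ _).trans ?_)
      rw [hN1, add_zero]
      exact measure_union_le _ _
    have h2 : μ.neg (A ∩ C) ≤ μ.neg (symmDiff Nᶜ C ∩ A) := by
      have hsub : A ∩ C ⊆ (symmDiff Nᶜ C ∩ A) ∪ Nᶜ := by
        intro x hx
        by_cases hxN : x ∈ N <;> simp [hx.1, hx.2, hxN, Set.mem_symmDiff]
      refine (measure_mono hsub).trans ((measure_union_le _ _).trans ?_)
      rw [hN2, add_zero]
    have h3 : μ.pos A + μ.neg (A ∩ C) ≤ μ.pos (A ∩ C) + ENNReal.ofReal ε := by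
      refine (add_le_add h1 h2).trans ?_
      rw [add_assoc]
      refine add_le_add le_rfl (le_trans (le_of_eq ?_) hCε.le)
      rw [SignedRadon.variation, Measure.add_apply]
    have h4 : μ.pos A ≠ ⊤ := (measure_lt_top_of_isBounded _ hb).ne
    rw [← ENNReal.ofReal_toReal h4, ← ENNReal.ofReal_toReal (hlt C).2, ← ENNReal.ofReal_toReal (hlt C).1,
      ← ENNReal.ofReal_add (by positivity) (by positivity),
      ← ENNReal.ofReal_add (by positivity) (by positivity),
      ENNReal.ofReal_le_ofReal_iff (by positivity)] at h3
    rw [← ENNReal.ofReal_toReal h4, show (ε : ℝ≥0∞) = ENNReal.ofReal ε by simp]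
    refine (ENNReal.ofReal_le_ofReal (q := μ.val (A ∩ C) + ε) ?_).trans ENNReal.ofReal_add_le
    simp only [SignedRadon.val, measureReal_def]
    linarith
  · refine (ENNReal.ofReal_le_ofReal (sub_le_self _ measureReal_nonneg)).trans ?_
    rw [measureReal_def, ENNReal.ofReal_toReal (hlt C).1]
    exact measure_mono inter_subset_left

lemma BorelFamily.measurable_pos {μ : T → SignedRadon d} (h : BorelFamily μ) {A : Set (E d)}
    (hA : MeasurableSet A) (hb : Bornology.IsBounded A) : Measurable fun t => (μ t).pos A := by
  set 𝒞 := generateSetAlgebra (MeasurableSpace.countableGeneratingSet (E d)) with h𝒞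
  have hgen : borel (E d) = MeasurableSpace.generateFrom 𝒞 := by
    rw [h𝒞, generateFrom_generateSetAlgebra_eq, MeasurableSpace.generateFrom_countableGeneratingSet,
      BorelSpace.measurable_eq (α := E d)]
  have hc : 𝒞.Countable := countable_generateSetAlgebra
    MeasurableSpace.countable_countableGeneratingSet
  simp only [SignedRadon.pos_eq_iSup _ isSetAlgebra_generateSetAlgebra hgen hb]
  refine Measurable.biSup _ hc fun C hC => ?_
  have hCm : MeasurableSet C := by
    rw [BorelSpace.measurable_eq (α := E d), hgen]
    exact MeasurableSpace.measurableSet_generateFrom hC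
  exact (h _ (hA.inter hCm) (hb.subset inter_subset_left)).ennreal_ofReal

lemma BorelFamily.measurable_neg {μ : T → SignedRadon d} (h : BorelFamily μ) {A : Set (E d)}
    (hA : MeasurableSet A) (hb : Bornology.IsBounded A) : Measurable fun t => (μ t).neg A := by
  have := (h.scale (-1)).measurable_pos hA hb
  simpa [SignedRadon.scale, Real.toNNReal_of_nonpos] using this

lemma BorelFamily.exists_measurable_density {μ : T → SignedRadon d} (h : BorelFamily μ)
    (γ : Measure (E d)) [IsLocallyFiniteMeasure γ] :
    ∃ r : T × E d → ℝ, Measurable r ∧ ∀ t, (fun x => r (t, x)) =ᵐ[γ] (μ t).density γ := by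
  obtain ⟨⟨f, hf, hfe⟩, -⟩ := exists_measurable_rnDeriv γ (fun t => (μ t).pos)
    fun A hA hb => h.measurable_pos hA hb
  obtain ⟨⟨g, hg, hge⟩, -⟩ := exists_measurable_rnDeriv γ (fun t => (μ t).neg)
    fun A hA hb => h.measurable_neg hA hb
  refine ⟨fun q => (f q).toReal - (g q).toReal, hf.ennreal_toReal.sub hg.ennreal_toReal,
    fun t => ?_⟩
  filter_upwards [hfe t, hge t] with x h1 h2
  simp only [SignedRadon.density, ← h1, ← h2]

lemma BorelFamily.measurableSet_ac {μ : T → SignedRadon d} (h : BorelFamily μ)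
    (γ : Measure (E d)) [IsLocallyFiniteMeasure γ] : MeasurableSet {t | (μ t).variation ≪ γ} := by
  simp only [SignedRadon.variation_ac_iff]
  exact (exists_measurable_rnDeriv γ (fun t => (μ t).pos)
    fun A hA hb => h.measurable_pos hA hb).2.inter (exists_measurable_rnDeriv γ (fun t => (μ t).neg)
    fun A hA hb => h.measurable_neg hA hb).2

/-- The action is `⊤` off the measurable set of parameters at which both measures are absolutely
continuous; on it, the action is the integral of a jointly measurable function. Without this, finite
energy would not yield finite action almost everywhere. -/
lemma measurable_action {p a b : ℝ} {φ : ℝ × E d → ℝ≥0∞} (hφ : IsActionDensityOn p a b φ)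
    (hp : 1 < p) (hab : a < b) (γ : Measure (E d)) [IsLocallyFiniteMeasure γ]
    {μ : T → SignedRadon d} (hμ : BorelFamily μ) {ν : T → VectorRadon d}
    (hν : ∀ i, BorelFamily fun t => ν t i) : Measurable fun t => action φ γ (μ t) (ν t) := by
  classical
  obtain ⟨r, hr, hre⟩ := hμ.exists_measurable_density γ
  choose w hw hwe using fun i => (hν i).exists_measurable_density γ
  set S : Set T := {t | (μ t).variation ≪ γ} ∩ ⋂ i, {t | (ν t i).variation ≪ γ} with hS
  have hSm : MeasurableSet S := (hμ.measurableSet_ac γ).inter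
    (MeasurableSet.iInter fun i => (hν i).measurableSet_ac γ)
  have heq : (fun t => action φ γ (μ t) (ν t)) = fun t => if t ∈ S then
      ∫⁻ x, φ (r (t, x), WithLp.toLp 2 fun i => w i (t, x)) ∂γ else ⊤ := by
    ext t
    split_ifs with ht
    · rw [action_of_ac ht.1 (mem_iInter.1 ht.2)]
      refine lintegral_congr_ae ?_
      filter_upwards [hre t, ae_all_iff.2 fun i => hwe i t] with x h1 h2
      simp only [h1, h2]
      rfl
    · by_contra h
      have := ac_of_action_ne_top hφ hp hab h
      exact ht ⟨this.1, mem_iInter.2 this.2⟩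
  rw [heq]
  refine Measurable.ite hSm ?_ measurable_const
  refine Measurable.lintegral_prod_right' (f := fun q : T × E d =>
    φ (r q, WithLp.toLp 2 fun i => w i q)) (hφ.lsc.measurable.comp (hr.prodMk ?_))
  exact (WithLp.measurable_toLp 2 _).comp (measurable_pi_lambda _ hw)

/-- The value on a compact set is a limit of integrals of test functions; a π-λ argument then
reaches all bounded Borel sets. -/
lemma borelFamily_of_continuous [TopologicalSpace T] [BorelSpace T] {μ : T → SignedRadon d}
    (h : Continuous μ) : BorelFamily μ := by
  have hclosed : ∀ K : Set (E d), IsCompact K → Measurable fun t => (μ t).val K := by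
    intro K hK
    obtain ⟨χ, hχ1, -, hχc, hχ⟩ := exists_continuous_one_zero_of_isCompact hK isClosed_empty
      (disjoint_empty K)
    have hKc := hK.isClosed
    -- The outer approximations of the indicator need not have compact support; the cutoff `χ`
    -- supplies it.
    have hcont : ∀ n, Continuous fun x => χ x * (hKc.apprSeq n x : ℝ) := fun n =>
      χ.continuous.mul (NNReal.continuous_coe.comp (hKc.apprSeq n).continuous)
    let ζ : ℕ → CompactlySupportedContinuousMap (E d) ℝ := fun n =>
      ⟨⟨fun x => χ x * (hKc.apprSeq n x : ℝ), hcont n⟩, hχc.mul_right⟩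
    have key : ∀ m : Measure (E d), IsLocallyFiniteMeasure m →
        Tendsto (fun n => ∫ x, ζ n x ∂m) atTop (𝓝 (m.real K)) := by
      intro m _
      rw [← integral_indicator_one hK.measurableSet]
      refine tendsto_integral_of_dominated_convergence χ
        (fun n => (hcont n).aestronglyMeasurable)
        (χ.continuous.integrable_of_hasCompactSupport hχc) (fun n => ae_of_all _ fun x => ?_)
        (ae_of_all _ fun x => ?_)
      · have h1 : (hKc.apprSeq n x : ℝ) ≤ 1 := by
          exact_mod_cast HasOuterApproxClosed.apprSeq_apply_le_one hKc n x
        change ‖χ x * (hKc.apprSeq n x : ℝ)‖ ≤ χ x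
        rw [Real.norm_of_nonneg (mul_nonneg (hχ x).1 NNReal.zero_le_coe)]
        exact mul_le_of_le_one_right (hχ x).1 h1
      · have h1 := (tendsto_pi_nhds.1 (HasOuterApproxClosed.tendsto_apprSeq hKc)) x
        have h2 := ((NNReal.continuous_coe.tendsto _).comp h1).const_mul (χ x)
        have h3 : K.indicator 1 x = χ x * ((K.indicator (fun _ => (1 : ℝ≥0)) x : ℝ≥0) : ℝ) := by
          by_cases hx : x ∈ K
          · simp [hx, hχ1 hx]
          · simp [hx]
        rw [h3]
        exact h2
    refine measurable_of_tendsto_metrizable (f := fun n t => (μ t).integral (ζ n))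
      (fun n => ((SignedRadon.continuous_integral (ζ n)).comp h).measurable) ?_
    exact tendsto_pi_nhds.2 fun t => (key _ (μ t).pos_lf).sub (key _ (μ t).neg_lf)
  intro A hA hb
  obtain ⟨R, hR⟩ := hb.subset_closedBall (0 : E d)
  set K := Metric.closedBall (0 : E d) R with hK
  have hKc : IsCompact K := isCompact_closedBall 0 R
  have hfin : ∀ m : Measure (E d), IsLocallyFiniteMeasure m → IsFiniteMeasure (m.restrict K) :=
    fun m _ => ⟨by rw [Measure.restrict_apply_univ]; exact hKc.measure_lt_top⟩
  have hfp := fun t => hfin (μ t).pos (μ t).pos_lf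
  have hfn := fun t => hfin (μ t).neg (μ t).neg_lf
  -- Restriction to one large ball gives finite signed measures, so complements and countable unions
  -- can be handled by subtraction and convergent sums.
  let s : T → SignedMeasure (E d) := fun t =>
    ((μ t).pos.restrict K).toSignedMeasure - ((μ t).neg.restrict K).toSignedMeasure
  have hs : ∀ t B, MeasurableSet B → s t B = (μ t).val (B ∩ K) := fun t B hB => by
    simp only [s, sub_apply, Measure.toSignedMeasure_apply_measurable hB,
      measureReal_restrict_apply hB, SignedRadon.val]
  suffices ∀ B, MeasurableSet B → Measurable fun t => s t B by
    have h1 := this A hA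
    simp only [hs _ A hA, inter_eq_left.2 hR] at h1
    exact h1
  have huniv : Measurable fun t => s t univ := by
    simp only [hs _ _ MeasurableSet.univ, univ_inter]
    exact hclosed K hKc
  intro B hB
  refine MeasurableSpace.induction_on_inter (C := fun B _ => Measurable fun t => s t B)
    ((BorelSpace.measurable_eq (α := E d)).trans borel_eq_generateFrom_isClosed)
    isPiSystem_isClosed (by simp) (fun F hF => ?_)
    (fun F hF hF' => ?_) (fun f hf hfm hfM => ?_) B hB
  · simp only [hs _ F (IsClosed.measurableSet hF)]
    exact hclosed _ (hKc.inter_left hF)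
  · have : ∀ t, s t Fᶜ = s t univ - s t F := fun t => by
      rw [← VectorMeasure.of_add_of_sdiff hF MeasurableSet.univ (subset_univ F), compl_eq_univ_sdiff]
      ring
    simp only [this]
    exact huniv.sub hF'
  · refine measurable_of_tendsto_metrizable (f := fun n t => ∑ i ∈ Finset.range n, s t (f i))
      (fun n => Finset.measurable_fun_sum _ fun i _ => hfM i) ?_
    exact tendsto_pi_nhds.2 fun t => ((s t).hasSum_of_disjoint_iUnion hfm hf).tendsto_sum_nat

end BorelFamily

/-- A continuous function on `[0,1]` with integrable weak derivative `G` on `(0,1)` satisfies the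
fundamental theorem of calculus. -/
lemma sub_eq_integral_of_weak_deriv {F G : ℝ → ℝ} (hF : ContinuousOn F (Icc 0 1))
    (hG : IntegrableOn G (Ioo 0 1))
    (h : ∀ η : ℝ → ℝ, ContDiff ℝ 1 η → HasCompactSupport η → tsupport η ⊆ Ioo 0 1 →
      (∫ t in Ioo (0 : ℝ) 1, deriv η t * F t) + ∫ t in Ioo (0 : ℝ) 1, η t * G t = 0) :
    F 1 - F 0 = ∫ t in Ioo (0 : ℝ) 1, G t := by
  have hII : ∀ f : ℝ → ℝ, ∫ t in Ioo (0 : ℝ) 1, f t = ∫ t in (0 : ℝ)..1, f t := fun f => by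
    rw [intervalIntegral.integral_of_le zero_le_one, integral_Ioc_eq_integral_Ioo]
  have hGi : IntervalIntegrable G volume 0 1 := by
    rwa [intervalIntegrable_iff_integrableOn_Ioo_of_le zero_le_one]
  set P : ℝ → ℝ := fun t => ∫ s in (0 : ℝ)..t, G s with hP
  have hPac : AbsolutelyContinuousOnInterval P 0 1 :=
    hGi.absolutelyContinuousOnInterval_intervalIntegral (by simp)
  have hPc : ContinuousOn P (Icc 0 1) := by
    simpa [uIcc_of_le (zero_le_one' ℝ)] using hPac.continuousOn
  -- `H` has zero weak derivative, so the claim is the du Bois-Reymond lemma: `H` is constant.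
  set H : ℝ → ℝ := fun t => F t - P t with hH
  have hHc : ContinuousOn H (Icc 0 1) := hF.sub hPc
  have hfi : ∀ {u f : ℝ → ℝ}, Continuous u → ContinuousOn f (Icc 0 1) →
      IntervalIntegrable (fun t => u t * f t) volume 0 1 := fun {u f} hu hf =>
    ContinuousOn.intervalIntegrable (by
      rw [uIcc_of_le zero_le_one]; exact hu.continuousOn.mul hf)
  -- A continuous `v` of mean zero that vanishes near both end points has a primitive which is an
  -- admissible test function; testing with it shows that `H` is orthogonal to `v`.
  have hparts : ∀ v : ℝ → ℝ, Continuous v → (∃ δ > 0, ∀ t, t ∉ Icc δ (1 - δ) → v t = 0) →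
      ∫ t in (0 : ℝ)..1, v t = 0 → ∫ t in (0 : ℝ)..1, v t * H t = 0 := by
    rintro v hv ⟨δ, hδ, hvδ⟩ hv0
    set η : ℝ → ℝ := fun t => ∫ s in (0 : ℝ)..t, v s with hη
    have hηd : ∀ t, HasDerivAt η (v t) t := fun t => (hv.integral_hasStrictDerivAt 0 t).hasDerivAt
    have hηderiv : deriv η = v := funext fun t => (hηd t).deriv
    have hη1 : ContDiff ℝ 1 η := by
      rw [contDiff_one_iff_deriv, hηderiv]
      exact ⟨fun t => (hηd t).differentiableAt, hv⟩
    have hη0 : ∀ t, t ∉ Icc δ (1 - δ) → η t = 0 := by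
      intro t ht
      rw [mem_Icc, not_and_or, not_le, not_le] at ht
      rcases ht with ht | ht
      · refine intervalIntegral.integral_zero_ae (ae_of_all _ fun s hs => hvδ s fun hs' => ?_)
        rw [uIoc, mem_Ioc] at hs
        rcases le_max_iff.1 hs.2 with h1 | h1
        · linarith [hs'.1]
        · linarith [hs'.1]
      · have : η t = (∫ s in (0 : ℝ)..1, v s) + ∫ s in (1 : ℝ)..t, v s :=
          (intervalIntegral.integral_add_adjacent_intervals (hv.intervalIntegrable _ _)
            (hv.intervalIntegrable _ _)).symm
        rw [this, hv0, zero_add]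
        refine intervalIntegral.integral_zero_ae (ae_of_all _ fun s hs => hvδ s fun hs' => ?_)
        rw [uIoc, mem_Ioc] at hs
        rcases min_lt_iff.1 hs.1 with h1 | h1
        · linarith [hs'.2]
        · linarith [hs'.2]
    have hts : tsupport η ⊆ Icc δ (1 - δ) := closure_minimal (fun t ht => by
      by_contra h'
      exact ht (hη0 t h')) isClosed_Icc
    have hηc : HasCompactSupport η := isCompact_Icc.of_isClosed_subset (isClosed_tsupport η) hts
    have h1 := h η hη1 hηc (hts.trans fun t ht => ⟨hδ.trans_le ht.1, by linarith [ht.2]⟩)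
    rw [hII, hII, hηderiv] at h1
    have hηac : AbsolutelyContinuousOnInterval η 0 1 :=
      (hv.intervalIntegrable 0 1).absolutelyContinuousOnInterval_intervalIntegral (by simp)
    have h2 := hηac.integral_mul_deriv_eq_deriv_mul hPac
    have e0 : η 0 = 0 := by simp [hη]
    rw [hηderiv, show η 1 = 0 from hv0, e0, zero_mul, zero_mul, sub_zero, zero_sub] at h2
    have h3 : ∫ t in (0 : ℝ)..1, η t * deriv P t = ∫ t in (0 : ℝ)..1, η t * G t := by
      refine intervalIntegral.integral_congr_ae ?_
      filter_upwards [hGi.ae_hasDerivAt_integral] with t ht hmem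
      rw [(ht (uIoc_subset_uIcc hmem) 0 (by simp)).deriv]
    have h4 : ∫ t in (0 : ℝ)..1, v t * H t =
        (∫ t in (0 : ℝ)..1, v t * F t) - ∫ t in (0 : ℝ)..1, v t * P t := by
      rw [← intervalIntegral.integral_sub (hfi hv hF) (hfi hv hPc)]
      exact intervalIntegral.integral_congr fun t _ => by simp only [hH]; ring
    rw [h4]
    linarith
  have hconst : ∀ δ : ℝ, 0 < δ → δ < 1 / 2 → ∃ c, ∀ t ∈ Ioo δ (1 - δ), H t = c := by
    intro δ hδ hδ2
    set χ : ℝ → ℝ := fun t => max 0 (min (t - δ) (1 - δ - t)) with hχ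
    have hχc : Continuous χ := by fun_prop
    have hχ0 : ∀ t, 0 ≤ χ t := fun t => le_max_left _ _
    have hχpos : ∀ t ∈ Ioo δ (1 - δ), 0 < χ t := fun t ht =>
      lt_max_of_lt_right (lt_min (by linarith [ht.1]) (by linarith [ht.2]))
    have hχz : ∀ t, t ∉ Icc δ (1 - δ) → χ t = 0 := by
      intro t ht
      rw [mem_Icc, not_and_or, not_le, not_le] at ht
      refine max_eq_left ?_
      rcases ht with ht | ht
      · exact (min_le_left _ _).trans (by linarith)
      · exact (min_le_right _ _).trans (by linarith)
    -- `hparts` needs test functions continuous on all of `ℝ`, while `H` is known to be continuous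
    -- only on `[0,1]`.
    set Hx : ℝ → ℝ := IccExtend zero_le_one ((Icc (0 : ℝ) 1).domRestrict H) with hHx
    have hHxc : Continuous Hx := (continuousOn_iff_continuous_domRestrict.1 hHc).Icc_extend'
    have hHxe : ∀ t ∈ Icc (0 : ℝ) 1, Hx t = H t := fun t ht => by
      rw [hHx, IccExtend_of_mem zero_le_one _ ht, domRestrict_apply]
    have hmid : (1 / 2 : ℝ) ∈ Ioo δ (1 - δ) := ⟨hδ2, by linarith⟩
    have hI : 0 < ∫ t in (0 : ℝ)..1, χ t :=
      intervalIntegral.integral_pos one_pos hχc.continuousOn (fun t _ => hχ0 t)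
        ⟨1 / 2, by norm_num, hχpos _ hmid⟩
    -- With `c` the `χ`-weighted mean of `H`, the function `χ (H - c)` is admissible in `hparts`.
    -- Orthogonality gives `∫ χ (H - c)² = 0`, so `H = c` where `χ > 0`.
    set c := (∫ t in (0 : ℝ)..1, χ t * Hx t) / ∫ t in (0 : ℝ)..1, χ t with hc
    have hvc : Continuous fun t => χ t * (Hx t - c) := hχc.mul (hHxc.sub continuous_const)
    have hv0 : ∫ t in (0 : ℝ)..1, χ t * (Hx t - c) = 0 := by
      simp only [mul_sub]
      have i1 : Continuous fun t => χ t * Hx t := hχc.mul hHxc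
      have i2 : Continuous fun t => χ t * c := hχc.mul continuous_const
      rw [intervalIntegral.integral_sub (i1.intervalIntegrable _ _) (i2.intervalIntegrable _ _),
        intervalIntegral.integral_mul_const, hc,
        mul_div_cancel₀ _ hI.ne', sub_self]
    have h1 := hparts _ hvc ⟨δ, hδ, fun t ht => by rw [hχz t ht, zero_mul]⟩ hv0
    have h2 : ∫ t in (0 : ℝ)..1, χ t * (Hx t - c) ^ 2 = 0 := by
      have : ∫ t in (0 : ℝ)..1, χ t * (Hx t - c) ^ 2 =
          (∫ t in (0 : ℝ)..1, χ t * (Hx t - c) * H t) - c * ∫ t in (0 : ℝ)..1, χ t * (Hx t - c) := by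
        rw [← intervalIntegral.integral_const_mul, ← intervalIntegral.integral_sub (hfi hvc hHc)
          ((hvc.const_mul c).intervalIntegrable _ _)]
        refine intervalIntegral.integral_congr fun t ht => ?_
        rw [uIcc_of_le zero_le_one] at ht
        simp only [← hHxe t ht]
        ring
      rw [this, h1, hv0, mul_zero, sub_zero]
    refine ⟨c, fun t ht => ?_⟩
    have ht01 : t ∈ Icc (0 : ℝ) 1 := ⟨by linarith [ht.1], by linarith [ht.2]⟩
    rw [← hHxe t ht01]
    by_contra hne
    have hsq : 0 < (Hx t - c) ^ 2 := by
      have := sub_ne_zero.2 hne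
      positivity
    have : 0 < ∫ t in (0 : ℝ)..1, χ t * (Hx t - c) ^ 2 :=
      intervalIntegral.integral_pos one_pos
        (hχc.mul ((hHxc.sub continuous_const).pow 2)).continuousOn
        (fun s _ => mul_nonneg (hχ0 s) (sq_nonneg _)) ⟨t, ht01, mul_pos (hχpos t ht) hsq⟩
    exact this.ne' h2
  have hIoo : EqOn H (fun _ => H (1 / 2)) (Ioo 0 1) := by
    intro t ht
    -- Small enough for one interval `(δ, 1 - δ)` to contain both `t` and `1/2`.
    set δ := min t (min (1 - t) (1 / 2)) / 2 with hδ
    have hm : 0 < min t (min (1 - t) (1 / 2)) :=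
      lt_min ht.1 (lt_min (by linarith [ht.2]) (by norm_num))
    have m1 := min_le_left t (min (1 - t) (1 / 2))
    have m2 := (min_le_right t (min (1 - t) (1 / 2))).trans (min_le_left _ _)
    have m3 := (min_le_right t (min (1 - t) (1 / 2))).trans (min_le_right _ _)
    obtain ⟨c, hc⟩ := hconst δ (by positivity) (by rw [hδ]; linarith)
    rw [hc t ⟨by rw [hδ]; linarith, by rw [hδ]; linarith⟩,
      hc (1 / 2) ⟨by rw [hδ]; linarith, by rw [hδ]; linarith⟩]
  have hIcc : EqOn H (fun _ => H (1 / 2)) (Icc 0 1) :=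
    hIoo.of_subset_closure hHc continuousOn_const Ioo_subset_Icc_self
      (by rw [closure_Ioo zero_ne_one])
  have h0 := hIcc (left_mem_Icc.2 zero_le_one)
  have h1 := hIcc (right_mem_Icc.2 zero_le_one)
  rw [hII]
  have e0 : P 0 = 0 := by simp [hP]
  have e1 : P 1 = ∫ s in (0 : ℝ)..1, G s := rfl
  simp only [hH] at h0 h1
  rw [← e1]
  linarith

/-! ### Sections and derivatives of space-time test functions. -/

section Sections

variable {d : ℕ}

lemma hasCompactSupport_section {h : E d × ℝ → ℝ} (hc : HasCompactSupport h) (t : ℝ) :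
    HasCompactSupport fun x => h (x, t) := by
  refine HasCompactSupport.intro (K := Prod.fst '' tsupport h) (hc.image continuous_fst)
    fun x hx => ?_
  by_contra hne
  exact hx ⟨(x, t), subset_tsupport h hne, rfl⟩

/-- A cutoff dominating the spatial support of a compactly supported function on space-time. -/
lemma exists_cutoff {h : E d × ℝ → ℝ} (hc : HasCompactSupport h) :
    ∃ χ : CompactlySupportedContinuousMap (E d) ℝ, (∀ x, 0 ≤ χ x) ∧
      ∀ x, (∃ t, h (x, t) ≠ 0) → χ x = 1 := by
  obtain ⟨χ, hχ1, -, hχc, hχ⟩ := exists_continuous_one_zero_of_isCompact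
    (hc.image continuous_fst) isClosed_empty (disjoint_empty _)
  exact ⟨⟨χ, hχc⟩, fun x => (hχ x).1, fun x ⟨t, ht⟩ =>
    hχ1 ⟨(x, t), subset_tsupport h ht, rfl⟩⟩

lemma exists_ball_section {h : E d × ℝ → ℝ} (hcont : Continuous h) (hc : HasCompactSupport h) :
    ∃ R : ℝ, 0 < R ∧ ∃ L : ℝ, 0 ≤ L ∧ ∀ x t, |h (x, t)| ≤ L ∧
      (x ∉ Metric.ball (0 : E d) R → h (x, t) = 0) := by
  obtain ⟨L, hL⟩ := hcont.bounded_above_of_compact_support hc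
  obtain ⟨R, hR⟩ := (hc.image continuous_fst).isBounded.subset_ball (0 : E d)
  refine ⟨max R 1, by positivity, L, (norm_nonneg _).trans (hL (0, 0)), fun x t => ⟨hL _, fun hx => ?_⟩⟩
  by_contra hne
  exact hx (Metric.ball_subset_ball (le_max_left _ _) (hR ⟨(x, t), subset_tsupport h hne, rfl⟩))

lemma deriv_section {ζ : E d × ℝ → ℝ} (hζ : ContDiff ℝ 1 ζ) (x : E d) (t : ℝ) :
    HasDerivAt (fun s => ζ (x, s)) (fderiv ℝ ζ (x, t) (0, 1)) t := by
  have h1 := (hζ.differentiable one_ne_zero (x, t)).hasFDerivAt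
  have h2 : HasDerivAt (fun s : ℝ => ((x, s) : E d × ℝ)) (0, 1) t :=
    (hasDerivAt_const t x).prodMk (hasDerivAt_id t)
  exact h1.comp_hasDerivAt t h2

lemma fderiv_section {ζ : E d × ℝ → ℝ} (hζ : ContDiff ℝ 1 ζ) (x : E d) (t : ℝ) (v : E d) :
    fderiv ℝ (fun y => ζ (y, t)) x v = fderiv ℝ ζ (x, t) (v, 0) := by
  have h1 := (hζ.differentiable one_ne_zero (x, t)).hasFDerivAt
  have h2 : HasFDerivAt (fun y : E d => ((y, t) : E d × ℝ))
      ((ContinuousLinearMap.id ℝ (E d)).prod 0) x :=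
    (hasFDerivAt_id x).prodMk (hasFDerivAt_const t x)
  have h3 : HasFDerivAt (fun y => ζ (y, t)) _ x := HasFDerivAt.comp x h1 h2
  rw [h3.fderiv]
  rfl

lemma continuous_fderiv_apply_const {ζ : E d × ℝ → ℝ} (hζ : ContDiff ℝ 1 ζ) (v : E d × ℝ) :
    Continuous fun q => fderiv ℝ ζ q v :=
  (hζ.continuous_fderiv one_ne_zero).clm_apply continuous_const

end Sections

/-! ### Integral estimates for signed measures. -/

namespace SignedRadon

variable {d : ℕ} {γ : Measure (E d)} {μ : SignedRadon d}

lemma integral_add {f g : E d → ℝ} (hf : Continuous f) (hfc : HasCompactSupport f)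
    (hg : Continuous g) (hgc : HasCompactSupport g) :
    μ.integral (fun x => f x + g x) = μ.integral f + μ.integral g := by
  have hi : ∀ (m : Measure (E d)), IsLocallyFiniteMeasure m → Integrable f m ∧ Integrable g m :=
    fun m _ => ⟨hf.integrable_of_hasCompactSupport hfc, hg.integrable_of_hasCompactSupport hgc⟩
  simp only [integral]
  rw [MeasureTheory.integral_add (hi _ μ.pos_lf).1 (hi _ μ.pos_lf).2,
    MeasureTheory.integral_add (hi _ μ.neg_lf).1 (hi _ μ.neg_lf).2]
  ring

lemma integral_const_mul (c : ℝ) (f : E d → ℝ) :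
    μ.integral (fun x => c * f x) = c * μ.integral f := by
  simp only [integral, MeasureTheory.integral_const_mul]
  ring

lemma integral_sub {f g : E d → ℝ} (hf : Continuous f) (hfc : HasCompactSupport f)
    (hg : Continuous g) (hgc : HasCompactSupport g) :
    μ.integral (fun x => f x - g x) = μ.integral f - μ.integral g := by
  have h1 : (fun x => f x - g x) = fun x => f x + (-1) * g x := by ext; ring
  have h2 : HasCompactSupport fun x => (-1) * g x := hgc.mul_left
  have h3 : Continuous fun x => (-1) * g x := continuous_const.mul hg
  rw [h1, integral_add hf hfc h3 h2, integral_const_mul]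
  ring

lemma enorm_integral_le {f : E d → ℝ} {L : ℝ} (hL : ∀ x, |f x| ≤ L) {B : Set (E d)}
    (hB : MeasurableSet B) (hf : ∀ x, x ∉ B → f x = 0) :
    ‖μ.integral f‖ₑ ≤ ENNReal.ofReal L * μ.variation B := by
  have key : ∀ m : Measure (E d), ‖∫ x, f x ∂m‖ₑ ≤ ENNReal.ofReal L * m B := by
    intro m
    refine (enorm_integral_le_lintegral_enorm _).trans ?_
    rw [← setLIntegral_const, ← lintegral_indicator hB]
    refine lintegral_mono fun x => ?_
    by_cases hx : x ∈ B
    · rw [indicator_of_mem hx, Real.enorm_eq_ofReal_abs]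
      exact ENNReal.ofReal_le_ofReal (hL x)
    · simp [hf x hx]
  rw [integral, variation, Measure.add_apply, mul_add]
  exact (enorm_sub_le).trans (add_le_add (key _) (key _))

/-- The bound involves `γ` but not `μ`, so it is uniform along curves and over all measures at
finite distance. -/
lemma Between.abs_integral_le [IsLocallyFiniteMeasure γ] {a b : ℝ} (hab : a ≤ b)
    (h : μ.Between a b γ) {f : E d → ℝ} (hf : Continuous f) (hfc : HasCompactSupport f) {ε : ℝ}
    {χ : CompactlySupportedContinuousMap (E d) ℝ} (hχ : ∀ x, |f x| ≤ ε * χ x) :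
    |μ.integral f| ≤ max |a| |b| * (ε * ∫ x, χ x ∂γ) := by
  obtain ⟨ρ, hρ, hd⟩ := (between_iff_hasDensity hab).1 h
  refine (hd.abs_integral_le (fun x => abs_le_max_abs_abs (hρ x).1 (hρ x).2) hf hfc).trans ?_
  gcongr
  rw [← MeasureTheory.integral_const_mul]
  exact integral_mono (hf.integrable_of_hasCompactSupport hfc).abs (χ.integrable.const_mul ε) hχ

end SignedRadon

/-- Splitting at `|w| = l` gives `|w| ≤ l + l^(1-p) |w|^p`, and coercivity replaces `|w|^p` by `φ /
c`. The free parameter `l` takes the place of Hölder's inequality. -/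
lemma variation_le_action {d : ℕ} {p a b c : ℝ} {φ : ℝ × E d → ℝ≥0∞}
    (hφ : IsActionDensityOn p a b φ) (hp : 1 < p) (hab : a < b) (hc : 0 < c)
    (hcφ : ∀ (ρ : ℝ) (w : E d), ENNReal.ofReal (c * ‖w‖ ^ p) ≤ φ (ρ, w)) {γ : Measure (E d)}
    [IsLocallyFiniteMeasure γ] (μ : SignedRadon d) (ν : VectorRadon d) (i : Fin d) {l : ℝ}
    (hl : 0 < l) {B : Set (E d)} (hB : MeasurableSet B) :
    (ν i).variation B ≤ ENNReal.ofReal l * γ B +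
      ENNReal.ofReal (l ^ (1 - p) / c) * action φ γ μ ν := by
  have hlc : 0 < l ^ (1 - p) / c := div_pos (Real.rpow_pos_of_pos hl _) hc
  by_cases h : action φ γ μ ν = ⊤
  · rw [h, ENNReal.mul_top (by simpa using hlc)]
    simp
  obtain ⟨hμ, hν⟩ := ac_of_action_ne_top hφ hp hab h
  have hd := SignedRadon.hasDensity_density (SignedRadon.variation_ac_iff.1 (hν i)).1
    (SignedRadon.variation_ac_iff.1 (hν i)).2
  rw [action_of_ac hμ hν, hd.variation, withDensity_apply _ hB,
    ← lintegral_const_mul' _ _ ENNReal.ofReal_ne_top, ← setLIntegral_const]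
  refine le_trans ?_ (add_le_add le_rfl (setLIntegral_le_lintegral B _))
  rw [← lintegral_add_left measurable_const]
  refine lintegral_mono fun x => ?_
  set w := ν.density γ x with hw
  have h1 : |(ν i).density γ x| ≤ ‖w‖ := by
    have := PiLp.norm_apply_le w i
    rwa [Real.norm_eq_abs] at this
  have h2 : ‖w‖ ≤ l + l ^ (1 - p) * ‖w‖ ^ p := by
    rcases le_total ‖w‖ l with hle | hle
    · have : 0 ≤ l ^ (1 - p) * ‖w‖ ^ p := by positivity
      linarith
    · have hw0 : 0 < ‖w‖ := hl.trans_le hle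
      have h3 : ‖w‖ ^ (1 - p) ≤ l ^ (1 - p) :=
        Real.rpow_le_rpow_of_nonpos hl hle (by linarith)
      have h4 : ‖w‖ = ‖w‖ ^ (1 - p) * ‖w‖ ^ p := by
        rw [← Real.rpow_add hw0, sub_add_cancel, Real.rpow_one]
      have h5 : ‖w‖ ^ (1 - p) * ‖w‖ ^ p ≤ l ^ (1 - p) * ‖w‖ ^ p := by gcongr
      linarith
  calc ENNReal.ofReal |(ν i).density γ x| ≤ ENNReal.ofReal (l + l ^ (1 - p) / c * (c * ‖w‖ ^ p)) := by
        refine ENNReal.ofReal_le_ofReal (h1.trans (h2.trans (le_of_eq ?_)))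
        field_simp
    _ = ENNReal.ofReal l + ENNReal.ofReal (l ^ (1 - p) / c) * ENNReal.ofReal (c * ‖w‖ ^ p) := by
        rw [ENNReal.ofReal_add hl.le (by positivity), ENNReal.ofReal_mul hlc.le]
    _ ≤ _ := by
        gcongr
        exact hcφ _ _

/-! ### Curves of finite energy. -/

section Curves

variable {d : ℕ} {p a b : ℝ} {φ : ℝ × E d → ℝ≥0∞} {γ : Measure (E d)} {μ₀ μ₁ : SignedRadon d}
  {c : (ℝ → SignedRadon d) × (ℝ → VectorRadon d)}

/-- The energy of a curve on the unit interval. -/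
def energy (φ : ℝ × E d → ℝ≥0∞) (γ : Measure (E d))
    (c : (ℝ → SignedRadon d) × (ℝ → VectorRadon d)) : ℝ≥0∞ :=
  ∫⁻ t in Ioo (0 : ℝ) 1, action φ γ (c.1 t) (c.2 t)

/-- Connecting curves of finite energy whose parametrization is extended regularly to all of `ℝ`. -/
structure IsRegularCurve (φ : ℝ × E d → ℝ≥0∞) (γ : Measure (E d)) (μ₀ μ₁ : SignedRadon d)
    (c : (ℝ → SignedRadon d) × (ℝ → VectorRadon d)) : Prop where
  mem : c ∈ finiteEnergyCE φ γ 1 μ₀ μ₁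
  continuous : Continuous c.1
  borel : ∀ i, BorelFamily fun t => c.2 t i

lemma IsCE.congr {T : ℝ} {μ μ' : ℝ → SignedRadon d} {ν ν' : ℝ → VectorRadon d} (h : IsCE T μ ν)
    (hμ : EqOn μ' μ (Icc 0 T)) (hν : EqOn ν' ν (Ioo 0 T)) : IsCE T μ' ν' where
  continuousOn := h.continuousOn.congr hμ
  borel i A hA hb := by
    have : (fun t : Ioo (0 : ℝ) T => (ν' t i).val A) = fun t : Ioo (0 : ℝ) T => (ν t i).val A := by
      ext t
      rw [hν t.2]
    rw [this]
    exact h.borel i A hA hb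
  finite_left R hR := by
    rw [setLIntegral_congr_fun measurableSet_Ioo fun t ht => by
      rw [hμ (Ioo_subset_Icc_self ht)]]
    exact h.finite_left R hR
  finite_right R hR i := by
    rw [setLIntegral_congr_fun measurableSet_Ioo fun t ht => by rw [hν ht]]
    exact h.finite_right R hR i
  equation ζ h1 h2 h3 := by
    rw [setIntegral_congr_fun measurableSet_Ioo fun t ht => by
      simp only [hμ (Ioo_subset_Icc_self ht)]; rfl]
    nth_rewrite 2 [setIntegral_congr_fun measurableSet_Ioo fun t ht => by
      simp only [hν ht]; rfl]
    exact h.equation ζ h1 h2 h3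

/-- Only times in `[0,1]` matter: `μ` is frozen at its end values and the flux is set to zero
outside `(0,1)`. Time changes and measurability can then be treated on all of `ℝ`. -/
lemma exists_isRegularCurve (hc : c ∈ finiteEnergyCE φ γ 1 μ₀ μ₁) :
    ∃ c', IsRegularCurve φ γ μ₀ μ₁ c' ∧ energy φ γ c' = energy φ γ c := by
  classical
  obtain ⟨hce, h0, h1, hE⟩ := hc
  let c' : (ℝ → SignedRadon d) × (ℝ → VectorRadon d) :=
    (IccExtend zero_le_one ((Icc (0 : ℝ) 1).domRestrict c.1),
      fun t i => if t ∈ Ioo (0 : ℝ) 1 then c.2 t i else (c.2 t i).scale 0)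
  have e1 : EqOn c'.1 c.1 (Icc 0 1) := fun t ht => by
    simp only [c']
    rw [IccExtend_of_mem zero_le_one _ ht, domRestrict_apply]
  have e2 : EqOn c'.2 c.2 (Ioo 0 1) := fun t ht => by
    ext1 i
    simp only [c', if_pos ht]
  have hen : energy φ γ c' = energy φ γ c :=
    setLIntegral_congr_fun measurableSet_Ioo fun t ht => by
      simp only [e1 (Ioo_subset_Icc_self ht), e2 ht]
  refine ⟨c', ⟨⟨hce.congr e1 e2, ?_, ?_, ?_⟩, ?_, fun i A hA hb => ?_⟩, hen⟩
  · rw [e1 (left_mem_Icc.2 zero_le_one), h0]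
  · rw [e1 (right_mem_Icc.2 zero_le_one), h1]
  · exact hen.trans_lt hE
  · exact (continuousOn_iff_continuous_domRestrict.1 hce.continuousOn).Icc_extend'
  · have : (fun t => (c'.2 t i).val A) = fun t => if h : t ∈ Ioo (0 : ℝ) 1 then
        (fun s : Ioo (0 : ℝ) 1 => (c.2 s i).val A) ⟨t, h⟩ else (fun _ => 0) (⟨t, h⟩ : {t // t ∉ Ioo (0 : ℝ) 1}) := by
      ext t
      by_cases ht : t ∈ Ioo (0 : ℝ) 1
      · simp only [c', if_pos ht, dif_pos ht]
      · simp only [c', if_neg ht, dif_neg ht, SignedRadon.val_scale, zero_mul]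
    rw [this]
    exact Measurable.dite (hce.borel i A hA hb) measurable_const measurableSet_Ioo

namespace IsRegularCurve

variable [IsLocallyFiniteMeasure γ]

lemma ae_action_ne_top (hφ : IsActionDensityOn p a b φ) (hp : 1 < p) (hab : a < b)
    (hc : IsRegularCurve φ γ μ₀ μ₁ c) :
    ∀ᵐ t ∂volume.restrict (Ioo (0 : ℝ) 1), action φ γ (c.1 t) (c.2 t) ≠ ⊤ :=
  (ae_lt_top (measurable_action hφ hp hab γ (borelFamily_of_continuous hc.continuous) hc.borel)
    hc.mem.2.2.2.ne).mono fun _ h => h.ne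

/-- The bad times in `(0,1)` form an open set by weak* closedness and a null set by finiteness of
the energy, so there are none. The end points follow by closure. -/
lemma between (hφ : IsActionDensityOn p a b φ) (hp : 1 < p) (hab : a < b)
    (hc : IsRegularCurve φ γ μ₀ μ₁ c) {t : ℝ} (ht : t ∈ Icc (0 : ℝ) 1) :
    (c.1 t).Between a b γ := by
  have hcl : IsClosed {t | (c.1 t).Between a b γ} :=
    (SignedRadon.isClosed_between hab.le).preimage hc.continuous
  have hsub : Ioo (0 : ℝ) 1 ⊆ {t | (c.1 t).Between a b γ} := by
    have hopen : IsOpen (Ioo (0 : ℝ) 1 ∩ {t | (c.1 t).Between a b γ}ᶜ) :=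
      isOpen_Ioo.inter hcl.isOpen_compl
    have hae := (hc.ae_action_ne_top hφ hp hab).mono fun t ht =>
      between_of_action_ne_top hφ hp hab ht
    rw [ae_restrict_iff' measurableSet_Ioo] at hae
    have hnull : volume (Ioo (0 : ℝ) 1 ∩ {t | (c.1 t).Between a b γ}ᶜ) = 0 := by
      refine measure_mono_null (fun t ht => ?_) (ae_iff.1 hae)
      exact fun h => ht.2 (h ht.1)
    rw [hopen.measure_eq_zero_iff volume] at hnull
    intro t ht
    by_contra h
    exact (hnull ▸ (⟨ht, h⟩ : t ∈ Ioo (0 : ℝ) 1 ∩ {t | (c.1 t).Between a b γ}ᶜ) : t ∈ (∅ : Set ℝ))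
  rw [← closure_Ioo zero_ne_one] at ht
  exact closure_minimal hsub hcl ht

/-- Both measure and integrand vary with `t`. The change of integrand is small by uniform continuity
and the mass bound common to all `c.1 t`; the change of measure is weak* continuity. -/
lemma continuousOn_integral (hφ : IsActionDensityOn p a b φ) (hp : 1 < p) (hab : a < b)
    (hc : IsRegularCurve φ γ μ₀ μ₁ c) {h : E d × ℝ → ℝ} (hcont : Continuous h)
    (hcs : HasCompactSupport h) :
    ContinuousOn (fun t => (c.1 t).integral fun x => h (x, t)) (Icc 0 1) := by
  have hsec : ∀ t, Continuous fun x => h (x, t) := fun t => by fun_prop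
  obtain ⟨χ, hχ0, hχ1⟩ := exists_cutoff hcs
  intro t₀ ht₀
  have hfix : Continuous fun t => (c.1 t).integral fun x => h (x, t₀) :=
    (SignedRadon.continuous_integral ⟨⟨_, hsec t₀⟩, hasCompactSupport_section hcs t₀⟩).comp
      hc.continuous
  have hdiff : Tendsto (fun t => (c.1 t).integral fun x => h (x, t) - h (x, t₀))
      (𝓝[Icc 0 1] t₀) (𝓝 0) := by
    rw [Metric.tendsto_nhdsWithin_nhds]
    intro ε hε
    set C := max |a| |b| * ∫ x, χ x ∂γ with hC
    have hC0 : 0 ≤ C := mul_nonneg (le_max_of_le_left (abs_nonneg _)) (integral_nonneg hχ0)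
    obtain ⟨δ, hδ, hu⟩ := Metric.uniformContinuous_iff.1
      (hcs.uniformContinuous_of_continuous hcont) (ε / (C + 1)) (by positivity)
    refine ⟨δ, hδ, fun {t} ht htd => ?_⟩
    rw [Real.dist_eq, sub_zero]
    have hdc : Continuous fun x => h (x, t) - h (x, t₀) := (hsec t).sub (hsec t₀)
    have hds : HasCompactSupport fun x => h (x, t) - h (x, t₀) :=
      (hasCompactSupport_section hcs t).sub (hasCompactSupport_section hcs t₀)
    have hb := (hc.between hφ hp hab ht).abs_integral_le hab.le hdc hds (ε := ε / (C + 1)) (χ := χ) fun x => by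
        by_cases hx : ∃ s, h (x, s) ≠ 0
        · rw [hχ1 x hx, mul_one, ← Real.dist_eq]
          refine (hu ?_).le
          rw [Prod.dist_eq, dist_self]
          exact max_lt hδ htd
        · push Not at hx
          simp only [hx, sub_self, abs_zero]
          exact mul_nonneg (by positivity) (hχ0 x)
    refine hb.trans_lt ?_
    rw [mul_left_comm, ← hC, div_mul_eq_mul_div, div_lt_iff₀ (by positivity)]
    nlinarith
  have hsum := hdiff.add (hfix.continuousWithinAt (s := Icc 0 1) (x := t₀))
  rw [zero_add] at hsum
  refine hsum.congr fun t => ?_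
  rw [SignedRadon.integral_sub (hsec t) (hasCompactSupport_section hcs t) (hsec t₀)
    (hasCompactSupport_section hcs t₀)]
  ring

/-- The flux is only a Borel family, so measurability comes from a jointly measurable density and
Fubini rather than from continuity; integrability comes from the local mass bound. -/
lemma integrableOn_integral_vector (hφ : IsActionDensityOn p a b φ) (hp : 1 < p) (hab : a < b)
    (hc : IsRegularCurve φ γ μ₀ μ₁ c) {h : E d × ℝ → ℝ} (hcont : Continuous h)
    (hcs : HasCompactSupport h) (i : Fin d) :
    IntegrableOn (fun t => (c.2 t i).integral fun x => h (x, t)) (Ioo 0 1) := by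
  have hsec : ∀ t, Continuous fun x => h (x, t) := fun t => by fun_prop
  refine ⟨?_, ?_⟩
  · obtain ⟨r, hr, hre⟩ := (hc.borel i).exists_measurable_density γ
    have hsm : StronglyMeasurable fun t => ∫ x, h (x, t) * r (t, x) ∂γ :=
      StronglyMeasurable.integral_prod_right (f := fun t x => h (x, t) * r (t, x))
        (((hcont.measurable.comp measurable_swap).mul hr).stronglyMeasurable)
    refine ⟨_, hsm, ?_⟩
    filter_upwards [hc.ae_action_ne_top hφ hp hab] with t ht
    have hac := SignedRadon.variation_ac_iff.1 ((ac_of_action_ne_top hφ hp hab ht).2 i)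
    exact ((SignedRadon.hasDensity_density hac.1 hac.2).congr (by fun_prop)
      (hre t).symm).integral_eq (hsec t) (hasCompactSupport_section hcs t)
  · obtain ⟨R, hR, L, hL, hLR⟩ := exists_ball_section hcont hcs
    have hfin := hc.mem.1.finite_right R hR i
    rw [HasFiniteIntegral]
    refine (lintegral_mono fun t => SignedRadon.enorm_integral_le (fun x => (hLR x t).1)
      (measurableSet_ball (x := (0 : E d)) (ε := R)) fun x hx => (hLR x t).2 hx).trans_lt ?_
    rw [lintegral_const_mul' _ _ ENNReal.ofReal_ne_top]
    exact ENNReal.mul_lt_top ENNReal.ofReal_lt_top hfin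

end IsRegularCurve

end Curves

/-! ### The continuity equation up to the end points. -/

section ContinuityEquation

variable {d : ℕ} {p a b : ℝ} {φ : ℝ × E d → ℝ≥0∞} {γ : Measure (E d)} {μ₀ μ₁ : SignedRadon d}
  {c : (ℝ → SignedRadon d) × (ℝ → VectorRadon d)}

/-- `∫ ∂ₜζ(·,t) dμ`. -/
def timeTerm (μ : SignedRadon d) (ζ : E d × ℝ → ℝ) (t : ℝ) : ℝ :=
  μ.integral fun x => fderiv ℝ ζ (x, t) (0, 1)

/-- `∫ ∇ₓζ(·,t) · dν`. -/
def spaceTerm (ν : VectorRadon d) (ζ : E d × ℝ → ℝ) (t : ℝ) : ℝ :=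
  ∑ i, (ν i).integral fun x => fderiv ℝ ζ (x, t) (EuclideanSpace.single i 1, 0)

lemma timeTerm_eq {ζ : E d × ℝ → ℝ} (hζ : ContDiff ℝ 1 ζ) (μ : SignedRadon d) (t : ℝ) :
    (μ.integral fun x => deriv (fun s => ζ (x, s)) t) = timeTerm μ ζ t := by
  simp only [timeTerm, (deriv_section hζ _ t).deriv]

lemma spaceTerm_eq {ζ : E d × ℝ → ℝ} (hζ : ContDiff ℝ 1 ζ) (ν : VectorRadon d) (t : ℝ) :
    (∑ i, (ν i).integral fun x => fderiv ℝ (fun y => ζ (y, t)) x (EuclideanSpace.single i 1)) =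
      spaceTerm ν ζ t := by
  simp only [spaceTerm, fderiv_section hζ]

lemma equation_iff {T : ℝ} {μ : ℝ → SignedRadon d} {ν : ℝ → VectorRadon d} {ζ : E d × ℝ → ℝ}
    (hζ : ContDiff ℝ 1 ζ) :
    (∫ t in Ioo 0 T, (μ t).integral (fun x => deriv (fun s => ζ (x, s)) t)) +
      (∫ t in Ioo 0 T, ∑ i, (ν t i).integral
        (fun x => fderiv ℝ (fun y => ζ (y, t)) x (EuclideanSpace.single i 1))) = 0 ↔
    (∫ t in Ioo 0 T, timeTerm (μ t) ζ t) + ∫ t in Ioo 0 T, spaceTerm (ν t) ζ t = 0 := by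
  simp only [timeTerm_eq hζ, spaceTerm_eq hζ]

lemma hasCompactSupport_fderiv_apply {ζ : E d × ℝ → ℝ} (hc : HasCompactSupport ζ) (v : E d × ℝ) :
    HasCompactSupport fun q => fderiv ℝ ζ q v :=
  (hc.fderiv (𝕜 := ℝ)).comp_left (g := fun L : E d × ℝ →L[ℝ] ℝ => L v) rfl

lemma fderiv_time_mul {η : ℝ → ℝ} (hη : ContDiff ℝ 1 η) {ζ : E d × ℝ → ℝ} (hζ : ContDiff ℝ 1 ζ)
    (q v : E d × ℝ) : fderiv ℝ (fun q : E d × ℝ => η q.2 * ζ q) q v =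
      deriv η q.2 * v.2 * ζ q + η q.2 * fderiv ℝ ζ q v := by
  have h1 : HasFDerivAt (fun q : E d × ℝ => η q.2)
      ((deriv η q.2) • ContinuousLinearMap.snd ℝ (E d) ℝ) q :=
    (hη.differentiable one_ne_zero q.2).hasDerivAt.comp_hasFDerivAt q hasFDerivAt_snd
  have h2 := (hζ.differentiable one_ne_zero q).hasFDerivAt
  have h3 : HasFDerivAt (fun q : E d × ℝ => η q.2 * ζ q) _ q := h1.mul h2
  rw [h3.fderiv]
  simp
  ring

namespace IsRegularCurve

variable [IsLocallyFiniteMeasure γ]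

lemma integrableOn_timeTerm (hφ : IsActionDensityOn p a b φ) (hp : 1 < p) (hab : a < b)
    (hc : IsRegularCurve φ γ μ₀ μ₁ c) {ζ : E d × ℝ → ℝ} (hζ : ContDiff ℝ 1 ζ)
    (hζc : HasCompactSupport ζ) :
    IntegrableOn (fun t => timeTerm (c.1 t) ζ t) (Ioo 0 1) :=
  ((hc.continuousOn_integral hφ hp hab (continuous_fderiv_apply_const hζ (0, 1))
    (hasCompactSupport_fderiv_apply hζc _)).integrableOn_Icc).mono_set Ioo_subset_Icc_self

lemma integrableOn_spaceTerm (hφ : IsActionDensityOn p a b φ) (hp : 1 < p) (hab : a < b)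
    (hc : IsRegularCurve φ γ μ₀ μ₁ c) {ζ : E d × ℝ → ℝ} (hζ : ContDiff ℝ 1 ζ)
    (hζc : HasCompactSupport ζ) :
    IntegrableOn (fun t => spaceTerm (c.2 t) ζ t) (Ioo 0 1) :=
  integrable_finsetSum _ fun i _ => hc.integrableOn_integral_vector hφ hp hab
    (continuous_fderiv_apply_const hζ _) (hasCompactSupport_fderiv_apply hζc _) i

/-- The continuity equation tested with functions that need not vanish at the end points. -/
lemma integral_add_integral_eq_sub (hφ : IsActionDensityOn p a b φ) (hp : 1 < p) (hab : a < b)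
    (hc : IsRegularCurve φ γ μ₀ μ₁ c) {ζ : E d × ℝ → ℝ} (hζ : ContDiff ℝ 1 ζ)
    (hζc : HasCompactSupport ζ) :
    (∫ t in Ioo (0 : ℝ) 1, timeTerm (c.1 t) ζ t) + ∫ t in Ioo (0 : ℝ) 1, spaceTerm (c.2 t) ζ t =
      (μ₁.integral fun x => ζ (x, 1)) - μ₀.integral fun x => ζ (x, 0) := by
  have hD := hc.integrableOn_timeTerm hφ hp hab hζ hζc
  have hN := hc.integrableOn_spaceTerm hφ hp hab hζ hζc
  have hF := hc.continuousOn_integral hφ hp hab hζ.continuous hζc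
  rw [← integral_add hD hN]
  -- Testing the equation with `η(t) ζ(x,t)` identifies the time and space terms as the weak
  -- derivative of `t ↦ ∫ ζ(·,t) dμₜ`.
  have hmain := sub_eq_integral_of_weak_deriv hF (hD.add hN) fun η hη hηc hηs => by
    have hψ : ContDiff ℝ 1 fun q : E d × ℝ => η q.2 * ζ q := (hη.comp contDiff_snd).mul hζ
    have hψc : HasCompactSupport fun q : E d × ℝ => η q.2 * ζ q := hζc.mul_left
    have hψs : tsupport (fun q : E d × ℝ => η q.2 * ζ q) ⊆ univ ×ˢ Ioo 0 1 := by
      have h1 : tsupport (fun q : E d × ℝ => η q.2 * ζ q) ⊆ Prod.snd ⁻¹' tsupport η :=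
        closure_minimal (fun q hq => subset_tsupport η (left_ne_zero_of_mul hq))
          ((isClosed_tsupport η).preimage continuous_snd)
      exact fun q hq => ⟨mem_univ _, hηs (h1 hq)⟩
    have heq := (equation_iff hψ).1 (hc.mem.1.equation _ hψ hψc hψs)
    have hηd : Continuous (deriv η) := hη.continuous_deriv le_rfl
    have hTt : ∀ t, timeTerm (c.1 t) (fun q : E d × ℝ => η q.2 * ζ q) t =
        deriv η t * ((c.1 t).integral fun x => ζ (x, t)) + η t * timeTerm (c.1 t) ζ t := by
      intro t
      simp only [timeTerm, fderiv_time_mul hη hζ, mul_one]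
      have k1 : Continuous fun x => ζ (x, t) := hζ.continuous.comp (by fun_prop)
      have k2 := hasCompactSupport_section hζc t
      have k3 : Continuous fun x => fderiv ℝ ζ (x, t) (0, 1) :=
        (continuous_fderiv_apply_const hζ (0, 1)).comp (by fun_prop)
      have k4 := hasCompactSupport_section (hasCompactSupport_fderiv_apply hζc (0, 1)) t
      rw [SignedRadon.integral_add (f := fun x => deriv η t * ζ (x, t))
        (g := fun x => η t * fderiv ℝ ζ (x, t) (0, 1)) (continuous_const.mul k1) k2.mul_left
        (continuous_const.mul k3) k4.mul_left, SignedRadon.integral_const_mul,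
        SignedRadon.integral_const_mul]
    have hSt : ∀ t, spaceTerm (c.2 t) (fun q : E d × ℝ => η q.2 * ζ q) t =
        η t * spaceTerm (c.2 t) ζ t := by
      intro t
      simp only [spaceTerm, fderiv_time_mul hη hζ, mul_zero, zero_mul, zero_add,
        SignedRadon.integral_const_mul, Finset.mul_sum]
    simp only [hTt, hSt] at heq
    have hbd : ∀ {u : ℝ → ℝ}, Continuous u → ∀ {f : ℝ → ℝ}, IntegrableOn f (Ioo 0 1) →
        IntegrableOn (fun t => u t * f t) (Ioo 0 1) := by
      intro u hu f hf
      rw [← integrableOn_Icc_iff_integrableOn_Ioo] at hf ⊢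
      exact hf.continuousOn_mul hu.continuousOn isCompact_Icc
    have hFi : IntegrableOn (fun t => (c.1 t).integral fun x => ζ (x, t)) (Ioo 0 1) :=
      hF.integrableOn_Icc.mono_set Ioo_subset_Icc_self
    rw [integral_add (hbd hηd hFi) (hbd hη.continuous hD)] at heq
    simp only [Pi.add_apply, mul_add]
    rw [integral_add (hbd hη.continuous hD) (hbd hη.continuous hN)]
    linarith
  simp only [hc.mem.2.1, hc.mem.2.2.1, Pi.add_apply] at hmain
  exact hmain.symm

end IsRegularCurve

/-- Quantitative weak* continuity of curves of finite energy, for smooth test functions. -/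
lemma exists_enorm_sub_le [IsLocallyFiniteMeasure γ] (hφ : IsActionDensityOn p a b φ) (hp : 1 < p)
    (hab : a < b) {g : E d → ℝ} (hg : ContDiff ℝ 1 g) (hgc : HasCompactSupport g) :
    ∃ C : ℝ≥0∞, C ≠ ⊤ ∧ ∀ l : ℝ, 0 < l → ∀ μ₀ μ₁ : SignedRadon d,
      ∀ c ∈ finiteEnergyCE φ γ 1 μ₀ μ₁, ‖μ₁.integral g - μ₀.integral g‖ₑ ≤
        C * (ENNReal.ofReal l + ENNReal.ofReal (l ^ (1 - p)) * energy φ γ c) := by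
  obtain ⟨κ, hκ, hκφ⟩ := hφ.exists_coercive hp hab
  -- The time cutoff only makes the test function compactly supported. It equals `1` around `[0,1]`,
  -- so the time term vanishes and the boundary values are those of `g`.
  let θ : ContDiffBump (0 : ℝ) := ⟨2, 3, by norm_num, by norm_num⟩
  have hθ1 : ∀ t ∈ Icc (-2 : ℝ) 2, θ t = 1 := fun t ht => θ.one_of_mem_closedBall (by
    rw [Real.closedBall_eq_Icc]; simpa [θ] using ht)
  set ζ : E d × ℝ → ℝ := fun q => g q.1 * θ q.2 with hζdef
  have hζ : ContDiff ℝ 1 ζ := (hg.comp contDiff_fst).mul (θ.contDiff.comp contDiff_snd)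
  have hζc : HasCompactSupport ζ := by
    refine HasCompactSupport.intro (K := tsupport g ×ˢ tsupport θ)
      (hgc.isCompact.prod θ.hasCompactSupport.isCompact) fun q hq => ?_
    by_contra hne
    exact hq ⟨subset_tsupport g (left_ne_zero_of_mul hne),
      subset_tsupport θ (right_ne_zero_of_mul hne)⟩
  have hζt : ∀ x t, t ∈ Icc (-2 : ℝ) 2 → ζ (x, t) = g x := fun x t ht => by
    simp only [hζdef, hθ1 t ht, mul_one]
  have htime : ∀ x, ∀ t ∈ Ioo (0 : ℝ) 1, fderiv ℝ ζ (x, t) (0, 1) = 0 := by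
    intro x t ht
    rw [← (deriv_section hζ x t).deriv]
    have : (fun s => ζ (x, s)) =ᶠ[𝓝 t] fun _ => g x := by
      filter_upwards [Ioo_mem_nhds ht.1 ht.2] with s hs
      exact hζt x s ⟨by linarith [hs.1], by linarith [hs.2]⟩
    rw [this.deriv_eq, deriv_const]
  choose R hR L hL hLR using fun i : Fin d => exists_ball_section
    (continuous_fderiv_apply_const hζ (EuclideanSpace.single i 1, 0))
    (hasCompactSupport_fderiv_apply hζc (EuclideanSpace.single i 1, 0))
  -- The constant depends on `g`, `φ` and `γ`, not on `l` or on the curve.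
  have hC : ∑ i, ENNReal.ofReal (L i) * (γ (Metric.ball 0 (R i)) + ENNReal.ofReal κ⁻¹) ≠ ⊤ :=
    (ENNReal.sum_lt_top.2 fun i _ => ENNReal.mul_lt_top ENNReal.ofReal_lt_top
      (ENNReal.add_lt_top.2 ⟨measure_lt_top_of_isBounded γ Metric.isBounded_ball,
        ENNReal.ofReal_lt_top⟩)).ne
  refine ⟨_, hC, ?_⟩
  intro l hl μ₀ μ₁ c hc
  obtain ⟨c', hc', hen⟩ := exists_isRegularCurve hc
  rw [← hen]
  have hmain := hc'.integral_add_integral_eq_sub hφ hp hab hζ hζc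
  simp only [hζt _ 1 (by norm_num), hζt _ 0 (by norm_num)] at hmain
  have hz : ∫ t in Ioo (0 : ℝ) 1, timeTerm (c'.1 t) ζ t = 0 := by
    rw [setIntegral_congr_fun (g := fun _ => (0 : ℝ)) measurableSet_Ioo fun t ht => by
      simp only [timeTerm, htime _ t ht]
      simp [SignedRadon.integral]]
    simp
  rw [hz, zero_add] at hmain
  change ‖(μ₁.integral fun x => g x) - μ₀.integral fun x => g x‖ₑ ≤ _
  rw [← hmain]
  have hpow : 0 < l ^ (1 - p) := Real.rpow_pos_of_pos hl _
  have hpt : ∀ t, ‖spaceTerm (c'.2 t) ζ t‖ₑ ≤ (∑ i, ENNReal.ofReal (L i) *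
      (γ (Metric.ball 0 (R i)) + ENNReal.ofReal κ⁻¹)) *
      (ENNReal.ofReal l + ENNReal.ofReal (l ^ (1 - p)) * action φ γ (c'.1 t) (c'.2 t)) := by
    intro t
    rw [spaceTerm, Finset.sum_mul]
    refine (enorm_sum_le _ _).trans (Finset.sum_le_sum fun i _ => ?_)
    refine (SignedRadon.enorm_integral_le (fun x => (hLR i x t).1)
      (measurableSet_ball (x := (0 : E d)) (ε := R i)) fun x hx => (hLR i x t).2 hx).trans ?_
    rw [mul_assoc]
    gcongr
    refine (variation_le_action (γ := γ) hφ hp hab hκ hκφ (c'.1 t) (c'.2 t) i hl measurableSet_ball).trans ?_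
    rw [div_eq_mul_inv, ENNReal.ofReal_mul hpow.le]
    ring_nf
    rw [add_assoc, add_assoc]
    refine add_le_add le_rfl ?_
    rw [← add_assoc]
    exact le_add_self
  refine (enorm_integral_le_lintegral_enorm _).trans ((lintegral_mono hpt).trans ?_)
  rw [lintegral_const_mul' _ _ hC]
  gcongr
  rw [lintegral_add_left measurable_const, lintegral_const_mul' _ _ ENNReal.ofReal_ne_top]
  simp [energy]

end ContinuityEquation

/-! ### Affine changes of time. -/

section Affine

lemma measurableEmbedding_affine {α : ℝ} (hα : α ≠ 0) (β : ℝ) :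
    MeasurableEmbedding fun s : ℝ => α * s + β :=
  ((Homeomorph.mulLeft₀ α hα).trans (Homeomorph.addRight β)).measurableEmbedding

lemma map_volume_affine {α : ℝ} (hα : α ≠ 0) (β : ℝ) :
    (volume : Measure ℝ).map (fun s : ℝ => α * s + β) = ENNReal.ofReal |α⁻¹| • volume := by
  have : (fun s : ℝ => α * s + β) = (fun s => s + β) ∘ fun s => α * s := rfl
  rw [this, ← Measure.map_map (measurable_add_const β) (measurable_const_mul α),
    Real.map_volume_mul_left hα, Measure.map_smul, map_add_right_eq_self]

lemma setLIntegral_affine {α : ℝ} (hα : α ≠ 0) (β : ℝ) (f : ℝ → ℝ≥0∞) (S : Set ℝ) :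
    ∫⁻ s in (fun s => α * s + β) ⁻¹' S, f (α * s + β) = ENNReal.ofReal |α⁻¹| * ∫⁻ t in S, f t := by
  have he := measurableEmbedding_affine hα β
  rw [← smul_eq_mul, ← lintegral_smul_measure, ← Measure.restrict_smul, ← map_volume_affine hα β,
    he.restrict_map, he.lintegral_map]

lemma setIntegral_affine {α : ℝ} (hα : α ≠ 0) (β : ℝ) (f : ℝ → ℝ) (S : Set ℝ) :
    ∫ s in (fun s => α * s + β) ⁻¹' S, f (α * s + β) = |α⁻¹| * ∫ t in S, f t := by
  have he := measurableEmbedding_affine hα β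
  have h := integral_smul_measure (μ := volume.restrict S) f (ENNReal.ofReal |α⁻¹|)
  rw [ENNReal.toReal_ofReal (abs_nonneg _), smul_eq_mul] at h
  rw [← h, ← Measure.restrict_smul, ← map_volume_affine hα β, he.restrict_map, he.integral_map]

lemma integrableOn_affine {α : ℝ} (hα : α ≠ 0) (β : ℝ) {f : ℝ → ℝ} {S : Set ℝ}
    (h : IntegrableOn f S) :
    IntegrableOn (fun s => f (α * s + β)) ((fun s => α * s + β) ⁻¹' S) := by
  have he := measurableEmbedding_affine hα β
  have h1 : IntegrableOn f S (volume.map fun s : ℝ => α * s + β) := by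
    rw [map_volume_affine hα β, IntegrableOn, Measure.restrict_smul]
    exact h.smul_measure ENNReal.ofReal_ne_top
  exact he.integrableOn_map_iff.1 h1

lemma restrict_Ioo_eq_add {θ : ℝ} (h0 : 0 < θ) (h1 : θ < 1) :
    (volume : Measure ℝ).restrict (Ioo 0 1) =
      volume.restrict (Ioo 0 θ) + volume.restrict (Ioo θ 1) := by
  rw [← Measure.restrict_union (by
    rw [Set.disjoint_left]; exact fun x hx hx' => lt_asymm hx.2 hx'.1) measurableSet_Ioo]
  refine Measure.restrict_congr_set ?_
  have hne : ∀ᵐ x : ℝ, x ≠ θ := by simp [ae_iff]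
  filter_upwards [hne] with x hx
  refine propext ⟨fun h => ?_, fun h => ?_⟩
  · rcases lt_or_gt_of_ne hx with h' | h'
    · exact Or.inl ⟨h.1, h'⟩
    · exact Or.inr ⟨h', h.2⟩
  · rcases h with h | h
    · exact ⟨h.1, h.2.trans h1⟩
    · exact ⟨h0.trans h.1, h.2⟩

variable {d : ℕ}

lemma hasFDerivAt_comp_affine {ζ : E d × ℝ → ℝ} (hζ : ContDiff ℝ 1 ζ) (α β : ℝ) (q v : E d × ℝ) :
    fderiv ℝ (fun q : E d × ℝ => ζ (q.1, α * q.2 + β)) q v =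
      fderiv ℝ ζ (q.1, α * q.2 + β) (v.1, α * v.2) := by
  have h1 : HasFDerivAt (fun q : E d × ℝ => (q.1, α * q.2 + β))
      ((ContinuousLinearMap.fst ℝ (E d) ℝ).prod (α • ContinuousLinearMap.snd ℝ (E d) ℝ)) q :=
    hasFDerivAt_fst.prodMk ((hasFDerivAt_snd.const_mul α).add_const β)
  have h2 : HasFDerivAt (fun q : E d × ℝ => ζ (q.1, α * q.2 + β)) _ q :=
    HasFDerivAt.comp q (hζ.differentiable one_ne_zero _).hasFDerivAt h1
  rw [h2.fderiv]
  rfl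

lemma timeTerm_comp_affine {ζ : E d × ℝ → ℝ} (hζ : ContDiff ℝ 1 ζ) (α β : ℝ) (μ : SignedRadon d)
    (t : ℝ) : timeTerm μ (fun q => ζ (q.1, α * q.2 + β)) t = α * timeTerm μ ζ (α * t + β) := by
  rw [timeTerm, timeTerm, ← SignedRadon.integral_const_mul]
  congr 1
  ext x
  rw [hasFDerivAt_comp_affine hζ]
  have : ((0, α * 1) : E d × ℝ) = α • (0, 1) := by simp
  rw [this, map_smul, smul_eq_mul]

lemma spaceTerm_comp_affine {ζ : E d × ℝ → ℝ} (hζ : ContDiff ℝ 1 ζ) (α β : ℝ) (ν : VectorRadon d)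
    (t : ℝ) : spaceTerm ν (fun q => ζ (q.1, α * q.2 + β)) t = spaceTerm ν ζ (α * t + β) := by
  simp only [spaceTerm, hasFDerivAt_comp_affine hζ, mul_zero]

lemma spaceTerm_scale (r : ℝ) (ν : VectorRadon d) (ζ : E d × ℝ → ℝ) (t : ℝ) :
    spaceTerm (fun i => (ν i).scale r) ζ t = r * spaceTerm ν ζ t := by
  simp only [spaceTerm, SignedRadon.integral_scale, Finset.mul_sum]

lemma contDiff_comp_affine {ζ : E d × ℝ → ℝ} (hζ : ContDiff ℝ 1 ζ) (α β : ℝ) :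
    ContDiff ℝ 1 fun q : E d × ℝ => ζ (q.1, α * q.2 + β) :=
  hζ.comp (contDiff_fst.prodMk ((contDiff_const.mul contDiff_snd).add contDiff_const))

lemma hasCompactSupport_comp_affine {ζ : E d × ℝ → ℝ} (hζ : HasCompactSupport ζ) {α : ℝ}
    (hα : α ≠ 0) (β : ℝ) : HasCompactSupport fun q : E d × ℝ => ζ (q.1, α * q.2 + β) :=
  hζ.comp_homeomorph ((Homeomorph.refl (E d)).prodCongr
    ((Homeomorph.mulLeft₀ α hα).trans (Homeomorph.addRight β)))

end Affine

/-! ### Comparison of `W` with the weak* topology. -/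

section Distance

variable {d : ℕ} {p a b : ℝ} {φ : ℝ × E d → ℝ≥0∞} {γ : Measure (E d)} {μ₀ μ₁ μ₂ : SignedRadon d}

lemma W_lt_iff {r : ℝ≥0∞} :
    W p φ γ μ₀ μ₁ < r ↔ ∃ c ∈ finiteEnergyCE φ γ 1 μ₀ μ₁, energy φ γ c ^ (1 / p) < r := by
  simp only [W, iInf_lt_iff, exists_prop]
  rfl

lemma W_le {c : (ℝ → SignedRadon d) × (ℝ → VectorRadon d)}
    (hc : c ∈ finiteEnergyCE φ γ 1 μ₀ μ₁) : W p φ γ μ₀ μ₁ ≤ energy φ γ c ^ (1 / p) :=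
  iInf₂_le c hc

lemma energy_le_of_rpow_lt (hp : 1 < p) {x : ℝ≥0∞} {l : ℝ} (hl : 0 < l)
    (h : x ^ (1 / p) < ENNReal.ofReal l) : x ≤ ENNReal.ofReal (l ^ p) := by
  have hp0 : 0 < p := by linarith
  rw [← ENNReal.ofReal_rpow_of_pos hl, ← ENNReal.rpow_one x, ← one_div_mul_cancel hp0.ne',
    ENNReal.rpow_mul]
  exact ENNReal.rpow_le_rpow h.le hp0.le

variable [IsLocallyFiniteMeasure γ]

lemma between_of_W_ne_top (hφ : IsActionDensityOn p a b φ) (hp : 1 < p) (hab : a < b)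
    (h : W p φ γ μ₀ μ₁ ≠ ⊤) : μ₀.Between a b γ ∧ μ₁.Between a b γ := by
  obtain ⟨c, hc, -⟩ := W_lt_iff.1 (lt_top_iff_ne_top.2 h)
  obtain ⟨c', hc', -⟩ := exists_isRegularCurve hc
  have h0 := hc'.between hφ hp hab (left_mem_Icc.2 zero_le_one)
  have h1 := hc'.between hφ hp hab (right_mem_Icc.2 zero_le_one)
  rw [hc'.mem.2.1] at h0
  rw [hc'.mem.2.2.1] at h1
  exact ⟨h0, h1⟩

/-- Taking the radius of the `W`-ball equal to `l` gives energy at most `l^p`, so both terms of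
`exists_enorm_sub_le` are at most `C l`; `l` is chosen with `2 C l ≤ ε`. -/
lemma exists_W_lt_smooth (hφ : IsActionDensityOn p a b φ) (hp : 1 < p) (hab : a < b) {g : E d → ℝ}
    (hg : ContDiff ℝ 1 g) (hgc : HasCompactSupport g) {ε : ℝ} (hε : 0 < ε) :
    ∃ r : ℝ≥0∞, 0 < r ∧ ∀ μ₀ μ₁ : SignedRadon d, W p φ γ μ₀ μ₁ < r →
      |μ₁.integral g - μ₀.integral g| ≤ ε := by
  obtain ⟨C, hC, hb⟩ := exists_enorm_sub_le (γ := γ) hφ hp hab hg hgc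
  set l : ℝ := ε / (2 * (C.toReal + 1)) with hl
  have hC0 : 0 ≤ C.toReal := ENNReal.toReal_nonneg
  have hl0 : 0 < l := by positivity
  refine ⟨ENNReal.ofReal l, by simpa using hl0, fun μ₀ μ₁ h => ?_⟩
  obtain ⟨c, hc, hcl⟩ := W_lt_iff.1 h
  have h1 := hb l hl0 μ₀ μ₁ c hc
  have h2 := energy_le_of_rpow_lt hp hl0 hcl
  have hpow : 0 < l ^ (1 - p) := Real.rpow_pos_of_pos hl0 _
  have h3 : ‖μ₁.integral g - μ₀.integral g‖ₑ ≤ ENNReal.ofReal ε := by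
    refine h1.trans ?_
    calc C * (ENNReal.ofReal l + ENNReal.ofReal (l ^ (1 - p)) * energy φ γ c)
        ≤ C * (ENNReal.ofReal l + ENNReal.ofReal (l ^ (1 - p)) * ENNReal.ofReal (l ^ p)) := by
          gcongr
      _ = ENNReal.ofReal (C.toReal * (l + l)) := by
          rw [← ENNReal.ofReal_mul hpow.le, ← Real.rpow_add hl0, sub_add_cancel, Real.rpow_one,
            ← ENNReal.ofReal_add hl0.le hl0.le, ENNReal.ofReal_mul hC0, ENNReal.ofReal_toReal hC]
      _ ≤ ENNReal.ofReal ε := by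
          refine ENNReal.ofReal_le_ofReal ?_
          have : 2 * (C.toReal + 1) * l = ε := by
            rw [hl]
            field_simp
          nlinarith
  rwa [Real.enorm_eq_ofReal_abs, ENNReal.ofReal_le_ofReal_iff hε.le] at h3

/-- Integrals of test functions are uniformly continuous for the distance `W`. -/
lemma exists_W_lt (hφ : IsActionDensityOn p a b φ) (hp : 1 < p) (hab : a < b)
    (ζ : CompactlySupportedContinuousMap (E d) ℝ) {ε : ℝ} (hε : 0 < ε) :
    ∃ r : ℝ≥0∞, 0 < r ∧ ∀ μ₀ μ₁ : SignedRadon d, W p φ γ μ₀ μ₁ < r →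
      |μ₁.integral ζ - μ₀.integral ζ| < ε := by
  obtain ⟨χ₀, hχ1, -, hχc, hχ⟩ := exists_continuous_one_zero_of_isCompact
    ζ.hasCompactSupport.isCompact isClosed_empty (disjoint_empty _)
  let χ : CompactlySupportedContinuousMap (E d) ℝ := ⟨χ₀, hχc⟩
  set C := max |a| |b| * ∫ x, χ x ∂γ with hC
  have hC0 : 0 ≤ C := mul_nonneg (le_max_of_le_left (abs_nonneg _))
    (integral_nonneg fun x => (hχ x).1)
  set δ := ε / (4 * (C + 1)) with hδ
  have hδ0 : 0 < δ := by positivity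
  -- The smooth approximation vanishes wherever `ζ` does, so one cutoff `χ` controls the error. With
  -- `δ = ε / (4 (C + 1))` that error is at most `ε / 4` for each of the two measures.
  obtain ⟨g, hg, hgd, hgs⟩ := (map_continuous ζ).exists_contDiff_approx 1
    (ε := fun _ => δ) continuous_const fun _ => hδ0
  have hgz : ∀ x, x ∉ tsupport ζ → g x = 0 ∧ ζ x = 0 := fun x hx => by
    have h2 : ζ x = 0 := image_eq_zero_of_notMem_tsupport hx
    refine ⟨?_, h2⟩
    by_contra hne
    exact hgs hne h2
  have hgc : HasCompactSupport g :=
    HasCompactSupport.intro ζ.hasCompactSupport.isCompact fun x hx => (hgz x hx).1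
  obtain ⟨r, hr, hrb⟩ := exists_W_lt_smooth (γ := γ) hφ hp hab (hg.of_le (by norm_num)) hgc
    (half_pos (half_pos hε))
  refine ⟨r, hr, fun μ₀ μ₁ h => ?_⟩
  have happ : ∀ μ : SignedRadon d, μ.Between a b γ → |μ.integral g - μ.integral ζ| ≤ ε / 4 := by
    intro μ hμ
    rw [← SignedRadon.integral_sub hg.continuous hgc (map_continuous ζ) ζ.hasCompactSupport]
    refine (hμ.abs_integral_le hab.le (hg.continuous.sub (map_continuous ζ))
      (hgc.sub ζ.hasCompactSupport) (ε := δ) (χ := χ) fun x => ?_).trans ?_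
    · by_cases hx : x ∈ tsupport ζ
      · have : χ x = 1 := hχ1 hx
        rw [this, mul_one]
        exact (hgd x).le
      · simp only [Pi.sub_apply, (hgz x hx).1, (hgz x hx).2, sub_self, abs_zero]
        exact mul_nonneg hδ0.le (hχ x).1
    · rw [mul_left_comm, ← hC]
      have : 4 * (C + 1) * δ = ε := by
        rw [hδ]
        field_simp
      nlinarith
  have hne : W p φ γ μ₀ μ₁ ≠ ⊤ := h.ne_top
  obtain ⟨hb0, hb1⟩ := between_of_W_ne_top hφ hp hab hne
  have e0 := abs_le.1 (happ μ₀ hb0)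
  have e1 := abs_le.1 (happ μ₁ hb1)
  have e2 := abs_le.1 (hrb μ₀ μ₁ h)
  rw [abs_lt]
  constructor <;> linarith [e0.1, e0.2, e1.1, e1.2, e2.1, e2.2]

lemma eq_of_W_eq_zero (hφ : IsActionDensityOn p a b φ) (hp : 1 < p) (hab : a < b)
    (h : W p φ γ μ₀ μ₁ = 0) : μ₀ = μ₁ := by
  refine SignedRadon.ext_of_integral_eq fun ζ => ?_
  by_contra hne
  have hpos : 0 < |μ₁.integral ζ - μ₀.integral ζ| := abs_pos.2 (sub_ne_zero.2 (Ne.symm hne))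
  obtain ⟨r, hr, hb⟩ := exists_W_lt (γ := γ) hφ hp hab ζ hpos
  exact lt_irrefl _ (hb μ₀ μ₁ (h ▸ hr))

lemma topologyW_le_weakStar (hφ : IsActionDensityOn p a b φ) (hp : 1 < p) (hab : a < b) :
    topologyW p φ γ ≤ SignedRadon.weakStar := by
  rw [SignedRadon.weakStar, ← continuous_iff_le_induced]
  refine @continuous_pi _ _ _ (topologyW p φ γ) _ _ fun ζ => ?_
  refine continuous_def.2 fun V hV => ?_
  change ∀ μ ∈ _, _
  intro μ hμ
  obtain ⟨ε, hε, hball⟩ := Metric.isOpen_iff.1 hV _ hμ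
  obtain ⟨r, hr, hb⟩ := exists_W_lt (γ := γ) hφ hp hab ζ hε
  refine ⟨r, hr, fun ν hν => hball ?_⟩
  rw [Metric.mem_ball, Real.dist_eq]
  exact hb μ ν hν

/-- Every measure at finite distance from `σ` lies in a compact closed set that depends on neither
`σ` nor `R`. -/
lemma isCompact_closure_of_boundedW (hφ : IsActionDensityOn p a b φ) (hp : 1 < p) (hab : a < b)
    {B : Set (SignedRadon d)} (hB : BoundedW p φ γ B) : IsCompact (closure B) := by
  obtain ⟨σ, R, hR, hBR⟩ := hB
  refine (SignedRadon.isCompact_between (γ := γ) hab.le).of_isClosed_subset isClosed_closure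
    (closure_minimal (fun μ hμ => ?_) (SignedRadon.isClosed_between hab.le))
  exact (between_of_W_ne_top hφ hp hab ((hBR μ hμ).trans_lt hR).ne).2

end Distance

/-! ### Symmetry, triangle inequality and the diagonal. -/

section Distance

variable {d : ℕ} {p a b : ℝ} {φ : ℝ × E d → ℝ≥0∞} {γ : Measure (E d)} {μ₀ μ₁ μ₂ : SignedRadon d}
  [IsLocallyFiniteMeasure γ]

/-- Time reversal of a curve of finite energy. -/
lemma exists_reverse (hφ : IsActionDensityOn p a b φ) (hp : 1 < p) (hab : a < b)
    {c : (ℝ → SignedRadon d) × (ℝ → VectorRadon d)} (hc : c ∈ finiteEnergyCE φ γ 1 μ₀ μ₁) :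
    ∃ c' ∈ finiteEnergyCE φ γ 1 μ₁ μ₀, energy φ γ c' = energy φ γ c := by
  obtain ⟨c₁, h₁, hen⟩ := exists_isRegularCurve hc
  rw [← hen]
  have hne : (-1 : ℝ) ≠ 0 := by norm_num
  have hpre : (fun s : ℝ => -1 * s + 1) ⁻¹' Ioo 0 1 = Ioo 0 1 := by
    ext s
    simp only [mem_preimage, mem_Ioo]
    constructor <;> rintro ⟨h, h'⟩ <;> constructor <;> linarith
  have hL : ∀ f : ℝ → ℝ≥0∞, ∫⁻ s in Ioo (0 : ℝ) 1, f (-1 * s + 1) = ∫⁻ t in Ioo (0 : ℝ) 1, f t := by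
    intro f
    have := setLIntegral_affine hne 1 f (Ioo 0 1)
    rw [hpre] at this
    simpa using this
  have hI : ∀ f : ℝ → ℝ, ∫ s in Ioo (0 : ℝ) 1, f (-1 * s + 1) = ∫ t in Ioo (0 : ℝ) 1, f t := by
    intro f
    have := setIntegral_affine hne 1 f (Ioo 0 1)
    rw [hpre] at this
    simpa using this
  -- Reversing time changes the sign of `∂ₜμ`, hence of the flux; the action is even in the flux.
  set c' : (ℝ → SignedRadon d) × (ℝ → VectorRadon d) :=
    (fun s => c₁.1 (-1 * s + 1), fun s i => (c₁.2 (-1 * s + 1) i).scale (-1)) with hc'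
  have hE : energy φ γ c' = energy φ γ c₁ := by
    simp only [energy, hc', action_scale hφ hp hab hne, abs_neg, abs_one, Real.one_rpow,
      ENNReal.ofReal_one, one_mul]
    exact hL fun t => action φ γ (c₁.1 t) (c₁.2 t)
  refine ⟨c', ⟨⟨?_, fun i A hA hb => ?_, fun R hR => ?_, fun R hR i => ?_, fun ζ hζ hζc hζs => ?_⟩,
    ?_, ?_, ?_⟩, hE⟩
  · exact (h₁.continuous.comp (by fun_prop)).continuousOn
  · have h1 : Measurable fun s : ℝ => ((c₁.2 (-1 * s + 1) i).scale (-1)).val A :=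
      ((h₁.borel i).scale (-1) A hA hb).comp (by fun_prop : Measurable fun s : ℝ => -1 * s + 1)
    exact h1.comp measurable_subtype_coe
  · rw [hL fun t => (c₁.1 t).variation (Metric.ball 0 R)]
    exact h₁.mem.1.finite_left R hR
  · simp only [hc', SignedRadon.variation_scale, abs_neg, abs_one, Real.toNNReal_one, one_smul]
    rw [hL fun t => (c₁.2 t i).variation (Metric.ball 0 R)]
    exact h₁.mem.1.finite_right R hR i
  · rw [equation_iff hζ]
    have hs : tsupport (fun q : E d × ℝ => ζ (q.1, -1 * q.2 + 1)) ⊆ univ ×ˢ Ioo 0 1 := by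
      have h1 : tsupport (fun q : E d × ℝ => ζ (q.1, -1 * q.2 + 1)) ⊆
          (fun q : E d × ℝ => (q.1, -1 * q.2 + 1)) ⁻¹' tsupport ζ :=
        closure_minimal (fun q hq => subset_tsupport ζ hq)
          ((isClosed_tsupport ζ).preimage (by fun_prop))
      intro q hq
      have h2 := (hζs (h1 hq)).2
      exact ⟨mem_univ _, by linarith [h2.2], by linarith [h2.1]⟩
    have heq := (equation_iff (contDiff_comp_affine hζ (-1) 1)).1 (h₁.mem.1.equation _
      (contDiff_comp_affine hζ (-1) 1) (hasCompactSupport_comp_affine hζc hne 1) hs)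
    simp only [timeTerm_comp_affine hζ, spaceTerm_comp_affine hζ, integral_const_mul] at heq
    have e1 := hI fun t => timeTerm (c₁.1 t) ζ (-1 * t + 1)
    have e2 := hI fun t => spaceTerm (c₁.2 t) ζ (-1 * t + 1)
    have e3 : ∀ s : ℝ, -1 * (-1 * s + 1) + 1 = s := fun s => by ring
    simp only [e3] at e1 e2
    simp only [hc', spaceTerm_scale, integral_const_mul]
    rw [e1, e2]
    linarith
  · simp only [hc', mul_zero, zero_add]
    exact h₁.mem.2.2.1
  · simp only [hc', mul_one, neg_add_cancel]
    exact h₁.mem.2.1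
  · exact hE.trans_lt h₁.mem.2.2.2

lemma W_symm (hφ : IsActionDensityOn p a b φ) (hp : 1 < p) (hab : a < b)
    (μ₀ μ₁ : SignedRadon d) : W p φ γ μ₀ μ₁ = W p φ γ μ₁ μ₀ := by
  have key : ∀ μ₀ μ₁ : SignedRadon d, W p φ γ μ₀ μ₁ ≤ W p φ γ μ₁ μ₀ := fun μ₀ μ₁ => by
    refine le_iInf₂ fun c hc => ?_
    obtain ⟨c', hc', hE⟩ := exists_reverse hφ hp hab hc
    exact (W_le hc').trans_eq (by rw [hE]; rfl)
  exact le_antisymm (key _ _) (key _ _)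

/-- The contribution of a rescaled curve to the continuity equation. -/
lemma IsRegularCurve.rescaled_equation (hφ : IsActionDensityOn p a b φ) (hp : 1 < p) (hab : a < b)
    {c : (ℝ → SignedRadon d) × (ℝ → VectorRadon d)} (hc : IsRegularCurve φ γ μ₀ μ₁ c) {α : ℝ}
    (hα : 0 < α) (β : ℝ) {ζ : E d × ℝ → ℝ} (hζ : ContDiff ℝ 1 ζ) (hζc : HasCompactSupport ζ) :
    IntegrableOn (fun s => timeTerm (c.1 (α * s + β)) ζ s) ((fun s => α * s + β) ⁻¹' Ioo 0 1) ∧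
    IntegrableOn (fun s => spaceTerm (fun i => (c.2 (α * s + β) i).scale α) ζ s)
      ((fun s => α * s + β) ⁻¹' Ioo 0 1) ∧
    (∫ s in (fun s => α * s + β) ⁻¹' Ioo 0 1, timeTerm (c.1 (α * s + β)) ζ s) +
      (∫ s in (fun s => α * s + β) ⁻¹' Ioo 0 1,
        spaceTerm (fun i => (c.2 (α * s + β) i).scale α) ζ s) =
      (μ₁.integral fun x => ζ (x, α⁻¹ * (1 - β))) - μ₀.integral fun x => ζ (x, α⁻¹ * (0 - β)) := by
  -- The test function expressed in the curve's own time, so the equation on `[0,1]` up to the end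
  -- points applies.
  set ξ : E d × ℝ → ℝ := fun q => ζ (q.1, α⁻¹ * q.2 + -(α⁻¹ * β)) with hξ
  have hξ1 : ContDiff ℝ 1 ξ := contDiff_comp_affine hζ _ _
  have hξc : HasCompactSupport ξ := hasCompactSupport_comp_affine hζc (inv_ne_zero hα.ne') _
  have hback : ∀ s : ℝ, α⁻¹ * (α * s + β) + -(α⁻¹ * β) = s := fun s => by
    field_simp
    ring
  have hT : ∀ s, timeTerm (c.1 (α * s + β)) ζ s = α * timeTerm (c.1 (α * s + β)) ξ (α * s + β) := by
    intro s
    rw [hξ, timeTerm_comp_affine hζ, hback, ← mul_assoc, mul_inv_cancel₀ hα.ne', one_mul]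
  have hS : ∀ s, spaceTerm (fun i => (c.2 (α * s + β) i).scale α) ζ s =
      α * spaceTerm (c.2 (α * s + β)) ξ (α * s + β) := by
    intro s
    rw [spaceTerm_scale, hξ, spaceTerm_comp_affine hζ, hback]
  have hmain := hc.integral_add_integral_eq_sub hφ hp hab hξ1 hξc
  have i1 := integrableOn_affine hα.ne' β (hc.integrableOn_timeTerm hφ hp hab hξ1 hξc)
  have i2 := integrableOn_affine hα.ne' β (hc.integrableOn_spaceTerm hφ hp hab hξ1 hξc)
  have e1 := setIntegral_affine hα.ne' β (fun t => timeTerm (c.1 t) ξ t) (Ioo 0 1)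
  have e2 := setIntegral_affine hα.ne' β (fun t => spaceTerm (c.2 t) ξ t) (Ioo 0 1)
  simp only [hT, hS, integral_const_mul]
  refine ⟨i1.const_mul α, i2.const_mul α, ?_⟩
  rw [e1, e2, abs_of_pos (inv_pos.2 hα), ← mul_assoc, ← mul_assoc, mul_inv_cancel₀ hα.ne', one_mul,
    one_mul, hmain]
  have t1 : α⁻¹ * 1 + -(α⁻¹ * β) = α⁻¹ * (1 - β) := by ring
  have t0 : α⁻¹ * 0 + -(α⁻¹ * β) = α⁻¹ * (0 - β) := by ring
  simp only [hξ, t1, t0]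

/-- Concatenation of two curves, run through during the time intervals `(0,θ)` and `(θ,1)`. -/
lemma exists_concat (hφ : IsActionDensityOn p a b φ) (hp : 1 < p) (hab : a < b)
    {c₁ c₂ : (ℝ → SignedRadon d) × (ℝ → VectorRadon d)} (h₁ : IsRegularCurve φ γ μ₀ μ₁ c₁)
    (h₂ : IsRegularCurve φ γ μ₁ μ₂ c₂) {θ : ℝ} (h0 : 0 < θ) (h1 : θ < 1) :
    ∃ c ∈ finiteEnergyCE φ γ 1 μ₀ μ₂, energy φ γ c =
      ENNReal.ofReal θ * (ENNReal.ofReal (θ⁻¹ ^ p) * energy φ γ c₁) +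
      ENNReal.ofReal (1 - θ) * (ENNReal.ofReal ((1 - θ)⁻¹ ^ p) * energy φ γ c₂) := by
  classical
  have hθ' : 0 < 1 - θ := by linarith
  set α := θ⁻¹ with hα
  set α' := (1 - θ)⁻¹ with hα'
  set β := -(θ * α') with hβ
  have hα0 : 0 < α := inv_pos.2 h0
  have hα0' : 0 < α' := inv_pos.2 hθ'
  have hαinv : α⁻¹ = θ := inv_inv θ
  have hαinv' : α'⁻¹ = 1 - θ := inv_inv _
  have hpre : (fun s : ℝ => α * s + 0) ⁻¹' Ioo 0 1 = Ioo 0 θ := by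
    ext s
    simp only [mem_preimage, mem_Ioo, add_zero, hα]
    rw [mul_pos_iff_of_pos_left hα0, inv_mul_lt_iff₀ h0, mul_one]
  have hpre' : (fun s : ℝ => α' * s + β) ⁻¹' Ioo 0 1 = Ioo θ 1 := by
    ext s
    have : α' * s + β = (1 - θ)⁻¹ * (s - θ) := by rw [hβ, hα']; ring
    simp only [mem_preimage, mem_Ioo, this]
    rw [mul_pos_iff_of_pos_left hα0', inv_mul_lt_iff₀ hθ', mul_one, sub_pos, sub_lt_sub_iff_right]
  -- The flux is multiplied by the speed of the time change. Both pieces equal `μ₁` at time `θ`, so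
  -- the measures join continuously.
  set c : (ℝ → SignedRadon d) × (ℝ → VectorRadon d) :=
    (fun s => if s ≤ θ then c₁.1 (α * s + 0) else c₂.1 (α' * s + β),
      fun s => if s ≤ θ then (fun i => (c₁.2 (α * s + 0) i).scale α)
        else fun i => (c₂.2 (α' * s + β) i).scale α') with hc
  have hcl : ∀ s ∈ Ioo 0 θ, c.1 s = c₁.1 (α * s + 0) ∧
      c.2 s = fun i => (c₁.2 (α * s + 0) i).scale α := fun s hs => by
    simp only [hc, if_pos hs.2.le, and_self]
  have hcr : ∀ s ∈ Ioo θ 1, c.1 s = c₂.1 (α' * s + β) ∧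
      c.2 s = fun i => (c₂.2 (α' * s + β) i).scale α' := fun s hs => by
    simp only [hc, if_neg (not_le.2 hs.1), and_self]
  -- Stated for general `f` so that the energy and both local mass bounds use the same change of
  -- variables.
  have hL : ∀ (f : SignedRadon d → VectorRadon d → ℝ≥0∞),
      ∫⁻ s in Ioo (0 : ℝ) 1, f (c.1 s) (c.2 s) =
        ENNReal.ofReal θ * (∫⁻ t in Ioo (0 : ℝ) 1, f (c₁.1 t) fun i => (c₁.2 t i).scale α) +
        ENNReal.ofReal (1 - θ) * (∫⁻ t in Ioo (0 : ℝ) 1, f (c₂.1 t) fun i => (c₂.2 t i).scale α') := by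
    intro f
    have hsplit : ∫⁻ s in Ioo (0 : ℝ) 1, f (c.1 s) (c.2 s) =
        (∫⁻ s in Ioo 0 θ, f (c.1 s) (c.2 s)) + ∫⁻ s in Ioo θ 1, f (c.1 s) (c.2 s) := by
      rw [restrict_Ioo_eq_add h0 h1, lintegral_add_measure]
    rw [hsplit]
    congr 1
    · rw [setLIntegral_congr_fun measurableSet_Ioo fun s hs => by
        rw [(hcl s hs).1, (hcl s hs).2]]
      have := setLIntegral_affine hα0.ne' 0
        (fun t => f (c₁.1 t) fun i => (c₁.2 t i).scale α) (Ioo 0 1)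
      rwa [hpre, hαinv, abs_of_pos h0] at this
    · rw [setLIntegral_congr_fun measurableSet_Ioo fun s hs => by
        rw [(hcr s hs).1, (hcr s hs).2]]
      have := setLIntegral_affine hα0'.ne' β
        (fun t => f (c₂.1 t) fun i => (c₂.2 t i).scale α') (Ioo 0 1)
      rwa [hpre', hαinv', abs_of_pos hθ'] at this
  have hE : energy φ γ c = ENNReal.ofReal θ * (ENNReal.ofReal (α ^ p) * energy φ γ c₁) +
      ENNReal.ofReal (1 - θ) * (ENNReal.ofReal (α' ^ p) * energy φ γ c₂) := by
    rw [energy, hL (action φ γ)]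
    simp only [action_scale hφ hp hab hα0.ne', action_scale hφ hp hab hα0'.ne', abs_of_pos hα0,
      abs_of_pos hα0']
    rw [lintegral_const_mul' _ _ ENNReal.ofReal_ne_top,
      lintegral_const_mul' _ _ ENNReal.ofReal_ne_top]
    rfl
  refine ⟨c, ⟨⟨?_, fun i A hA hb => ?_, fun R hR => ?_, fun R hR i => ?_, fun ζ hζ hζc hζs => ?_⟩,
    ?_, ?_, ?_⟩, hE⟩
  · refine Continuous.continuousOn (Continuous.if_le (h₁.continuous.comp (by fun_prop))
      (h₂.continuous.comp (by fun_prop)) continuous_id continuous_const fun s hs => ?_)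
    obtain rfl : s = θ := hs
    have e1 : α * s + 0 = 1 := by rw [add_zero, hα, inv_mul_cancel₀ h0.ne']
    have e2 : α' * s + β = 0 := by rw [hβ]; ring
    simp only [e1, e2, h₁.mem.2.2.1, h₂.mem.2.1]
  · have h3 : Measurable fun s : ℝ => (c.2 s i).val A := by
      have : (fun s : ℝ => (c.2 s i).val A) = fun s => if s ≤ θ then
          ((c₁.2 (α * s + 0) i).scale α).val A else ((c₂.2 (α' * s + β) i).scale α').val A := by
        ext s
        simp only [hc]
        split_ifs <;> rfl
      rw [this]
      exact Measurable.ite measurableSet_Iic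
        (((h₁.borel i).scale α A hA hb).comp (by fun_prop : Measurable fun s : ℝ => α * s + 0))
        (((h₂.borel i).scale α' A hA hb).comp (by fun_prop : Measurable fun s : ℝ => α' * s + β))
    exact h3.comp measurable_subtype_coe
  · rw [hL fun μ _ => μ.variation (Metric.ball 0 R)]
    exact ENNReal.add_lt_top.2 ⟨ENNReal.mul_lt_top ENNReal.ofReal_lt_top
      (h₁.mem.1.finite_left R hR), ENNReal.mul_lt_top ENNReal.ofReal_lt_top
      (h₂.mem.1.finite_left R hR)⟩
  · rw [hL fun _ ν => (ν i).variation (Metric.ball 0 R)]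
    simp only [SignedRadon.variation_scale, Measure.smul_apply, ENNReal.smul_def, smul_eq_mul]
    rw [lintegral_const_mul' _ _ ENNReal.coe_ne_top, lintegral_const_mul' _ _ ENNReal.coe_ne_top]
    exact ENNReal.add_lt_top.2 ⟨ENNReal.mul_lt_top ENNReal.ofReal_lt_top
      (ENNReal.mul_lt_top ENNReal.coe_lt_top (h₁.mem.1.finite_right R hR i)),
      ENNReal.mul_lt_top ENNReal.ofReal_lt_top
      (ENNReal.mul_lt_top ENNReal.coe_lt_top (h₂.mem.1.finite_right R hR i))⟩
  · rw [equation_iff hζ]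
    obtain ⟨i1, i2, e⟩ := h₁.rescaled_equation hφ hp hab hα0 0 hζ hζc
    obtain ⟨i1', i2', e'⟩ := h₂.rescaled_equation hφ hp hab hα0' β hζ hζc
    rw [hpre] at i1 i2 e
    rw [hpre'] at i1' i2' e'
    have hb1 : α⁻¹ * (1 - 0) = θ := by rw [hαinv, sub_zero, mul_one]
    have hb0 : α⁻¹ * (0 - 0) = 0 := by simp
    have hb1' : α'⁻¹ * (1 - β) = 1 := by
      rw [mul_sub, hαinv', hβ, hα']
      field_simp
      ring
    have hb0' : α'⁻¹ * (0 - β) = θ := by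
      rw [hαinv', hβ, hα']
      field_simp
      ring
    have hvan : ∀ t : ℝ, t ∉ Ioo (0 : ℝ) 1 → ∀ x, ζ (x, t) = 0 := fun t ht x =>
      image_eq_zero_of_notMem_tsupport fun h => ht (hζs h).2
    have hz : ∀ μ : SignedRadon d, μ.integral (fun _ => (0 : ℝ)) = 0 := fun μ => by
      simp [SignedRadon.integral]
    rw [hb1, hb0] at e
    rw [hb1', hb0'] at e'
    -- The test function vanishes at times `0` and `1`; the remaining boundary terms are `± ∫ ζ(·,θ)
    -- dμ₁` and cancel.
    simp only [hvan 0 (by simp), hz, sub_zero] at e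
    simp only [hvan 1 (by simp), hz, zero_sub] at e'
    have j1 : IntegrableOn (fun s => timeTerm (c.1 s) ζ s) (Ioo 0 θ) :=
      i1.congr_fun (fun s hs => by rw [(hcl s hs).1]) measurableSet_Ioo
    have j2 : IntegrableOn (fun s => spaceTerm (c.2 s) ζ s) (Ioo 0 θ) :=
      i2.congr_fun (fun s hs => by rw [(hcl s hs).2]) measurableSet_Ioo
    have j1' : IntegrableOn (fun s => timeTerm (c.1 s) ζ s) (Ioo θ 1) :=
      i1'.congr_fun (fun s hs => by rw [(hcr s hs).1]) measurableSet_Ioo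
    have j2' : IntegrableOn (fun s => spaceTerm (c.2 s) ζ s) (Ioo θ 1) :=
      i2'.congr_fun (fun s hs => by rw [(hcr s hs).2]) measurableSet_Ioo
    rw [restrict_Ioo_eq_add h0 h1, integral_add_measure j1 j1', integral_add_measure j2 j2',
      setIntegral_congr_fun measurableSet_Ioo fun s hs => by rw [(hcl s hs).1],
      setIntegral_congr_fun (s := Ioo θ 1) (f := fun s => timeTerm (c.1 s) ζ s) measurableSet_Ioo
        fun s hs => by simp only [(hcr s hs).1]; rfl,
      setIntegral_congr_fun (s := Ioo 0 θ) (f := fun s => spaceTerm (c.2 s) ζ s) measurableSet_Ioo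
        fun s hs => by simp only [(hcl s hs).2]; rfl,
      setIntegral_congr_fun (s := Ioo θ 1) (f := fun s => spaceTerm (c.2 s) ζ s) measurableSet_Ioo
        fun s hs => by simp only [(hcr s hs).2]; rfl]
    linarith
  · simp only [hc, if_pos h0.le, mul_zero, zero_add]
    exact h₁.mem.2.1
  · have : α' * 1 + β = 1 := by
      rw [hβ, hα']
      field_simp
      ring
    simp only [hc, if_neg (not_le.2 h1), this]
    exact h₂.mem.2.2.1
  · change energy φ γ c < ⊤
    rw [hE]
    exact ENNReal.add_lt_top.2 ⟨ENNReal.mul_lt_top ENNReal.ofReal_lt_top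
      (ENNReal.mul_lt_top ENNReal.ofReal_lt_top h₁.mem.2.2.2),
      ENNReal.mul_lt_top ENNReal.ofReal_lt_top
      (ENNReal.mul_lt_top ENNReal.ofReal_lt_top h₂.mem.2.2.2)⟩

/-- With `θ = r / (r + s)` both pieces satisfy the same bound on energy per unit of time: `θ^(1-p)
r^p + (1-θ)^(1-p) s^p = (r + s)^p`. No constant-speed reparametrisation of the curves is needed. -/
lemma W_le_of_lt_of_lt (hφ : IsActionDensityOn p a b φ) (hp : 1 < p) (hab : a < b) {r s : ℝ}
    (hr : 0 < r) (hs : 0 < s) (h₁ : W p φ γ μ₀ μ₁ < ENNReal.ofReal r)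
    (h₂ : W p φ γ μ₁ μ₂ < ENNReal.ofReal s) : W p φ γ μ₀ μ₂ ≤ ENNReal.ofReal (r + s) := by
  obtain ⟨c₁, hc₁, hr1⟩ := W_lt_iff.1 h₁
  obtain ⟨c₂, hc₂, hs1⟩ := W_lt_iff.1 h₂
  obtain ⟨c₁', hc₁', e₁⟩ := exists_isRegularCurve hc₁
  obtain ⟨c₂', hc₂', e₂⟩ := exists_isRegularCurve hc₂
  have hp0 : 0 < p := by linarith
  have hrs : 0 < r + s := by positivity
  set θ := r / (r + s) with hθ
  have h0 : 0 < θ := by positivity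
  have h1 : 1 - θ = s / (r + s) := by
    rw [hθ]
    field_simp
    ring
  have h2 : 0 < 1 - θ := by rw [h1]; positivity
  obtain ⟨c, hc, hE⟩ := exists_concat hφ hp hab hc₁' hc₂' h0 (by linarith)
  have k1 := energy_le_of_rpow_lt hp hr hr1
  have k2 := energy_le_of_rpow_lt hp hs hs1
  rw [← e₁] at k1
  rw [← e₂] at k2
  have hEle : energy φ γ c ≤ ENNReal.ofReal ((r + s) ^ p) := by
    rw [hE]
    calc _ ≤ ENNReal.ofReal θ * (ENNReal.ofReal (θ⁻¹ ^ p) * ENNReal.ofReal (r ^ p)) +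
          ENNReal.ofReal (1 - θ) * (ENNReal.ofReal ((1 - θ)⁻¹ ^ p) * ENNReal.ofReal (s ^ p)) := by
          gcongr
      _ = ENNReal.ofReal (θ * (θ⁻¹ ^ p * r ^ p) + (1 - θ) * ((1 - θ)⁻¹ ^ p * s ^ p)) := by
          rw [ENNReal.ofReal_add (by positivity) (by positivity), ENNReal.ofReal_mul h0.le,
            ENNReal.ofReal_mul (by positivity), ENNReal.ofReal_mul h2.le,
            ENNReal.ofReal_mul (by positivity)]
      _ = ENNReal.ofReal ((r + s) ^ p) := by
          have t1 : θ⁻¹ * r = r + s := by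
            rw [hθ]
            field_simp
          have t2 : (1 - θ)⁻¹ * s = r + s := by
            rw [h1]
            field_simp
          rw [← Real.mul_rpow (by positivity) hr.le, ← Real.mul_rpow (by positivity) hs.le, t1, t2]
          congr 1
          ring
  refine (W_le hc).trans ((ENNReal.rpow_le_rpow hEle (by positivity)).trans_eq ?_)
  rw [← ENNReal.ofReal_rpow_of_pos hrs, ← ENNReal.rpow_mul, mul_one_div_cancel hp0.ne',
    ENNReal.rpow_one]

lemma W_triangle (hφ : IsActionDensityOn p a b φ) (hp : 1 < p) (hab : a < b)
    (μ₀ μ₁ μ₂ : SignedRadon d) : W p φ γ μ₀ μ₂ ≤ W p φ γ μ₀ μ₁ + W p φ γ μ₁ μ₂ := by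
  by_cases h1 : W p φ γ μ₀ μ₁ = ⊤
  · simp [h1]
  by_cases h2 : W p φ γ μ₁ μ₂ = ⊤
  · simp [h2]
  refine ENNReal.le_of_forall_pos_le_add fun ε hε _ => ?_
  have hε' : (0 : ℝ) < ε := hε
  set r := (W p φ γ μ₀ μ₁).toReal with hr
  set s := (W p φ γ μ₁ μ₂).toReal with hs
  have hr0 : 0 ≤ r := ENNReal.toReal_nonneg
  have hs0 : 0 ≤ s := ENNReal.toReal_nonneg
  have k1 : W p φ γ μ₀ μ₁ = ENNReal.ofReal r := (ENNReal.ofReal_toReal h1).symm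
  have k2 : W p φ γ μ₁ μ₂ = ENNReal.ofReal s := (ENNReal.ofReal_toReal h2).symm
  have key := W_le_of_lt_of_lt (γ := γ) (μ₀ := μ₀) (μ₁ := μ₁) (μ₂ := μ₂) hφ hp hab
    (r := r + ε / 2) (s := s + ε / 2) (by positivity) (by positivity)
    (by rw [k1]; exact (ENNReal.ofReal_lt_ofReal_iff (by positivity)).2 (by linarith))
    (by rw [k2]; exact (ENNReal.ofReal_lt_ofReal_iff (by positivity)).2 (by linarith))
  refine key.trans_eq ?_
  rw [k1, k2, ← ENNReal.ofReal_coe_nnreal, ← ENNReal.ofReal_add hr0 hs0,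
    ← ENNReal.ofReal_add (by positivity) (by positivity)]
  congr 1
  ring

/-- By Fubini the time integral can be taken first, and it vanishes because `ζ` is zero at times `0`
and `1`. This is the continuity equation for a constant curve. -/
lemma integral_timeTerm_const (μ : SignedRadon d) {ζ : E d × ℝ → ℝ} (hζ : ContDiff ℝ 1 ζ)
    (hζc : HasCompactSupport ζ) (hζs : tsupport ζ ⊆ univ ×ˢ Ioo 0 1) :
    ∫ t in Ioo (0 : ℝ) 1, timeTerm μ ζ t = 0 := by
  have hcont := continuous_fderiv_apply_const hζ ((0, 1) : E d × ℝ)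
  have hcs := hasCompactSupport_fderiv_apply hζc ((0, 1) : E d × ℝ)
  have hvan : ∀ t : ℝ, t ∉ Ioo (0 : ℝ) 1 → ∀ x, ζ (x, t) = 0 := fun t ht x =>
    image_eq_zero_of_notMem_tsupport fun h => ht (hζs h).2
  have key : ∀ m : Measure (E d), IsLocallyFiniteMeasure m →
      Integrable (fun t => ∫ x, fderiv ℝ ζ (x, t) (0, 1) ∂m) (volume.restrict (Ioo (0 : ℝ) 1)) ∧
      ∫ t in Ioo (0 : ℝ) 1, ∫ x, fderiv ℝ ζ (x, t) (0, 1) ∂m = 0 := by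
    intro m _
    have hint : Integrable (Function.uncurry fun (t : ℝ) (x : E d) => fderiv ℝ ζ (x, t) (0, 1))
        ((volume.restrict (Ioo (0 : ℝ) 1)).prod m) := by
      refine Continuous.integrable_of_hasCompactSupport (hcont.comp continuous_swap) ?_
      exact hcs.comp_homeomorph (Homeomorph.prodComm ℝ (E d))
    refine ⟨hint.integral_prod_left, ?_⟩
    rw [integral_integral_swap hint]
    refine integral_eq_zero_of_ae (ae_of_all _ fun x => ?_)
    have := intervalIntegral.integral_eq_sub_of_hasDerivAt (a := 0) (b := 1)
      (fun t _ => deriv_section hζ x t)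
      ((hcont.comp (by fun_prop : Continuous fun t : ℝ => (x, t))).intervalIntegrable _ _)
    rw [hvan 0 (by simp), hvan 1 (by simp), sub_zero,
      intervalIntegral.integral_of_le zero_le_one, integral_Ioc_eq_integral_Ioo] at this
    exact this
  have hp := key μ.pos μ.pos_lf
  have hn := key μ.neg μ.neg_lf
  simp only [timeTerm, SignedRadon.integral]
  rw [integral_sub hp.1 hn.1, hp.2, hn.2, sub_zero]

lemma W_self (hφ : IsActionDensityOn p a b φ) (hp : 1 < p) (hab : a < b) {μ : SignedRadon d}
    (hμ : μ.Between a b γ) : W p φ γ μ μ = 0 := by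
  set c : (ℝ → SignedRadon d) × (ℝ → VectorRadon d) := (fun _ => μ, fun _ _ => μ.scale 0) with hc
  have hE : energy φ γ c = 0 := by
    simp only [energy, hc]
    rw [action_scale_zero hφ hab hμ fun _ => μ]
    simp
  have hmem : c ∈ finiteEnergyCE φ γ 1 μ μ := by
    refine ⟨⟨continuousOn_const, fun i A _ _ => ?_, fun R hR => ?_, fun R hR i => ?_,
      fun ζ hζ hζc hζs => ?_⟩, rfl, rfl, ?_⟩
    · change Measurable fun _ : Ioo (0 : ℝ) 1 => (μ.scale 0).val A
      exact measurable_const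
    · simp only [hc, setLIntegral_const]
      exact ENNReal.mul_lt_top (measure_lt_top_of_isBounded _ Metric.isBounded_ball)
        (by simp)
    · simp [hc, SignedRadon.variation_scale_zero]
    · rw [equation_iff hζ]
      simp only [hc, spaceTerm_scale 0 fun _ => μ, zero_mul, integral_zero, add_zero]
      exact integral_timeTerm_const μ hζ hζc hζs
    · exact hE.trans_lt ENNReal.zero_lt_top
  refine le_antisymm ((W_le hmem).trans_eq ?_) zero_le
  rw [hE, ENNReal.zero_rpow_of_pos (by have : 0 < p := by linarith
                                       positivity)]

end Distance

end GenWass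

end

theorem proposition3p2 {d : ℕ} {p a b : ℝ} (hp : 1 < p) (hab : a < b)
    {φ : ℝ × GenWass.E d → ℝ≥0∞} (hφ : GenWass.IsActionDensityOn p a b φ)
    (γ : Measure (GenWass.E d)) [IsLocallyFiniteMeasure γ] :
    -- symmetry
    (∀ μ₀ μ₁ : GenWass.SignedRadon d, GenWass.W p φ γ μ₀ μ₁ = GenWass.W p φ γ μ₁ μ₀) ∧
    -- triangle inequality
    (∀ μ₀ μ₁ μ₂ : GenWass.SignedRadon d,
      GenWass.W p φ γ μ₀ μ₂ ≤ GenWass.W p φ γ μ₀ μ₁ + GenWass.W p φ γ μ₁ μ₂) ∧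
    -- measures at distance zero coincide
    (∀ μ₀ μ₁ : GenWass.SignedRadon d, GenWass.W p φ γ μ₀ μ₁ = 0 → μ₀ = μ₁) ∧
    -- vanishing on the diagonal over the measures with `a γ ≤ μ ≤ b γ`
    (∀ μ : GenWass.SignedRadon d, μ.Between a b γ → GenWass.W p φ γ μ μ = 0) ∧
    -- all other measures are at infinite distance from every measure
    (∀ μ : GenWass.SignedRadon d, ¬ μ.Between a b γ → ∀ ν, GenWass.W p φ γ μ ν = ⊤) ∧
    -- the topology of `W` is at least as fine as the weak* topology
    GenWass.topologyW p φ γ ≤ GenWass.SignedRadon.weakStar ∧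
    -- bounded sets are weakly* relatively compact
    (∀ B : Set (GenWass.SignedRadon d), GenWass.BoundedW p φ γ B → IsCompact (closure B)) := by
  refine ⟨GenWass.W_symm hφ hp hab, GenWass.W_triangle hφ hp hab,
    fun _ _ => GenWass.eq_of_W_eq_zero hφ hp hab, fun _ => GenWass.W_self hφ hp hab,
    fun μ hμ ν => ?_, GenWass.topologyW_le_weakStar hφ hp hab,
    fun _ => GenWass.isCompact_closure_of_boundedW hφ hp hab⟩
  by_contra h
  exact hμ (GenWass.between_of_W_ne_top hφ hp hab h).1
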